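/- Let $k$ be an algebraically closed field of characteristic zero and $\gamma\ge 1$ an integer. For a monic separable $f\in k[x]$ of degree $2\gamma+1$ let $B$ be the smooth projective model of $y^2=f(x)$, $q$ its point at infinity, and $\mathrm{Jac}(B)$ the group of divisor classes of degree $0$. Let $\Theta_d\subset\mathrm{Jac}(B)$ be the set of classes $[p_1+\dots+p_d-dq]$ with $p_i\in B$, and $\Theta_d^0=\Theta_d\setminus\Theta_{d-1}$ (with $\Theta_{-1}=\emptyset$). The multiplication profile of $x\in\mathrm{Jac}(B)$ is the sequence $m(x)=(\varepsilon_j)_{j\ge1}$ with $jx\in\Theta^0_{\varepsilon_j}$. For integers $M,N$ let $\pi_{M,N}$ be the sequence of period $N$, symmetric under $j\mapsto N-j$, whose $j$-th entry is $\min(j,\gamma,M-j)$ for $0\le j\le N/2$. "General" means: in the complement of the zero set of some polynomial that does not vanish identically on the parameter space. 1. Let $1\le s\le\gamma$, $f=-\tfrac12[(x^{\gamma+s}-x^{\gamma-s+1}+1)^2-x^{2(\gamma+s)}]$. Then $f$ is monic and separable of degree $2\gamma+1$. If $\beta^2=-\tfrac12$ and $p=(0,\beta)$, then $(\gamma+s)[p-q]=\sum_{\xi^{\gamma-s+1}=1}[(\xi,0)-q]$,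 the class $[p-q]$ has order exactly $2\gamma+2s$, and its profile is $\pi_{2\gamma+1,\,2\gamma+2s}$. Every class $[p-q]$ of order $2\gamma+2$ on any such curve has profile $\pi_{2\gamma+1,\,2\gamma+2}$. 2. Let $s,r\ge0$, $s+r=\gamma+1$. For general $(a_1,\dots,a_s,b_1,\dots,b_r)\in k^{s+r}$ we have $\sum a_i+2\sum b_j\ne0$; the polynomial $g=x^{2\gamma+2-s}-\prod(x-a_i)\prod(x-b_j)^2$ is separable of degree $2\gamma+1-s$; and with $c=(\sum a_i+2\sum b_j)^{-1}$, $f=c\prod(x-a_i)\,g$ is monic and separable of degree $2\gamma+1$. If $v=\sqrt{-c}\prod(x-a_i)\prod(x-b_j)$ (either square root) and $p=(0,v(0))$, then $(2\gamma+2-s)[p-q]=\sum_i[(a_i,0)-q]$, which is killed by $2$. If $1\le s\le\gamma$, then $[p-q]$ has order exactly $4\gamma+4-2s$ and profile $\pi_{2\gamma+2,\,4\gamma+4-2s}$. 3. Let $1\le s\le\gamma-1$. For general $(a_1,\dots,a_s,b,c)\in k^{s+2}$ we have $c\neq 0$, the polynomial $g=cx^{2\gamma+1-s}+\prod(x-a_i)(x-b)^2$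 is separable of degree $2\gamma+1-s$, and $f=c^{-1}\prod(x-a_i)\,g$ is monic and separable of degree $2\gamma+1$. If $v=\sqrt{c^{-1}}\prod(x-a_i)(x-b)$ and $p=(0,v(0))$, then $(2\gamma+1-s)[p-q]=\sum_i[(a_i,0)-q]$, and $[p-q]$ has order exactly $4\gamma+2-2s$ and profile $\pi_{2\gamma+1,\,4\gamma+2-2s}$. Among the profiles of all classes $[p'-q]$ of order $4\gamma+2-2s$ on curves as above, this is the unique one for which $\varepsilon_{2\gamma+1-s}$ is minimal, the minimum being $s$. 4. Let $\gamma\ge2$, and let $Z\subset k^{\gamma+2}$ be the set of $(a_1,\dots,a_{\gamma+1},b)$ such that the first two elementary symmetric functions of $a_1,\dots,a_{\gamma+1},b,b$ vanish. For a general point of $Z$ the $a_i$ are pairwise distinct, the $a_i$ and $b$ are nonzero, the polynomial $g=x^{\gamma+3}-\prod(x-a_i)(x-b)^2$ is separable of degree $\gamma$, and, with $c$ its leading coefficient, $f=c^{-1}\prod(x-a_i)\,g$ is monic and separable of degree $2\gamma+1$. If $v=\sqrt{-c^{-1}}\prod(x-a_i)(x-b)$ and $p=(0,v(0))$, then $(\gamma+3)[p-q]=\sum_i[(a_i,0)-q]$,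 and $[p-q]$ has order exactly $2\gamma+6$ and profile $\pi_{2\gamma+3,\,2\gamma+6}$. 5. Let $\gamma\ge2$. The profiles of classes $[p-q]$, $p\ne q$, of order $2\gamma+4$ on curves as above are exactly the two distinct sequences $\pi_{2\gamma+2,\,2\gamma+4}$ and $\pi_{2\gamma+1,\,2\gamma+4}$. 6. Let $\gamma\ge2$. The profile of a class $[p-q]$, $p\neq q$, of order $2\gamma+6$ is one of $\pi_{2\gamma+3,\,2\gamma+6}$, $\pi_{2\gamma+2,\,2\gamma+6}$, $\pi_{2\gamma+1,\,2\gamma+6}$, for which $(\varepsilon_{\gamma+2},\varepsilon_{\gamma+3})$ is $(\gamma,\gamma)$, $(\gamma,\gamma-1)$, $(\gamma-1,\gamma-2)$ respectively. The first two occur for every $\gamma\ge2$. For every $\gamma\ge3$ the third occurs too, so that there are exactly three profiles. -/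

import Mathlib

open Polynomial

noncomputable section

/-- `f` defines a hyperelliptic curve `y² = f(x)` of odd degree and genus `γ`: it is monic and
separable of degree `2γ + 1`. -/
def IsOddHyperelliptic {k : Type*} [Field k] (γ : ℕ) (f : k[X]) : Prop :=
  f.Monic ∧ f.natDegree = 2 * γ + 1 ∧ f.Separable

/-- Points of the smooth projective model of the curve `y² = f(x)` with `f` separable of odd degree:
the affine points, and one point at infinity (the marked Weierstrass point `q`). -/
inductive CurvePoint {k : Type*} [Field k] (f : k[X]) : Type _
  | infty : CurvePoint f
  | affine (a b : k) (h : b ^ 2 = f.eval a) : CurvePoint f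

/-- The affine coordinate ring `k[x, y] / (y² - f(x))`. -/
abbrev CoordRing {k : Type*} [Field k] (f : k[X]) : Type _ :=
  AdjoinRoot (X ^ 2 - C f : k[X][X])

/-- The regular function `A(x) + B(x) y` on the affine curve; every element of the coordinate ring
is of this form for a unique pair `(A, B)`. -/
def regFun {k : Type*} [Field k] (f A B : k[X]) : CoordRing f :=
  AdjoinRoot.of _ A + AdjoinRoot.of _ B * AdjoinRoot.root _

/-- The maximal ideal `(x - a, y - b)` of the point `(a, b)`. -/
def pointIdeal {k : Type*} [Field k] (f : k[X]) (a b : k) : Ideal (CoordRing f) :=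
  Ideal.span {regFun f (X - C a) 0, regFun f (-C b) 1}

open Classical in
/-- The order of vanishing of the nonzero function `A(x) + B(x) y` at a point of the curve.
At an affine point it is the largest `n` such that the function lies in the `n`-th power of the
maximal ideal of the point. At infinity, `x` has a pole of order `2` and `y` has a pole of order
`deg f`, which is odd, so that the pole order of `A(x) + B(x) y` is the maximum of `2 deg A` and
`2 deg B + deg f`, a zero summand being left out. -/
def ordAt {k : Type*} [Field k] (f A B : k[X]) : CurvePoint f → ℤ
  | .affine a b _ => ((sSup {n : ℕ | regFun f A B ∈ pointIdeal f a b ^ n} : ℕ) : ℤ)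
  | .infty =>
      -((max (2 * A.natDegree) (if B = 0 then 0 else 2 * B.natDegree + f.natDegree) : ℕ) : ℤ)

/-- Divisors on the projective curve. -/
abbrev CurveDivisor {k : Type*} [Field k] (f : k[X]) : Type _ := CurvePoint f →₀ ℤ

/-- The degree of a divisor. -/
def divDegree {k : Type*} [Field k] (f : k[X]) : CurveDivisor f →+ ℤ :=
  Finsupp.liftAddHom fun _ => AddMonoidHom.id ℤ

/-- The group of principal divisors, that is, of divisors of nonzero rational functions
`(A₁ + B₁ y) / (A₂ + B₂ y)`. -/
def principalDivisors {k : Type*} [Field k] (f : k[X]) : AddSubgroup (CurveDivisor f) :=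
  AddSubgroup.closure {D | ∃ A₁ B₁ A₂ B₂ : k[X], (A₁ ≠ 0 ∨ B₁ ≠ 0) ∧ (A₂ ≠ 0 ∨ B₂ ≠ 0) ∧
    ∀ P, D P = ordAt f A₁ B₁ P - ordAt f A₂ B₂ P}

/-- The (group of points of the) Jacobian: divisors of degree zero modulo linear equivalence. -/
abbrev CurveJacobian {k : Type*} [Field k] (f : k[X]) : Type _ :=
  (divDegree f).ker ⧸ (principalDivisors f).addSubgroupOf (divDegree f).ker

/-- The class `[P - q]`, where `q` is the point at infinity. -/
def pointClass {k : Type*} [Field k] {f : k[X]} (P : CurvePoint f) : CurveJacobian f :=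
  QuotientAddGroup.mk ⟨Finsupp.single P 1 - Finsupp.single CurvePoint.infty 1, by
    rw [AddMonoidHom.mem_ker, map_sub]; simp [divDegree]⟩

/-- `Θ_d`: the image of the `d`-th Abel–Jacobi map
`(P₁, …, P_d) ↦ [P₁ + ⋯ + P_d - d q]`. -/
def Theta {k : Type*} [Field k] (f : k[X]) (d : ℕ) : Set (CurveJacobian f) :=
  Set.range fun P : Fin d → CurvePoint f => ∑ i, pointClass (P i)

/-- `Θ⁰_d = Θ_d \ Θ_{d-1}`, with `Θ_{-1} = ∅`. -/
def ThetaZero {k : Type*} [Field k] (f : k[X]) : ℕ → Set (CurveJacobian f)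
  | 0 => Theta f 0
  | d + 1 => Theta f (d + 1) \ Theta f d

/-- `ε` is the multiplication profile of `x`: the multiple `j x` lies in `Θ⁰_{ε j}` for all `j`.
(The entry at `j = 0` is included for convenience; it says that `ε 0 = 0`.) -/
def HasMultProfile {k : Type*} [Field k] {f : k[X]} (x : CurveJacobian f) (ε : ℕ → ℕ) : Prop :=
  ∀ j, j • x ∈ ThetaZero f (ε j)

/-- The sequence of period `N`, symmetric under `j ↦ N - j`, with
`ε_j = min (j, γ, M - j)` for `0 ≤ j ≤ N / 2`. Thus, up to `j = N / 2`, it reads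
* `1, 2, …, γ, γ, γ - 1, γ - 2, …` for `M = 2γ + 1`,
* `1, 2, …, γ, γ, γ, γ - 1, γ - 2, …` for `M = 2γ + 2`,
* `1, 2, …, γ, γ, γ, γ, γ - 1, …` for `M = 2γ + 3`. -/
def stairProfile (γ M N j : ℕ) : ℕ :=
  let r := min (j % N) (N - j % N)
  min r (min γ (M - r))

/-- All multiplication profiles of point classes `[p - q]`, `p ≠ q`, of exact order `N` on odd
degree hyperelliptic curves of genus `γ` over `k`. -/
def torsionProfiles (k : Type*) [Field k] (γ N : ℕ) : Set (ℕ → ℕ) :=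
  {ε | ∃ f : k[X], IsOddHyperelliptic γ f ∧ ∃ (a b : k) (h : b ^ 2 = f.eval a),
    addOrderOf (pointClass (.affine a b h)) = N ∧ HasMultProfile (pointClass (.affine a b h)) ε}

/-- The polynomial `-½ [(x^{γ+s} - x^{γ-s+1} + 1)² - x^{2(γ+s)}]`, for `1 ≤ s ≤ γ`. -/
def firstPoly (k : Type*) [Field k] (γ s : ℕ) : k[X] :=
  C (-1 / 2) * ((X ^ (γ + s) - X ^ (γ - s + 1) + 1) ^ 2 - X ^ (2 * (γ + s)))

/-- `∏ (x - a_i)`. -/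
def rootPoly {k : Type*} [Field k] {n : ℕ} (a : Fin n → k) : k[X] := ∏ i, (X - C (a i))

/-- `x^{s+2r} - ∏ (x - a_i) ∏ (x - b_j)²`. -/
def secondAux {k : Type*} [Field k] {s r : ℕ} (a : Fin s → k) (b : Fin r → k) : k[X] :=
  X ^ (s + 2 * r) - rootPoly a * rootPoly b ^ 2

/-- `c x^n + ∏ (x - a_i) (x - b)²`. -/
def thirdAux {k : Type*} [Field k] {s : ℕ} (n : ℕ) (a : Fin s → k) (b c : k) : k[X] :=
  C c * X ^ n + rootPoly a * (X - C b) ^ 2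

/-- `x^{n+2} - ∏ (x - a_i) (x - b)²`. -/
def fourthAux {k : Type*} [Field k] {n : ℕ} (a : Fin n → k) (b : k) : k[X] :=
  X ^ (n + 2) - rootPoly a * (X - C b) ^ 2

/-- The algebraic set of `(a_1, …, a_n, b)` with
`e₁(a_1, …, a_n, b, b) = e₂(a_1, …, a_n, b, b) = 0`. -/
def fourthLocus (k : Type*) [Field k] (n : ℕ) : Set ((Fin n → k) × k) :=
  {z | (Finset.univ.val.map z.1 + {z.2, z.2}).esymm 1 = 0 ∧
    (Finset.univ.val.map z.1 + {z.2, z.2}).esymm 2 = 0}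

end

/-! Everything reduces to counting functions on the affine curve. Since `Theta` is stable under
negation, `j • [p - q]` lies in `Theta f d` exactly when some nonzero function `A + B y` vanishes to
order at least `j` at `p` and has pole order at most `j + d` at infinity (`smul_mem_Theta_iff`,
phrased with `HasFun`). That pole order is the degree of the norm `A² - f B²`, namely the larger of
`2 deg A` and, when `B ≠ 0`, `2 deg B + 2γ + 1`.

Upper bounds for the profile come from three functions: `(x - a)^j` gives `j`, a dimension count in
the spirit of Riemann-Roch gives `γ` (`hasFun_add_genus`), and an explicit `v - y` gives `M - j`.
Lower bounds come from degrees. A pole of order at most `2γ` excludes `y`, so vanishing to order `j`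
costs pole order `2j` (`two_mul_le_of_hasFun`). Just above `2γ` the coefficient of `y` is constant;
comparing a hypothetical function with `v - y` and eliminating `y` (`dvd_cross`) produces a
polynomial in `x` with too many zeros for its degree. The bounds for `j ≤ N / 2`, together with
periodicity and `x ↦ -x`, determine the profile (`hasMultProfile_stair`) and the exact order
(`addOrderOf_eq`).

In each family `v² - f` is a constant times `x^n ∏ (x - w_i)` with the `w_i` roots of `f`. Hence
`div (v - y)` expresses `n [p - q]` as a sum of Weierstrass classes, which are killed by `2`
(`half_order`). For the classification in order `2γ + 6`, `hasFun_step` shows that a small entry at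
`γ + 2` forces a small one at `γ + 3`.

General position is expressed by a discriminant polynomial in the parameters
(`exists_discriminant`); that it is not identically zero is shown by explicit members, found in
one-parameter families of which only finitely many members have double roots.

The orders of vanishing are powers of point ideals, so the valuation theory is built by hand. Its
core is that the ideals `P`, `P'` of a point and its conjugate satisfy `P * P' = (x - a)`
(`pointIdeal_mul_conj`), which yields additivity of orders (`mem_pow_or_of_mul_mem_pow`). -/

noncomputable section

set_option linter.unusedSectionVars false

/-! ### The affine coordinate ring, its norm and its point ideals. -/

section CoordinateRing

variable {k : Type*} [Field k] {f : k[X]}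

/-- The norm `A² - f B²` of the function `A + B y`. -/
def regNorm (f A B : k[X]) : k[X] := A ^ 2 - f * B ^ 2

lemma root_sq (f : k[X]) :
    (AdjoinRoot.root (X ^ 2 - C f : k[X][X])) ^ 2 = AdjoinRoot.of (X ^ 2 - C f) f := by
  have h := AdjoinRoot.eval₂_root (X ^ 2 - C f : k[X][X])
  simpa [sub_eq_zero] using h

lemma regFun_mul (f A B A' B' : k[X]) :
    regFun f A B * regFun f A' B' = regFun f (A * A' + f * (B * B')) (A * B' + B * A') := by
  simp only [regFun, map_add, map_mul, ← root_sq]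
  ring

lemma regFun_add (f A B A' B' : k[X]) :
    regFun f A B + regFun f A' B' = regFun f (A + A') (B + B') := by
  simp only [regFun, map_add]
  ring

lemma regFun_sub (f A B A' B' : k[X]) :
    regFun f A B - regFun f A' B' = regFun f (A - A') (B - B') := by
  simp only [regFun, map_sub]
  ring

lemma regFun_zero (f : k[X]) : regFun f 0 0 = 0 := by simp [regFun]

lemma monic_coordRing (f : k[X]) : (X ^ 2 - C f : k[X][X]).Monic :=
  monic_X_pow_sub_C f two_ne_zero

lemma regFun_eq_mk (f A B : k[X]) :
    regFun f A B = AdjoinRoot.mk (X ^ 2 - C f) (C B * X + C A) := by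
  simp [regFun, add_comm]

lemma regFun_eq_zero {A B : k[X]} (h : regFun f A B = 0) : A = 0 ∧ B = 0 := by
  by_contra hne
  have hne' : (C B * X + C A : k[X][X]) ≠ 0 := by
    intro h0
    apply hne
    constructor
    · simpa using congrArg (fun p => p.coeff 0) h0
    · simpa using congrArg (fun p => p.coeff 1) h0
  refine AdjoinRoot.mk_ne_zero_of_natDegree_lt (monic_coordRing f) hne' ?_ (regFun_eq_mk f A B ▸ h)
  rw [natDegree_X_pow_sub_C]
  exact lt_of_le_of_lt natDegree_linear_le one_lt_two

lemma regFun_injective {A B A' B' : k[X]} (h : regFun f A B = regFun f A' B') :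
    A = A' ∧ B = B' := by
  rw [← sub_eq_zero, regFun_sub] at h
  simpa [sub_eq_zero] using regFun_eq_zero h

lemma regFun_surjective (z : CoordRing f) : ∃ A B, z = regFun f A B := by
  obtain ⟨p, rfl⟩ := AdjoinRoot.mk_surjective z
  have hd : (p %ₘ (X ^ 2 - C f)).natDegree < 2 := by
    have := natDegree_modByMonic_lt p (monic_coordRing f) (by
      intro h
      have := congrArg natDegree h
      rw [natDegree_X_pow_sub_C] at this
      simp at this)
    rwa [natDegree_X_pow_sub_C] at this
  refine ⟨(p %ₘ (X ^ 2 - C f)).coeff 0, (p %ₘ (X ^ 2 - C f)).coeff 1, ?_⟩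
  rw [regFun_eq_mk, ← eq_X_add_C_of_natDegree_le_one (by omega), AdjoinRoot.mk_eq_mk]
  exact ⟨p /ₘ (X ^ 2 - C f), by
    rw [sub_eq_iff_eq_add, add_comm, modByMonic_add_div]⟩

/-- The hyperelliptic involution on functions. -/
def conjHom (f : k[X]) : CoordRing f →+* CoordRing f :=
  AdjoinRoot.lift (AdjoinRoot.of _) (-AdjoinRoot.root _) (by simp [root_sq])

lemma conjHom_regFun (A B : k[X]) : conjHom f (regFun f A B) = regFun f A (-B) := by
  simp [conjHom, regFun]

lemma regFun_mul_conj (A B : k[X]) :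
    regFun f A B * regFun f A (-B) = regFun f (regNorm f A B) 0 := by
  rw [regFun_mul, regNorm]
  congr 1 <;> ring

lemma regNorm_conj (A B : k[X]) : regNorm f A (-B) = regNorm f A B := by
  simp [regNorm]

lemma regNorm_mul (A B A' B' : k[X]) :
    regNorm f (A * A' + f * (B * B')) (A * B' + B * A') = regNorm f A B * regNorm f A' B' := by
  simp only [regNorm]
  ring

/-- Evaluation of functions at an affine point. -/
def evalPoint (a b : k) (h : b ^ 2 = f.eval a) : CoordRing f →+* k :=
  AdjoinRoot.lift (evalRingHom a) b (by simp [h])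

lemma evalPoint_regFun (a b : k) (h : b ^ 2 = f.eval a) (A B : k[X]) :
    evalPoint a b h (regFun f A B) = A.eval a + B.eval a * b := by
  simp [evalPoint, regFun]

lemma pointIdeal_eq_ker (a b : k) (h : b ^ 2 = f.eval a) :
    pointIdeal f a b = RingHom.ker (evalPoint a b h) := by
  apply le_antisymm
  · rw [pointIdeal, Ideal.span_le]
    rintro z (rfl | rfl) <;> simp [RingHom.mem_ker, evalPoint_regFun]
  · intro z hz
    obtain ⟨A, B, rfl⟩ := regFun_surjective z
    rw [RingHom.mem_ker, evalPoint_regFun] at hz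
    obtain ⟨A₁, hA⟩ := X_sub_C_dvd_sub_C_eval (a := a) (p := A)
    obtain ⟨B₁, hB⟩ := X_sub_C_dvd_sub_C_eval (a := a) (p := B)
    have hC : C (A.eval a) = - (C (B.eval a) * C b) := by
      rw [← C_mul, ← C_neg, eq_neg_of_add_eq_zero_left hz]
    refine Ideal.mem_span_pair.2 ⟨regFun f A₁ B₁, regFun f (C (B.eval a)) 0, ?_⟩
    rw [regFun_mul, regFun_mul, regFun_add]
    congr 1
    · linear_combination -hA - hC
    · linear_combination -hB

lemma mem_pointIdeal (a b : k) (h : b ^ 2 = f.eval a) (A B : k[X]) :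
    regFun f A B ∈ pointIdeal f a b ↔ A.eval a + B.eval a * b = 0 := by
  rw [pointIdeal_eq_ker a b h, RingHom.mem_ker, evalPoint_regFun]

lemma pointIdeal_isPrime (a b : k) (h : b ^ 2 = f.eval a) : (pointIdeal f a b).IsPrime := by
  rw [pointIdeal_eq_ker a b h]
  exact RingHom.ker_isPrime _

lemma map_conj_pointIdeal (a b : k) :
    (pointIdeal f a b).map (conjHom f) ≤ pointIdeal f a (-b) := by
  rw [pointIdeal, Ideal.map_span, Ideal.span_le]
  rintro _ ⟨z, (rfl | rfl), rfl⟩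
  · rw [conjHom_regFun, neg_zero]
    exact Ideal.subset_span (by simp)
  · rw [conjHom_regFun]
    have : regFun f (-C b) (-1) = -regFun f (-C (-b)) 1 := by simp [regFun]; ring
    rw [this]
    exact neg_mem (Ideal.subset_span (by simp))

lemma conj_mem_pow {a b : k} {n : ℕ} {A B : k[X]} (h : regFun f A B ∈ pointIdeal f a b ^ n) :
    regFun f A (-B) ∈ pointIdeal f a (-b) ^ n := by
  rw [← conjHom_regFun]
  have := Ideal.mem_map_of_mem (conjHom f) h
  rw [Ideal.map_pow] at this
  exact Ideal.pow_right_mono (map_conj_pointIdeal a b) n this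

/-- This makes point ideals invertible. Away from Weierstrass points `2b (x - a)` is the difference
of `(x - a)(y + b)` and `(y - b)(x - a)`. At a Weierstrass point `y² = (x - a) f₁` with `f₁(a) ≠ 0`
by separability, so `x - a` is a combination of `y²` and `(x - a)²`. -/
lemma pointIdeal_mul_conj [NeZero (2 : k)] (hf : f.Separable) (a b : k) (h : b ^ 2 = f.eval a) :
    pointIdeal f a b * pointIdeal f a (-b) = Ideal.span {regFun f (X - C a) 0} := by
  obtain ⟨f₁, hf₁⟩ := X_sub_C_dvd_sub_C_eval (a := a) (p := f)
  have hfe : f = (X - C a) * f₁ + C b ^ 2 := by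
    rw [← C_pow, h]
    linear_combination hf₁
  apply le_antisymm
  · rw [pointIdeal, pointIdeal, Ideal.span_pair_mul_span_pair, Ideal.span_le]
    have key : ∀ A B : k[X], regFun f ((X - C a) * A) ((X - C a) * B) ∈
        Ideal.span {regFun f (X - C a) 0} := fun A B =>
      Ideal.mem_span_singleton.2 ⟨regFun f A B, by rw [regFun_mul]; simp⟩
    rintro z (rfl | rfl | rfl | rfl) <;> rw [SetLike.mem_coe, regFun_mul] <;>
      try simp only [C_neg]
    · convert key (X - C a) 0 using 2 <;> ring1
    · convert key (C b) 1 using 2 <;> ring1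
    · convert key (-C b) 1 using 2 <;> ring1
    · convert key f₁ 0 using 2
      · linear_combination hfe
      · ring1
  · set J := pointIdeal f a b * pointIdeal f a (-b) with hJ
    have m₁ : regFun f (X - C a) 0 ∈ pointIdeal f a b := Ideal.subset_span (by simp)
    have m₂ : regFun f (-C b) 1 ∈ pointIdeal f a b := Ideal.subset_span (by simp)
    have m₁' : regFun f (X - C a) 0 ∈ pointIdeal f a (-b) := Ideal.subset_span (by simp)
    have m₂' : regFun f (C b) 1 ∈ pointIdeal f a (-b) := Ideal.subset_span (by simp)
    have e₁ := Ideal.mul_mem_mul m₁ m₂'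
    have e₂ := Ideal.mul_mem_mul m₂ m₁'
    have e₃ := Ideal.mul_mem_mul m₂ m₂'
    have e₄ := Ideal.mul_mem_mul m₁ m₁'
    rw [← hJ, regFun_mul] at e₁ e₂ e₃ e₄
    rw [Ideal.span_singleton_le_iff_mem]
    by_cases hb : b = 0
    · have hd : f₁.eval a ≠ 0 := by
        intro h0
        have hx : f = (X - C a) * f₁ := by simpa [hb] using hfe
        obtain ⟨f₂, rfl⟩ := dvd_iff_isRoot.2 h0
        have hu := hf.squarefree (X - C a) ⟨f₂, by rw [hx]; ring⟩
        exact not_isUnit_X_sub_C a hu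
      obtain ⟨f₂, hf₂⟩ := X_sub_C_dvd_sub_C_eval (a := a) (p := f₁)
      have : regFun f (X - C a) 0 = regFun f (C (f₁.eval a)⁻¹) 0 *
          (regFun f (-C b * C b + f * (1 * 1)) (-C b * 1 + 1 * C b) - regFun f f₂ 0 *
            regFun f ((X - C a) * (X - C a) + f * (0 * 0)) ((X - C a) * 0 + 0 * (X - C a))) := by
        rw [regFun_mul, regFun_sub, regFun_mul]
        have hc : C (f₁.eval a)⁻¹ * C (f₁.eval a) = 1 := by
          rw [← C_mul, inv_mul_cancel₀ hd, C_1]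
        congr 1
        · simp only [hb, C_0] at hfe ⊢
          linear_combination (-(X - C a)) * hc - C (f₁.eval a)⁻¹ * hfe
             - C (f₁.eval a)⁻¹ * (X - C a) * hf₂
        · simp [hb]
      rw [this]
      exact J.mul_mem_left _ (J.sub_mem e₃ (J.mul_mem_left _ e₄))
    · have : regFun f (X - C a) 0 = regFun f (C (2 * b)⁻¹) 0 *
          (regFun f ((X - C a) * C b + f * (0 * 1)) ((X - C a) * 1 + 0 * C b) -
          regFun f (-C b * (X - C a) + f * (1 * 0)) (-C b * 0 + 1 * (X - C a))) := by
        rw [regFun_sub, regFun_mul]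
        have hc : C (2 * b)⁻¹ * (2 * C b) = 1 := by
          rw [← map_ofNat C, ← C_mul, ← C_mul, inv_mul_cancel₀ (mul_ne_zero two_ne_zero hb), C_1]
        congr 1
        · linear_combination (-(X - C a)) * hc
        · ring
      rw [this]
      exact J.mul_mem_left _ (J.sub_mem e₁ e₂)

/-- Multiplying by the conjugate lands in `(P P')^n`, which is generated by `(x - a)^n`. -/
lemma dvd_regNorm_of_mem_pow [NeZero (2 : k)] (hf : f.Separable) {a b : k} (h : b ^ 2 = f.eval a)
    {n : ℕ} {A B : k[X]} (hm : regFun f A B ∈ pointIdeal f a b ^ n) :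
    (X - C a) ^ n ∣ regNorm f A B := by
  have := Ideal.mul_mem_mul hm (conj_mem_pow hm)
  rw [← mul_pow, pointIdeal_mul_conj hf a b h, Ideal.span_singleton_pow, regFun_mul_conj,
    Ideal.mem_span_singleton] at this
  obtain ⟨z, hz⟩ := this
  obtain ⟨A', B', rfl⟩ := regFun_surjective z
  have hp : ∀ m : ℕ, regFun f (X - C a) 0 ^ m = regFun f ((X - C a) ^ m) 0 := fun m => by
    simp [regFun]
  rw [hp, regFun_mul] at hz
  exact ⟨A', by simpa using (regFun_injective hz).1⟩

end CoordinateRing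

/-! ### Valuation property of an invertible prime ideal. -/

section InvertiblePrime

variable {R : Type*} [CommRing R] {P P' : Ideal R} {t : R}

/-- If every cofactor stayed in `P`, then `z P'^n ⊆ t^n P`; multiplying by `P^n` and cancelling
`t^n` would put `z` in `P^(n+1)`. -/
lemma exists_cofactor_not_mem (ht : t ∈ nonZeroDivisors R) (hPP : P * P' = Ideal.span {t})
    {n : ℕ} {z : R} (hz : z ∈ P ^ n) (hz' : z ∉ P ^ (n + 1)) :
    ∃ u ∈ P' ^ n, ∃ z', z * u = t ^ n * z' ∧ z' ∉ P := by
  by_contra! hcon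
  apply hz'
  have hle : Ideal.span {z} * P' ^ n ≤ Ideal.span {t ^ n} * P := by
    rw [Ideal.span_singleton_mul_le_iff]
    intro u hu
    have hm : z * u ∈ Ideal.span {t ^ n} := by
      rw [← Ideal.span_singleton_pow, ← hPP, mul_pow]
      exact Ideal.mul_mem_mul hz hu
    obtain ⟨z', hz'⟩ := Ideal.mem_span_singleton.1 hm
    rw [Ideal.mem_span_singleton_mul]
    exact ⟨z', hcon u hu z' hz', hz'.symm⟩
  have h2 := Ideal.mul_mono hle (le_refl (P ^ n))
  rw [mul_assoc, mul_assoc, ← mul_pow, mul_comm P' P, hPP, Ideal.span_singleton_pow,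
    ← pow_succ'] at h2
  have h3 : z * t ^ n ∈ Ideal.span {z} * Ideal.span {t ^ n} :=
    Ideal.mul_mem_mul (Ideal.mem_span_singleton_self _) (Ideal.mem_span_singleton_self _)
  obtain ⟨y, hy, he⟩ := Ideal.mem_span_singleton_mul.1 (h2 h3)
  have : y = z := by
    rw [mul_comm z] at he
    exact (mul_cancel_left_mem_nonZeroDivisors (pow_mem ht n)).1 he
  rwa [← this]

/-- The cofactors strip `P^n` and `P^m` off `z` and `w`, leaving elements outside `P`. One factor
`P` too many in `z w` would put their product in `P`, against primality. -/
lemma mem_pow_or_of_mul_mem_pow (ht : t ∈ nonZeroDivisors R) (hPP : P * P' = Ideal.span {t})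
    (hP : P.IsPrime) {n m : ℕ} {z w : R} (hz : z ∈ P ^ n) (hw : w ∈ P ^ m)
    (hzw : z * w ∈ P ^ (n + m + 1)) : z ∈ P ^ (n + 1) ∨ w ∈ P ^ (m + 1) := by
  by_contra! hcon
  obtain ⟨u, hu, z', hz', hzP⟩ := exists_cofactor_not_mem ht hPP hz hcon.1
  obtain ⟨v, hv, w', hw', hwP⟩ := exists_cofactor_not_mem ht hPP hw hcon.2
  have h1 : (z * w) * (u * v) ∈ P ^ (n + m + 1) * (P' ^ (n + m)) :=
    Ideal.mul_mem_mul hzw (by rw [pow_add]; exact Ideal.mul_mem_mul hu hv)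
  rw [pow_succ' P, mul_assoc, ← mul_pow, hPP, Ideal.span_singleton_pow, mul_comm P] at h1
  obtain ⟨y, hy, he⟩ := Ideal.mem_span_singleton_mul.1 h1
  have h2 : y = z' * w' := by
    apply (mul_cancel_left_mem_nonZeroDivisors (pow_mem ht (n + m))).1
    rw [he, pow_add]
    linear_combination w * v * hz' + t ^ n * z' * hw'
  rw [h2] at hy
  exact (hP.mem_or_mem hy).elim hzP hwP

end InvertiblePrime

/-! ### Orders of vanishing and their additivity. -/

section Orders

variable {k : Type*} [Field k] [CharZero k] {γ : ℕ} {f : k[X]}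

open Classical in
-- The degrees of `A²` and `f B²` have different parity, so leading terms never cancel.
lemma natDegree_regNorm (hf : IsOddHyperelliptic γ f) (A B : k[X]) :
    (regNorm f A B).natDegree =
      max (2 * A.natDegree) (if B = 0 then 0 else 2 * B.natDegree + f.natDegree) := by
  have hf0 : f ≠ 0 := hf.1.ne_zero
  unfold regNorm
  split_ifs with hB
  · simp [hB]
  · have hfB : (f * B ^ 2).natDegree = 2 * B.natDegree + f.natDegree := by
      rw [natDegree_mul hf0 (pow_ne_zero 2 hB), natDegree_pow, add_comm]
    have hA : (A ^ 2).natDegree = 2 * A.natDegree := natDegree_pow A 2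
    have hd := hf.2.1
    rcases lt_or_ge (2 * A.natDegree) (2 * B.natDegree + f.natDegree) with h | h
    · rw [natDegree_sub_eq_right_of_natDegree_lt (by omega), hfB, max_eq_right h.le]
    · rw [natDegree_sub_eq_left_of_natDegree_lt (by omega), hA, max_eq_left h]

lemma regNorm_ne_zero (hf : IsOddHyperelliptic γ f) {A B : k[X]} (h : A ≠ 0 ∨ B ≠ 0) :
    regNorm f A B ≠ 0 := by
  intro h0
  have hd := hf.2.1
  have h1 := natDegree_regNorm hf A B
  rw [h0, natDegree_zero] at h1
  by_cases hB : B = 0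
  · simp [regNorm, hB] at h0
    tauto
  · rw [if_neg hB] at h1
    have := le_max_right (2 * A.natDegree) (2 * B.natDegree + f.natDegree)
    omega

lemma ne_zero_of_regNorm_ne_zero {A B : k[X]} (h : regNorm f A B ≠ 0) : A ≠ 0 ∨ B ≠ 0 := by
  by_contra! hcon
  simp [regNorm, hcon.1, hcon.2] at h

lemma mul_ne_zero_pair (hf : IsOddHyperelliptic γ f) {A B A' B' : k[X]} (h : A ≠ 0 ∨ B ≠ 0)
    (h' : A' ≠ 0 ∨ B' ≠ 0) : A * A' + f * (B * B') ≠ 0 ∨ A * B' + B * A' ≠ 0 := by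
  apply ne_zero_of_regNorm_ne_zero (f := f)
  rw [regNorm_mul]
  exact mul_ne_zero (regNorm_ne_zero hf h) (regNorm_ne_zero hf h')

lemma conj_ne_zero_pair {A B : k[X]} (h : A ≠ 0 ∨ B ≠ 0) : A ≠ 0 ∨ -B ≠ 0 := by
  simpa using h

lemma X_sub_C_mem_nonZeroDivisors (f : k[X]) (a : k) :
    regFun f (X - C a) 0 ∈ nonZeroDivisors (CoordRing f) := by
  rw [mem_nonZeroDivisors_iff_right]
  intro z hz
  obtain ⟨A, B, rfl⟩ := regFun_surjective z
  rw [regFun_mul] at hz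
  have := regFun_eq_zero hz
  have hX := X_sub_C_ne_zero a
  simp only [mul_zero, add_zero, zero_add, mul_eq_zero, hX, or_false] at this
  rw [this.1, this.2, regFun_zero]

/-- The degree of the norm bounds the exponents, so the supremum in `ordAt` is an attained maximum
and not a default value. -/
lemma mem_pow_iff_le_ordAt (hf : IsOddHyperelliptic γ f) {a b : k} (h : b ^ 2 = f.eval a)
    {A B : k[X]} (hAB : A ≠ 0 ∨ B ≠ 0) (n : ℕ) :
    regFun f A B ∈ pointIdeal f a b ^ n ↔ (n : ℤ) ≤ ordAt f A B (.affine a b h) := by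
  set S := {n : ℕ | regFun f A B ∈ pointIdeal f a b ^ n} with hS
  have hbdd : BddAbove S := by
    refine ⟨(regNorm f A B).natDegree, fun m hm => ?_⟩
    have := natDegree_le_of_dvd (dvd_regNorm_of_mem_pow hf.2.2 h hm) (regNorm_ne_zero hf hAB)
    rwa [natDegree_pow, natDegree_X_sub_C, mul_one] at this
  have hne : S.Nonempty := ⟨0, by simp [hS]⟩
  simp only [ordAt, Nat.cast_le]
  exact ⟨fun hm => le_csSup hbdd hm, fun hm => Ideal.pow_le_pow_right hm (Nat.sSup_mem hne hbdd)⟩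

lemma ordAt_affine_nonneg {a b : k} (h : b ^ 2 = f.eval a) (A B : k[X]) :
    0 ≤ ordAt f A B (.affine a b h) := by
  simp [ordAt]

lemma ordAt_eq_of_mem {a b : k} (hf : IsOddHyperelliptic γ f) (h : b ^ 2 = f.eval a)
    {A B : k[X]} (hAB : A ≠ 0 ∨ B ≠ 0) {n : ℕ} (h1 : regFun f A B ∈ pointIdeal f a b ^ n)
    (h2 : regFun f A B ∉ pointIdeal f a b ^ (n + 1)) : ordAt f A B (.affine a b h) = n := by
  rw [mem_pow_iff_le_ordAt hf h hAB] at h1 h2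
  push_cast at h2
  omega

lemma ordAt_infty (hf : IsOddHyperelliptic γ f) (A B : k[X]) :
    ordAt f A B .infty = -((regNorm f A B).natDegree : ℤ) := by
  rw [natDegree_regNorm hf]
  simp only [ordAt]

lemma ordAt_mul (hf : IsOddHyperelliptic γ f) {A B A' B' : k[X]} (hAB : A ≠ 0 ∨ B ≠ 0)
    (hAB' : A' ≠ 0 ∨ B' ≠ 0) (P : CurvePoint f) :
    ordAt f (A * A' + f * (B * B')) (A * B' + B * A') P =
      ordAt f A B P + ordAt f A' B' P := by
  match P with
  | .infty =>
    rw [ordAt_infty hf, ordAt_infty hf, ordAt_infty hf, regNorm_mul,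
      natDegree_mul (regNorm_ne_zero hf hAB) (regNorm_ne_zero hf hAB')]
    push_cast
    ring
  | .affine a b h =>
    obtain ⟨n, hn⟩ := Int.eq_ofNat_of_zero_le (ordAt_affine_nonneg h A B)
    obtain ⟨m, hm⟩ := Int.eq_ofNat_of_zero_le (ordAt_affine_nonneg h A' B')
    have h1 := (mem_pow_iff_le_ordAt hf h hAB n).2 hn.ge
    have h2 := (mem_pow_iff_le_ordAt hf h hAB' m).2 hm.ge
    rw [hn, hm, ← Nat.cast_add]
    apply ordAt_eq_of_mem hf h (mul_ne_zero_pair hf hAB hAB')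
    · rw [← regFun_mul, pow_add]
      exact Ideal.mul_mem_mul h1 h2
    · rw [← regFun_mul]
      intro hmem
      rcases mem_pow_or_of_mul_mem_pow (X_sub_C_mem_nonZeroDivisors f a)
        (pointIdeal_mul_conj hf.2.2 a b h) (pointIdeal_isPrime a b h) h1 h2 hmem with h3 | h3
      · rw [mem_pow_iff_le_ordAt hf h hAB, hn] at h3
        push_cast at h3
        omega
      · rw [mem_pow_iff_le_ordAt hf h hAB', hm] at h3
        push_cast at h3
        omega

/-- The hyperelliptic involution on points. -/
def CurvePoint.inv : CurvePoint f → CurvePoint f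
  | .infty => .infty
  | .affine a b h => .affine a (-b) (by rw [neg_sq, h])

lemma CurvePoint.inv_inv (P : CurvePoint f) : P.inv.inv = P := by
  cases P <;> simp [CurvePoint.inv]

lemma ordAt_conj_le (hf : IsOddHyperelliptic γ f) {A B : k[X]} (hAB : A ≠ 0 ∨ B ≠ 0)
    (P : CurvePoint f) : ordAt f A B P ≤ ordAt f A (-B) P.inv := by
  match P with
  | .infty =>
    rw [CurvePoint.inv, ordAt_infty hf, ordAt_infty hf, regNorm_conj]
  | .affine a b h =>
    obtain ⟨n, hn⟩ := Int.eq_ofNat_of_zero_le (ordAt_affine_nonneg h A B)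
    rw [hn, CurvePoint.inv, ← mem_pow_iff_le_ordAt hf _ (conj_ne_zero_pair hAB)]
    exact conj_mem_pow ((mem_pow_iff_le_ordAt hf h hAB n).2 hn.ge)

lemma ordAt_conj (hf : IsOddHyperelliptic γ f) {A B : k[X]} (hAB : A ≠ 0 ∨ B ≠ 0)
    (P : CurvePoint f) : ordAt f A (-B) P = ordAt f A B P.inv := by
  apply le_antisymm
  · simpa using ordAt_conj_le hf (conj_ne_zero_pair hAB) P
  · simpa [CurvePoint.inv_inv] using ordAt_conj_le hf hAB P.inv

lemma ordAt_pos_iff (hf : IsOddHyperelliptic γ f) {a b : k} (h : b ^ 2 = f.eval a)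
    {A B : k[X]} (hAB : A ≠ 0 ∨ B ≠ 0) :
    1 ≤ ordAt f A B (.affine a b h) ↔ A.eval a + B.eval a * b = 0 := by
  rw [← mem_pointIdeal a b h, ← pow_one (pointIdeal f a b), mem_pow_iff_le_ordAt hf h hAB,
    Nat.cast_one]

lemma ordAt_eq_zero (hf : IsOddHyperelliptic γ f) {a b : k} (h : b ^ 2 = f.eval a)
    {A B : k[X]} (hAB : A.eval a + B.eval a * b ≠ 0) : ordAt f A B (.affine a b h) = 0 := by
  have h0 : A ≠ 0 ∨ B ≠ 0 := by
    by_contra! hcon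
    simp [hcon.1, hcon.2] at hAB
  have := mt (ordAt_pos_iff hf h h0).1 hAB
  have := ordAt_affine_nonneg h A B
  omega

lemma X_sub_C_pair (a : k) : (X - C a : k[X]) ≠ 0 ∨ (0 : k[X]) ≠ 0 := .inl (X_sub_C_ne_zero a)

lemma X_sub_C_not_mem_pow_three (hf : IsOddHyperelliptic γ f) {a b : k} (h : b ^ 2 = f.eval a) :
    regFun f (X - C a) 0 ∉ pointIdeal f a b ^ 3 := by
  intro hmem
  have := natDegree_le_of_dvd (dvd_regNorm_of_mem_pow hf.2.2 h hmem)
    (regNorm_ne_zero hf (X_sub_C_pair a))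
  simp [regNorm, natDegree_pow] at this

open Classical in
lemma ordAt_X_sub_C_self (hf : IsOddHyperelliptic γ f) {a b : k} (h : b ^ 2 = f.eval a) :
    ordAt f (X - C a) 0 (.affine a b h) = if b = 0 then 2 else 1 := by
  have hmul := pointIdeal_mul_conj hf.2.2 a b h
  have hx : regFun f (X - C a) 0 ∈ pointIdeal f a b := Ideal.subset_span (by simp)
  split_ifs with hb
  · apply ordAt_eq_of_mem hf h (X_sub_C_pair a) (n := 2) _ (X_sub_C_not_mem_pow_three hf h)
    subst hb
    rw [neg_zero] at hmul
    rw [pow_two (pointIdeal f a 0), hmul]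
    exact Ideal.mem_span_singleton_self _
  · apply ordAt_eq_of_mem hf h (X_sub_C_pair a) (n := 1) (by simpa using hx)
    intro hmem
    -- With `x - a ∈ P²`, every `z ∈ P` has `z (y + b) ∈ P P' ⊆ P²`, while `y + b` takes the value
    -- `2b ≠ 0` at the point. So `P = P² = P³`, which contradicts the norm bound for `x - a`.
    have hle : pointIdeal f a b ≤ pointIdeal f a b ^ 2 := by
      intro z hz
      have hy : regFun f (C b) 1 ∈ pointIdeal f a (-b) := Ideal.subset_span (by simp)
      have hz1 : z ∈ pointIdeal f a b ^ 1 := by rwa [pow_one]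
      have hy0 : regFun f (C b) 1 ∈ pointIdeal f a b ^ 0 := by
        rw [pow_zero, Ideal.one_eq_top]
        exact Submodule.mem_top
      have h1 : z * regFun f (C b) 1 ∈ pointIdeal f a b ^ (1 + 0 + 1) := by
        have h2 := Ideal.mul_mem_mul hz hy
        rw [hmul] at h2
        exact (Ideal.span_singleton_le_iff_mem _).2 hmem h2
      rcases mem_pow_or_of_mul_mem_pow (X_sub_C_mem_nonZeroDivisors f a) hmul
        (pointIdeal_isPrime a b h) hz1 hy0 h1 with h2 | h2
      · exact h2
      · rw [zero_add, pow_one, mem_pointIdeal a b h] at h2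
        simp [← two_mul, hb] at h2
    have hle3 : pointIdeal f a b ≤ pointIdeal f a b ^ 3 := by
      calc pointIdeal f a b ≤ pointIdeal f a b ^ 2 := hle
        _ = pointIdeal f a b * pointIdeal f a b := pow_two _
        _ ≤ pointIdeal f a b * pointIdeal f a b ^ 2 := Ideal.mul_mono_right hle
        _ = pointIdeal f a b ^ 3 := (pow_succ' _ 2).symm
    exact X_sub_C_not_mem_pow_three hf h (hle3 hx)

end Orders

/-! ### Divisors of functions and principal divisors. -/

lemma divDegree_single {k : Type*} [Field k] {f : k[X]} (P : CurvePoint f) (n : ℤ) :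
    divDegree f (Finsupp.single P n) = n := by
  simp [divDegree]

section Divisors

variable {k : Type*} [Field k] [CharZero k] {γ : ℕ} {f : k[X]}

lemma finite_points_over (f : k[X]) (S : Set k) (hS : S.Finite) :
    {P : CurvePoint f | ∀ a b h, P = .affine a b h → a ∈ S}.Finite := by
  let φ : CurvePoint f → Option (k × k) := fun P => match P with
    | .infty => none
    | .affine a b _ => some (a, b)
  have hφ : Function.Injective φ := by
    intro P Q h
    cases P <;> cases Q <;> simp_all [φ]
  have hT : (⋃ a ∈ S, {b : k | b ^ 2 = f.eval a}).Finite := by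
    refine hS.biUnion fun a _ => ?_
    have : (X ^ 2 - C (f.eval a) : k[X]) ≠ 0 := X_pow_sub_C_ne_zero two_pos _
    refine ((X ^ 2 - C (f.eval a) : k[X]).rootSet_finite k).subset fun b hb => ?_
    rw [mem_rootSet]
    exact ⟨this, by simpa [sub_eq_zero] using hb⟩
  refine (((hS.prod hT).image some).union (Set.finite_singleton none)).preimage
    (f := φ) hφ.injOn |>.subset ?_
  intro P hP
  cases P with
  | infty => simp [φ]
  | affine a b h =>
    have ha := hP a b h rfl
    left
    exact ⟨(a, b), ⟨ha, Set.mem_biUnion ha h⟩, rfl⟩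

lemma finite_support_ordAt (hf : IsOddHyperelliptic γ f) {A B : k[X]} (hAB : A ≠ 0 ∨ B ≠ 0) :
    (Function.support (ordAt f A B)).Finite := by
  refine (finite_points_over f _ ((regNorm f A B).rootSet_finite k)).subset ?_
  rintro P hP a b h rfl
  rw [mem_rootSet]
  refine ⟨regNorm_ne_zero hf hAB, ?_⟩
  have h1 : 1 ≤ ordAt f A B (.affine a b h) := by
    have := ordAt_affine_nonneg h A B
    have : ordAt f A B (.affine a b h) ≠ 0 := hP
    omega
  rw [ordAt_pos_iff hf h hAB] at h1
  simp only [regNorm, coe_aeval_eq_eval, eval_sub, eval_pow, eval_mul, ← h]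
  linear_combination (A.eval a - B.eval a * b) * h1

open Classical in
/-- The divisor of the function `A + B y`. -/
def funDivisor (f A B : k[X]) : CurveDivisor f :=
  if h : (Function.support (ordAt f A B)).Finite then Finsupp.ofSupportFinite _ h else 0

lemma funDivisor_apply (hf : IsOddHyperelliptic γ f) {A B : k[X]} (hAB : A ≠ 0 ∨ B ≠ 0)
    (P : CurvePoint f) : funDivisor f A B P = ordAt f A B P := by
  rw [funDivisor, dif_pos (finite_support_ordAt hf hAB)]
  rfl

lemma funDivisor_mul (hf : IsOddHyperelliptic γ f) {A B A' B' : k[X]} (hAB : A ≠ 0 ∨ B ≠ 0)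
    (hAB' : A' ≠ 0 ∨ B' ≠ 0) :
    funDivisor f (A * A' + f * (B * B')) (A * B' + B * A') =
      funDivisor f A B + funDivisor f A' B' := by
  ext P
  rw [Finsupp.add_apply, funDivisor_apply hf hAB, funDivisor_apply hf hAB',
    funDivisor_apply hf (mul_ne_zero_pair hf hAB hAB'), ordAt_mul hf hAB hAB']

lemma funDivisor_poly_mul (hf : IsOddHyperelliptic γ f) {n A B : k[X]} (hn : n ≠ 0)
    (hAB : A ≠ 0 ∨ B ≠ 0) :
    funDivisor f (n * A) (n * B) = funDivisor f n 0 + funDivisor f A B := by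
  rw [← funDivisor_mul hf (.inl hn) hAB]
  congr 1 <;> ring

lemma funDivisor_C (hf : IsOddHyperelliptic γ f) {c : k} (hc : c ≠ 0) :
    funDivisor f (C c) 0 = 0 := by
  ext P
  rw [funDivisor_apply hf (.inl (C_ne_zero.2 hc))]
  cases P with
  | infty => simp [ordAt]
  | affine a b h => exact ordAt_eq_zero hf h (by simpa using hc)

lemma CurvePoint.inv_eq_iff {a b : k} (h : b ^ 2 = f.eval a) :
    (CurvePoint.affine a b h).inv = .affine a b h ↔ b = 0 := by
  simp only [CurvePoint.inv, CurvePoint.affine.injEq, true_and]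
  exact neg_eq_self

lemma funDivisor_X_sub_C (hf : IsOddHyperelliptic γ f) {a b : k} (h : b ^ 2 = f.eval a) :
    funDivisor f (X - C a) 0 = Finsupp.single (.affine a b h) 1 +
      Finsupp.single (CurvePoint.affine a b h).inv 1 - Finsupp.single .infty 2 := by
  classical
  ext P
  rw [funDivisor_apply hf (X_sub_C_pair a)]
  simp only [Finsupp.add_apply, Finsupp.sub_apply, Finsupp.single_apply, CurvePoint.inv]
  cases P with
  | infty => simp [ordAt]
  | affine a' b' h' =>
    by_cases ha : a' = a
    · subst ha
      rw [ordAt_X_sub_C_self hf h']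
      have hb : b' = b ∨ b' = -b := by rw [← sq_eq_sq_iff_eq_or_eq_neg, h, h']
      have hbb : b = -b ↔ b = 0 := by rw [eq_comm, neg_eq_self]
      rcases hb with rfl | rfl
      · by_cases hb0 : b' = 0
        · simp [hb0]
        · simp [hb0, neg_eq_self]
      · by_cases hb0 : b = 0
        · simp [hb0]
        · simp [hb0, hbb]
    · rw [ordAt_eq_zero hf h' (by simpa [sub_eq_zero] using ha)]
      simp [Ne.symm ha]

variable [IsAlgClosed k]

lemma exists_point_over (f : k[X]) (a : k) : ∃ b : k, b ^ 2 = f.eval a :=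
  IsAlgClosed.exists_pow_nat_eq _ two_pos

/-- Induction on nonzero polynomials over an algebraically closed field, by linear factors. -/
lemma poly_induction {motive : k[X] → Prop} (hC : ∀ c : k, c ≠ 0 → motive (C c))
    (hmul : ∀ (a : k) (p : k[X]), p ≠ 0 → motive p → motive ((X - C a) * p)) (p : k[X])
    (hp : p ≠ 0) : motive p := by
  induction hn : p.natDegree generalizing p with
  | zero =>
    rw [eq_C_of_natDegree_eq_zero hn] at hp ⊢
    exact hC _ (C_ne_zero.1 hp)
  | succ n ih =>
    obtain ⟨a, ha⟩ := IsAlgClosed.exists_root p (by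
      intro h
      have := natDegree_eq_of_degree_eq_some (n := 0) h
      omega)
    obtain ⟨q, rfl⟩ := dvd_iff_isRoot.2 ha
    have hq := right_ne_zero_of_mul hp
    refine hmul a q hq (ih q hq ?_)
    rw [natDegree_mul (X_sub_C_ne_zero a) hq, natDegree_X_sub_C] at hn
    omega

lemma divDegree_poly (hf : IsOddHyperelliptic γ f) (n : k[X]) (hn : n ≠ 0) :
    divDegree f (funDivisor f n 0) = 0 := by
  refine poly_induction (motive := fun n => divDegree f (funDivisor f n 0) = 0) ?_ ?_ n hn
  · intro c hc
    rw [funDivisor_C hf hc, map_zero]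
  · intro a p hp ih
    obtain ⟨b, hb⟩ := exists_point_over f a
    have := funDivisor_poly_mul hf (X_sub_C_ne_zero a) (A := p) (B := 0) (.inl hp)
    rw [mul_zero] at this
    rw [this, map_add, ih, funDivisor_X_sub_C hf hb, map_sub, map_add, divDegree_single,
      divDegree_single, divDegree_single]
    norm_num

lemma funDivisor_conj (hf : IsOddHyperelliptic γ f) {A B : k[X]} (hAB : A ≠ 0 ∨ B ≠ 0) :
    funDivisor f A (-B) =
      Finsupp.equivMapDomain ⟨CurvePoint.inv, CurvePoint.inv, CurvePoint.inv_inv,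
        CurvePoint.inv_inv⟩ (funDivisor f A B) := by
  ext P
  rw [Finsupp.equivMapDomain_apply, funDivisor_apply hf hAB,
    funDivisor_apply hf (conj_ne_zero_pair hAB), ordAt_conj hf hAB]
  rfl

lemma funDivisor_add_conj (hf : IsOddHyperelliptic γ f) {A B : k[X]} (hAB : A ≠ 0 ∨ B ≠ 0) :
    funDivisor f A B + funDivisor f A (-B) = funDivisor f (regNorm f A B) 0 := by
  rw [← funDivisor_mul hf hAB (conj_ne_zero_pair hAB), regNorm]
  congr 1 <;> ring

/-- The involution preserves degree, and a function times its conjugate is a polynomial in `x`,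
whose divisor has degree zero factor by factor. -/
lemma divDegree_funDivisor (hf : IsOddHyperelliptic γ f) {A B : k[X]} (hAB : A ≠ 0 ∨ B ≠ 0) :
    divDegree f (funDivisor f A B) = 0 := by
  have h1 := congrArg (divDegree f) (funDivisor_add_conj hf hAB)
  rw [divDegree_poly hf _ (regNorm_ne_zero hf hAB), map_add, funDivisor_conj hf hAB] at h1
  have h2 : ∀ (e : CurvePoint f ≃ CurvePoint f) (D : CurveDivisor f),
      divDegree f (Finsupp.equivMapDomain e D) = divDegree f D := by
    intro e D
    induction D using Finsupp.induction_linear with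
    | zero => simp
    | add D E hD hE =>
      rw [Finsupp.equivMapDomain_eq_mapDomain] at *
      rw [Finsupp.mapDomain_add, map_add, map_add, hD, hE]
    | single P n => rw [Finsupp.equivMapDomain_single, divDegree_single, divDegree_single]
  rw [h2] at h1
  omega

/-- Products of functions show that the generating set of the closure is already a subgroup. -/
lemma mem_principalDivisors_iff (hf : IsOddHyperelliptic γ f) (D : CurveDivisor f) :
    D ∈ principalDivisors f ↔ ∃ A₁ B₁ A₂ B₂ : k[X], (A₁ ≠ 0 ∨ B₁ ≠ 0) ∧ (A₂ ≠ 0 ∨ B₂ ≠ 0) ∧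
      D = funDivisor f A₁ B₁ - funDivisor f A₂ B₂ := by
  constructor
  · intro hD
    induction hD using AddSubgroup.closure_induction with
    | mem D hD =>
      obtain ⟨A₁, B₁, A₂, B₂, h1, h2, h⟩ := hD
      refine ⟨A₁, B₁, A₂, B₂, h1, h2, ?_⟩
      ext P
      rw [h, Finsupp.sub_apply, funDivisor_apply hf h1, funDivisor_apply hf h2]
    | zero => exact ⟨1, 0, 1, 0, by simp, by simp, by simp⟩
    | add D E _ _ hD hE =>
      obtain ⟨A₁, B₁, A₂, B₂, h1, h2, rfl⟩ := hD
      obtain ⟨A₃, B₃, A₄, B₄, h3, h4, rfl⟩ := hE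
      refine ⟨_, _, _, _, mul_ne_zero_pair hf h1 h3, mul_ne_zero_pair hf h2 h4, ?_⟩
      rw [funDivisor_mul hf h1 h3, funDivisor_mul hf h2 h4]
      abel
    | neg D _ hD =>
      obtain ⟨A₁, B₁, A₂, B₂, h1, h2, rfl⟩ := hD
      exact ⟨A₂, B₂, A₁, B₁, h2, h1, by abel⟩
  · rintro ⟨A₁, B₁, A₂, B₂, h1, h2, rfl⟩
    refine AddSubgroup.subset_closure ⟨A₁, B₁, A₂, B₂, h1, h2, fun P => ?_⟩
    rw [Finsupp.sub_apply, funDivisor_apply hf h1, funDivisor_apply hf h2]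

/-- Vanishing at both `(c, b)` and `(c, -b)` gives `A(c) ± b B(c) = 0`, so both coefficients vanish
at `c`. When `b = 0` the double zero puts the function in `P² = (x - c)`. -/
lemma X_sub_C_dvd_pair (hf : IsOddHyperelliptic γ f) {A B : k[X]} (hAB : A ≠ 0 ∨ B ≠ 0) (c : k)
    (h : ∀ a b hab, ordAt f (X - C c) 0 (.affine a b hab) ≤ ordAt f A B (.affine a b hab)) :
    ∃ A' B', A = (X - C c) * A' ∧ B = (X - C c) * B' := by
  obtain ⟨b, hb⟩ := exists_point_over f c
  have hb' : (-b) ^ 2 = f.eval c := by rw [neg_sq, hb]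
  by_cases h0 : b = 0
  · have h1 := h c b hb
    rw [ordAt_X_sub_C_self hf hb, if_pos h0] at h1
    have h2 := (mem_pow_iff_le_ordAt hf hb hAB 2).2 h1
    subst h0
    have h3 := pointIdeal_mul_conj hf.2.2 c 0 hb
    rw [neg_zero] at h3
    rw [pow_two (pointIdeal f c 0), h3, Ideal.mem_span_singleton] at h2
    obtain ⟨z, hz⟩ := h2
    obtain ⟨A', B', rfl⟩ := regFun_surjective z
    rw [regFun_mul] at hz
    obtain ⟨h4, h5⟩ := regFun_injective hz
    exact ⟨A', B', by simpa using h4, by simpa using h5⟩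
  · have h1 := h c b hb
    have h2 := h c (-b) hb'
    rw [ordAt_X_sub_C_self hf, if_neg h0, ordAt_pos_iff hf hb hAB] at h1
    rw [ordAt_X_sub_C_self hf, if_neg (by simpa using h0), ordAt_pos_iff hf hb' hAB] at h2
    have h3 : A.eval c = 0 := by
      have : 2 * A.eval c = 0 := by linear_combination h1 + h2
      simpa using this
    have h4 : B.eval c = 0 := by
      have : 2 * b * B.eval c = 0 := by linear_combination h1 - h2
      simpa [h0] using this
    obtain ⟨A', hA'⟩ := dvd_iff_isRoot.2 h3
    obtain ⟨B', hB'⟩ := dvd_iff_isRoot.2 h4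
    exact ⟨A', B', hA', hB'⟩

lemma poly_dvd_pair (hf : IsOddHyperelliptic γ f) (n : k[X]) (hn : n ≠ 0) :
    ∀ A B : k[X], (A ≠ 0 ∨ B ≠ 0) →
    (∀ a b hab, ordAt f n 0 (.affine a b hab) ≤ ordAt f A B (.affine a b hab)) →
    ∃ A' B', A = n * A' ∧ B = n * B' := by
  refine poly_induction (motive := fun n => ∀ A B : k[X], (A ≠ 0 ∨ B ≠ 0) →
    (∀ a b hab, ordAt f n 0 (.affine a b hab) ≤ ordAt f A B (.affine a b hab)) →
    ∃ A' B', A = n * A' ∧ B = n * B') ?_ ?_ n hn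
  · intro c hc A B _ _
    refine ⟨C c⁻¹ * A, C c⁻¹ * B, ?_, ?_⟩ <;>
      rw [← mul_assoc, ← C_mul, mul_inv_cancel₀ hc, C_1, one_mul]
  · intro c p hp ih A B hAB h
    have key : ∀ P, ordAt f ((X - C c) * p) 0 P = ordAt f (X - C c) 0 P + ordAt f p 0 P := by
      intro P
      rw [← ordAt_mul hf (X_sub_C_pair c) (.inl hp)]
      congr 1 <;> ring
    obtain ⟨A₁, B₁, rfl, rfl⟩ := X_sub_C_dvd_pair hf hAB c (fun a b hab => by
      have := h a b hab
      rw [key] at this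
      have := ordAt_affine_nonneg hab p 0
      omega)
    have hAB₁ : A₁ ≠ 0 ∨ B₁ ≠ 0 := hAB.imp right_ne_zero_of_mul right_ne_zero_of_mul
    obtain ⟨A₂, B₂, rfl, rfl⟩ := ih A₁ B₁ hAB₁ (fun a b hab => by
      have := h a b hab
      have h2 := ordAt_mul hf (X_sub_C_pair c) hAB₁ (.affine a b hab)
      simp only [zero_mul, mul_zero, add_zero] at h2
      rw [key, h2] at this
      omega)
    exact ⟨A₂, B₂, by ring, by ring⟩

/-- A principal divisor without affine poles is the divisor of a regular function. -/
lemma exists_funDivisor_eq (hf : IsOddHyperelliptic γ f) {D : CurveDivisor f}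
    (hD : D ∈ principalDivisors f) (hpos : ∀ a b hab, 0 ≤ D (.affine a b hab)) :
    ∃ A B : k[X], (A ≠ 0 ∨ B ≠ 0) ∧ D = funDivisor f A B := by
  obtain ⟨A₁, B₁, A₂, B₂, h1, h2, rfl⟩ := (mem_principalDivisors_iff hf D).1 hD
  have hn := regNorm_ne_zero hf h2
  have h3 := mul_ne_zero_pair hf h1 (conj_ne_zero_pair h2)
  -- Rationalise the denominator with its conjugate, so that it becomes a polynomial in `x` and can
  -- be divided out.
  have hD : funDivisor f A₁ B₁ - funDivisor f A₂ B₂ =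
      funDivisor f (A₁ * A₂ + f * (B₁ * -B₂)) (A₁ * -B₂ + B₁ * A₂) -
        funDivisor f (regNorm f A₂ B₂) 0 := by
    rw [funDivisor_mul hf h1 (conj_ne_zero_pair h2), ← funDivisor_add_conj hf h2]
    abel
  rw [hD] at hpos ⊢
  obtain ⟨A, B, hA, hB⟩ := poly_dvd_pair hf _ hn _ _ h3 (fun a b hab => by
    have := hpos a b hab
    rw [Finsupp.sub_apply, funDivisor_apply hf h3, funDivisor_apply hf (.inl hn)] at this
    omega)
  rw [hA, hB] at h3 ⊢
  have hAB : A ≠ 0 ∨ B ≠ 0 := h3.imp right_ne_zero_of_mul right_ne_zero_of_mul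
  exact ⟨A, B, hAB, by rw [funDivisor_poly_mul hf hn hAB]; abel⟩

lemma funDivisor_mem_principalDivisors (hf : IsOddHyperelliptic γ f) {A B : k[X]}
    (hAB : A ≠ 0 ∨ B ≠ 0) : funDivisor f A B ∈ principalDivisors f := by
  rw [mem_principalDivisors_iff hf]
  exact ⟨A, B, 1, 0, hAB, by simp, by rw [← C_1, funDivisor_C hf one_ne_zero, sub_zero]⟩

end Divisors

/-! ### The Jacobian, theta strata and their translation into functions. -/

section Jacobian

variable {k : Type*} [Field k] {f : k[X]}

/-- The class of `D - (deg D) q`. -/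
def classOf (f : k[X]) : CurveDivisor f →+ CurveJacobian f :=
  (QuotientAddGroup.mk' _).comp
    { toFun := fun D => ⟨D - Finsupp.single .infty (divDegree f D), by
        rw [AddMonoidHom.mem_ker, map_sub, divDegree_single, sub_self]⟩
      map_zero' := by ext1; simp
      map_add' := fun D E => by
        ext1
        simp only [map_add, Finsupp.single_add, AddSubgroup.coe_add]
        abel }

lemma classOf_single (P : CurvePoint f) : classOf f (Finsupp.single P 1) = pointClass P := by
  simp only [classOf, pointClass, AddMonoidHom.coe_comp, Function.comp_apply,
    QuotientAddGroup.coe_mk', AddMonoidHom.coe_mk, ZeroHom.coe_mk, divDegree_single]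

lemma classOf_single_nat (P : CurvePoint f) (n : ℕ) :
    classOf f (Finsupp.single P (n : ℤ)) = n • pointClass P := by
  rw [← classOf_single, ← map_nsmul, Finsupp.smul_single, nsmul_eq_mul, mul_one]

lemma classOf_eq_zero_iff (D : CurveDivisor f) :
    classOf f D = 0 ↔ D - Finsupp.single .infty (divDegree f D) ∈ principalDivisors f := by
  simp only [classOf, AddMonoidHom.coe_comp, Function.comp_apply, QuotientAddGroup.coe_mk',
    AddMonoidHom.coe_mk, ZeroHom.coe_mk]
  rw [QuotientAddGroup.eq_zero_iff, AddSubgroup.mem_addSubgroupOf]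

lemma pointClass_infty : pointClass (.infty : CurvePoint f) = 0 := by
  rw [← classOf_single, classOf_eq_zero_iff, divDegree_single, sub_self]
  exact zero_mem _

lemma classOf_single_infty (n : ℤ) : classOf f (Finsupp.single .infty n) = 0 := by
  rw [classOf_eq_zero_iff, divDegree_single, sub_self]
  exact zero_mem _

lemma divDegree_eq_sum (D : CurveDivisor f) : divDegree f D = ∑ P ∈ D.support, D P := by
  simp [divDegree, Finsupp.sum]

lemma eq_zero_of_effective {D : CurveDivisor f} (hD : ∀ P, 0 ≤ D P) (h : divDegree f D = 0) :
    D = 0 := by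
  rw [divDegree_eq_sum, Finset.sum_eq_zero_iff_of_nonneg fun P _ => hD P] at h
  ext P
  by_contra hne
  exact hne (h P (Finsupp.mem_support_iff.2 hne))

lemma classOf_mem_Theta (d : ℕ) : ∀ D : CurveDivisor f, (∀ P, 0 ≤ D P) → divDegree f D = d →
    classOf f D ∈ Theta f d := by
  induction d with
  | zero =>
    intro D hD h
    rw [eq_zero_of_effective hD (by simpa using h), map_zero]
    exact ⟨Fin.elim0, by simp⟩
  | succ d ih =>
    intro D hD h
    obtain ⟨P, hP⟩ : ∃ P, 1 ≤ D P := by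
      by_contra! hcon
      have : D = 0 := by
        ext P
        have := hD P
        have := hcon P
        simp only [Finsupp.coe_zero, Pi.zero_apply]
        omega
      rw [this, map_zero] at h
      push_cast at h
      omega
    obtain ⟨Q, hQ⟩ := ih (D - Finsupp.single P 1) (fun R => by
      classical
      rw [Finsupp.sub_apply, Finsupp.single_apply]
      split_ifs with hR
      · subst hR; omega
      · simpa using hD R) (by
      rw [map_sub, divDegree_single, h]; push_cast; ring)
    refine ⟨Fin.cons P Q, ?_⟩
    have hQ' : ∑ i, pointClass (Q i) = classOf f (D - Finsupp.single P 1) := hQ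
    simp only [Fin.sum_univ_succ, Fin.cons_zero, Fin.cons_succ]
    rw [hQ', map_sub, classOf_single]
    abel

lemma mem_Theta_iff (d : ℕ) (x : CurveJacobian f) : x ∈ Theta f d ↔
    ∃ D : CurveDivisor f, (∀ P, 0 ≤ D P) ∧ divDegree f D = d ∧ classOf f D = x := by
  constructor
  · rintro ⟨P, rfl⟩
    refine ⟨∑ i, Finsupp.single (P i) 1, fun R => ?_, ?_, ?_⟩
    · rw [Finsupp.finsetSum_apply]
      classical
      refine Finset.sum_nonneg fun i _ => ?_
      rw [Finsupp.single_apply]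
      split_ifs <;> norm_num
    · simp [map_sum, divDegree_single]
    · simp [map_sum, classOf_single]
  · rintro ⟨D, h1, h2, rfl⟩
    exact classOf_mem_Theta d D h1 h2

lemma Theta_mono {d e : ℕ} (h : d ≤ e) : Theta f d ⊆ Theta f e := by
  intro x hx
  obtain ⟨D, h1, h2, rfl⟩ := (mem_Theta_iff d x).1 hx
  refine (mem_Theta_iff e _).2 ⟨D + Finsupp.single .infty ((e : ℤ) - d), fun P => ?_, ?_, ?_⟩
  · classical
    rw [Finsupp.add_apply, Finsupp.single_apply]
    have := h1 P
    split_ifs <;> omega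
  · rw [map_add, divDegree_single, h2]; ring
  · rw [map_add, classOf_single_infty, add_zero]

lemma mem_ThetaZero_iff (d : ℕ) (x : CurveJacobian f) :
    x ∈ ThetaZero f d ↔ x ∈ Theta f d ∧ ∀ d' < d, x ∉ Theta f d' := by
  cases d with
  | zero => simp [ThetaZero]
  | succ d =>
    simp only [ThetaZero, Set.mem_sdiff]
    refine and_congr_right fun _ => ⟨fun h d' hd' hx => h (Theta_mono (by omega) hx),
      fun h => h d (by omega)⟩

lemma ThetaZero_unique {d e : ℕ} {x : CurveJacobian f} (hd : x ∈ ThetaZero f d)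
    (he : x ∈ ThetaZero f e) : d = e := by
  rw [mem_ThetaZero_iff] at hd he
  rcases lt_trichotomy d e with h | h | h
  · exact absurd hd.1 (he.2 d h)
  · exact h
  · exact absurd he.1 (hd.2 e h)

lemma HasMultProfile.unique {x : CurveJacobian f} {ε ε' : ℕ → ℕ} (h : HasMultProfile x ε)
    (h' : HasMultProfile x ε') : ε = ε' :=
  funext fun j => ThetaZero_unique (h j) (h' j)

variable [CharZero k] [IsAlgClosed k] {γ : ℕ}

lemma classOf_funDivisor (hf : IsOddHyperelliptic γ f) {A B : k[X]} (hAB : A ≠ 0 ∨ B ≠ 0) :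
    classOf f (funDivisor f A B) = 0 := by
  rw [classOf_eq_zero_iff, divDegree_funDivisor hf hAB, Finsupp.single_zero, sub_zero]
  exact funDivisor_mem_principalDivisors hf hAB

lemma pointClass_inv (hf : IsOddHyperelliptic γ f) (P : CurvePoint f) :
    pointClass P.inv = -pointClass P := by
  cases P with
  | infty => rw [CurvePoint.inv, pointClass_infty, neg_zero]
  | affine a b h =>
    have h1 := classOf_funDivisor hf (X_sub_C_pair a)
    rw [funDivisor_X_sub_C hf h, map_sub, map_add, classOf_single_infty, classOf_single,
      classOf_single, sub_zero] at h1
    exact (neg_eq_of_add_eq_zero_right h1).symm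

lemma two_smul_pointClass (hf : IsOddHyperelliptic γ f) {a : k} (h : (0 : k) ^ 2 = f.eval a) :
    2 • pointClass (.affine a 0 h) = 0 := by
  have := pointClass_inv hf (.affine a 0 h)
  rw [(CurvePoint.inv_eq_iff h).2 rfl, eq_neg_iff_add_eq_zero] at this
  rwa [two_nsmul]

lemma neg_mem_Theta (hf : IsOddHyperelliptic γ f) {d : ℕ} {x : CurveJacobian f}
    (hx : x ∈ Theta f d) : -x ∈ Theta f d := by
  obtain ⟨P, rfl⟩ := hx
  refine ⟨fun i => (P i).inv, ?_⟩
  simp only [pointClass_inv hf, Finset.sum_neg_distrib]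

lemma neg_mem_Theta_iff (hf : IsOddHyperelliptic γ f) {d : ℕ} {x : CurveJacobian f} :
    -x ∈ Theta f d ↔ x ∈ Theta f d :=
  ⟨fun h => by simpa using neg_mem_Theta hf h, neg_mem_Theta hf⟩

lemma neg_mem_ThetaZero_iff (hf : IsOddHyperelliptic γ f) {d : ℕ} {x : CurveJacobian f} :
    -x ∈ ThetaZero f d ↔ x ∈ ThetaZero f d := by
  simp only [mem_ThetaZero_iff, neg_mem_Theta_iff hf]

/-- There is a nonzero regular function vanishing to order `j` at `(a, b)`, with a pole of order at
most `m` at infinity. -/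
def HasFun (f : k[X]) (a b : k) (j m : ℕ) : Prop :=
  ∃ A B : k[X], (A ≠ 0 ∨ B ≠ 0) ∧ regFun f A B ∈ pointIdeal f a b ^ j ∧
    (regNorm f A B).natDegree ≤ m

lemma HasFun.mono {a b : k} {j m j' m' : ℕ} (h : HasFun f a b j m) (hj : j' ≤ j) (hm : m ≤ m') :
    HasFun f a b j' m' := by
  obtain ⟨A, B, h1, h2, h3⟩ := h
  exact ⟨A, B, h1, Ideal.pow_le_pow_right hj h2, h3.trans hm⟩

/-- An effective `E` of degree `d` representing `-j [p - q]` makes `E + j p - (j + d) q` principal,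
and such a divisor is that of a regular function on the affine curve. -/
lemma smul_mem_Theta_iff (hf : IsOddHyperelliptic γ f) {a b : k} (h : b ^ 2 = f.eval a)
    (j d : ℕ) :
    j • pointClass (.affine a b h) ∈ Theta f d ↔ HasFun f a b j (j + d) := by
  classical
  rw [← neg_mem_Theta_iff hf, mem_Theta_iff]
  constructor
  · rintro ⟨E, hE, hdeg, hcl⟩
    have h0 : classOf f (E + Finsupp.single (.affine a b h) (j : ℤ)) = 0 := by
      rw [map_add, hcl, classOf_single_nat, neg_add_cancel]
    rw [classOf_eq_zero_iff, map_add, divDegree_single, hdeg] at h0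
    obtain ⟨A, B, hAB, hD⟩ := exists_funDivisor_eq hf h0 (fun a' b' h' => by
      have := hE (.affine a' b' h')
      simp only [Finsupp.add_apply, Finsupp.sub_apply, Finsupp.single_apply]
      rw [if_neg (by simp : ¬ CurvePoint.infty = .affine a' b' h')]
      split_ifs <;> omega)
    refine ⟨A, B, hAB, ?_, ?_⟩
    · rw [mem_pow_iff_le_ordAt hf h hAB, ← funDivisor_apply hf hAB, ← hD]
      have := hE (.affine a b h)
      simpa [Finsupp.single_apply] using this
    · have h1 := ordAt_infty hf A B
      rw [← funDivisor_apply hf hAB, ← hD] at h1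
      have := hE .infty
      simp at h1
      omega
  · rintro ⟨A, B, hAB, hm, hd⟩
    refine ⟨funDivisor f A B - Finsupp.single (.affine a b h) (j : ℤ) +
      Finsupp.single .infty ((j : ℤ) + d), fun P => ?_, ?_, ?_⟩
    · rw [mem_pow_iff_le_ordAt hf h hAB] at hm
      simp only [Finsupp.add_apply, Finsupp.sub_apply, Finsupp.single_apply,
        funDivisor_apply hf hAB]
      cases P with
      | infty =>
        rw [ordAt_infty hf]
        simp
        omega
      | affine a' b' h' =>
        have := ordAt_affine_nonneg h' A B
        split_ifs with h1 <;> simp_all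
    · rw [map_add, map_sub, divDegree_funDivisor hf hAB, divDegree_single, divDegree_single]
      ring
    · rw [map_add, map_sub, classOf_funDivisor hf hAB, classOf_single_nat, classOf_single_infty,
        zero_sub, add_zero]

lemma regFun_mem_pow_of_dvd {a b : k} {n : ℕ} {A : k[X]} (h : (X - C a) ^ n ∣ A) :
    regFun f A 0 ∈ pointIdeal f a b ^ n := by
  obtain ⟨B, rfl⟩ := h
  have : regFun f ((X - C a) ^ n * B) 0 = regFun f (X - C a) 0 ^ n * regFun f B 0 := by
    simp [regFun]
  rw [this]
  exact Ideal.mul_mem_right _ _ (Ideal.pow_mem_pow (Ideal.subset_span (by simp)) n)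

lemma ordAt_add_conj (hf : IsOddHyperelliptic γ f) {A B : k[X]} (hAB : A ≠ 0 ∨ B ≠ 0)
    (P : CurvePoint f) :
    ordAt f A B P + ordAt f A (-B) P = ordAt f (regNorm f A B) 0 P := by
  rw [← funDivisor_apply hf hAB, ← funDivisor_apply hf (conj_ne_zero_pair hAB),
    ← funDivisor_apply hf (.inl (regNorm_ne_zero hf hAB)), ← funDivisor_add_conj hf hAB]
  rfl

/-- If the conjugate does not vanish at the point, the whole order of the norm there belongs to `A +
B y`. -/
lemma mem_pow_of_dvd_regNorm (hf : IsOddHyperelliptic γ f) {a b : k} (h : b ^ 2 = f.eval a)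
    {A B : k[X]} {n : ℕ} (hN : (X - C a) ^ n ∣ regNorm f A B)
    (hconj : A.eval a - B.eval a * b ≠ 0) : regFun f A B ∈ pointIdeal f a b ^ n := by
  have hAB : A ≠ 0 ∨ B ≠ 0 := by
    by_contra! hcon
    simp [hcon.1, hcon.2] at hconj
  have h0 := ordAt_eq_zero hf h (A := A) (B := -B) (by simpa [← sub_eq_add_neg] using hconj)
  have h1 := (mem_pow_iff_le_ordAt hf h (.inl (regNorm_ne_zero hf hAB)) n).1
    (regFun_mem_pow_of_dvd hN)
  rw [← ordAt_add_conj hf hAB, h0, add_zero] at h1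
  exact (mem_pow_iff_le_ordAt hf h hAB n).2 h1

/-- The function is `v - y`: it vanishes to order at least `n` at `p` because `v + y` takes the
value `2b` there, and at each `(w i, 0)` because `v² - f` and `f` vanish. -/
lemma smul_pointClass_eq_sum (hf : IsOddHyperelliptic γ f) {a b : k} (h : b ^ 2 = f.eval a)
    (hb : b ≠ 0) {ι : Type*} [Fintype ι] {w : ι → k} (hw : Function.Injective w)
    (hwf : ∀ i, (0 : k) ^ 2 = f.eval (w i)) {v : k[X]} (hv : v.eval a = b) {c : k} (hc : c ≠ 0)
    {n : ℕ} (hN : v ^ 2 - f = C c * (X - C a) ^ n * ∏ i, (X - C (w i))) :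
    n • pointClass (.affine a b h) = ∑ i, pointClass (.affine (w i) 0 (hwf i)) := by
  classical
  have hnorm : regNorm f v (-1) = C c * (X - C a) ^ n * ∏ i, (X - C (w i)) := by
    rw [← hN, regNorm]; ring
  have hAB : v ≠ 0 ∨ (-1 : k[X]) ≠ 0 := .inr (by simp)
  have hmem : regFun f v (-1) ∈ pointIdeal f a b ^ n := by
    refine mem_pow_of_dvd_regNorm hf h ?_ ?_
    · rw [hnorm]
      exact ⟨C c * ∏ i, (X - C (w i)), by ring⟩
    · simp [hv, ← two_mul, hb]
  have hdeg : (regNorm f v (-1)).natDegree = n + Fintype.card ι := by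
    rw [hnorm, mul_assoc, natDegree_C_mul hc, natDegree_mul (pow_ne_zero _ (X_sub_C_ne_zero a))
      (Finset.prod_ne_zero_iff.2 fun i _ => X_sub_C_ne_zero (w i)), natDegree_pow,
      natDegree_X_sub_C, natDegree_prod_of_monic _ _ fun i _ => monic_X_sub_C (w i)]
    simp
  have hwa : ∀ i, w i ≠ a := by
    rintro i rfl
    apply hb
    have := hwf i
    rw [← h] at this
    simpa using this.symm
  have hvw : ∀ i, v.eval (w i) = 0 := by
    intro i
    have h1 := congrArg (fun p => p.eval (w i)) hN
    have h2 : ∏ j, (X - C (w j)) = (X - C (w i)) * ∏ j ∈ Finset.univ.erase i, (X - C (w j)) :=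
      (Finset.mul_prod_erase _ _ (Finset.mem_univ i)).symm
    rw [h2] at h1
    simpa [← hwf i] using h1
  set E : CurveDivisor f := ∑ i, Finsupp.single (.affine (w i) 0 (hwf i)) (1 : ℤ) with hE
  -- Only lower bounds for the orders are needed: the difference is effective of degree zero, hence
  -- zero.
  have hD : funDivisor f v (-1) - Finsupp.single (.affine a b h) (n : ℤ) - E +
      Finsupp.single .infty ((n : ℤ) + Fintype.card ι) = 0 := by
    apply eq_zero_of_effective
    · intro P
      simp only [Finsupp.add_apply, Finsupp.sub_apply, Finsupp.single_apply, hE,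
        Finsupp.finsetSum_apply, funDivisor_apply hf hAB]
      cases P with
      | infty =>
        rw [ordAt_infty hf, hdeg]
        simp
      | affine a' b' h' =>
        have h0 := ordAt_affine_nonneg h' v (-1)
        by_cases hP : ∃ i, a' = w i
        · obtain ⟨i, rfl⟩ := hP
          have hb' : b' = 0 := by simpa [← hwf i] using h'
          subst hb'
          have h1 := (ordAt_pos_iff hf h' hAB).2 (by simp [hvw i])
          simp only [CurvePoint.affine.injEq, and_true, reduceCtorEq, if_false, add_zero,
            hw.eq_iff, Finset.sum_ite_eq', Finset.mem_univ, if_true]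
          rw [if_neg (by rintro ⟨h2, -⟩; exact hwa i h2.symm)]
          omega
        · push Not at hP
          have h1 : ∀ i, ¬ (w i = a' ∧ (0 : k) = b') := fun i hi => hP i hi.1.symm
          simp only [CurvePoint.affine.injEq, reduceCtorEq, if_false, add_zero, h1,
            Finset.sum_const_zero, sub_zero]
          split_ifs with h2
          · obtain ⟨rfl, rfl⟩ := h2
            have := (mem_pow_iff_le_ordAt hf h hAB n).1 hmem
            omega
          · omega
    · rw [map_add, map_sub, map_sub, divDegree_funDivisor hf hAB, divDegree_single,
        divDegree_single, hE, map_sum]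
      simp [divDegree_single]
  have hcl := congrArg (classOf f) hD
  rw [map_zero, map_add, map_sub, map_sub, classOf_funDivisor hf hAB, classOf_single_infty,
    classOf_single_nat, hE, map_sum, add_zero, zero_sub, sub_eq_zero, neg_eq_iff_eq_neg] at hcl
  -- The divisor gives the sum with a minus sign, which disappears because Weierstrass classes are
  -- killed by `2`.
  rw [hcl, ← Finset.sum_neg_distrib]
  refine Finset.sum_congr rfl fun i _ => ?_
  rw [classOf_single, neg_eq_iff_add_eq_zero, ← two_nsmul, two_smul_pointClass hf]

end Jacobian

/-! ### Bounds for profiles and the classification of profiles. -/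

section Profiles

variable {k : Type*} [Field k] [CharZero k] [IsAlgClosed k] {γ : ℕ} {f : k[X]} {a b : k}

lemma natDegree_regNorm_le_iff (hf : IsOddHyperelliptic γ f) (A B : k[X]) (m : ℕ) :
    (regNorm f A B).natDegree ≤ m ↔
      2 * A.natDegree ≤ m ∧ (B ≠ 0 → 2 * B.natDegree + (2 * γ + 1) ≤ m) := by
  rw [natDegree_regNorm hf, max_le_iff, hf.2.1]
  by_cases hB : B = 0 <;> simp [hB]

/-- Away from Weierstrass points `x - a` is a uniformizer, so the order of a polynomial in `x` is
its root multiplicity. -/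
lemma dvd_of_regFun_mem_pow (hf : IsOddHyperelliptic γ f) (h : b ^ 2 = f.eval a) (hb : b ≠ 0)
    (j : ℕ) : ∀ A : k[X], regFun f A 0 ∈ pointIdeal f a b ^ j → (X - C a) ^ j ∣ A := by
  induction j with
  | zero => intro A _; simp
  | succ j ih =>
    intro A hA
    by_cases h0 : A = 0
    · simp [h0]
    have h1 : A.IsRoot a := by
      have h2 := (mem_pointIdeal a b h A 0).1 (Ideal.pow_le_self (Nat.succ_ne_zero j) hA)
      simpa using h2
    obtain ⟨A', rfl⟩ := dvd_iff_isRoot.2 h1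
    have hA' := right_ne_zero_of_mul h0
    rw [pow_succ']
    refine mul_dvd_mul_left _ (ih A' ?_)
    rw [mem_pow_iff_le_ordAt hf h (.inl hA')]
    rw [mem_pow_iff_le_ordAt hf h (.inl h0)] at hA
    have h3 := ordAt_mul hf (X_sub_C_pair a) (A' := A') (B' := 0) (.inl hA') (.affine a b h)
    rw [ordAt_X_sub_C_self hf, if_neg hb] at h3
    simp only [mul_zero, zero_mul, add_zero] at h3
    rw [h3] at hA
    push_cast at hA
    omega

lemma le_natDegree_of_regFun_mem_pow (hf : IsOddHyperelliptic γ f) (h : b ^ 2 = f.eval a)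
    (hb : b ≠ 0) {j : ℕ} {A : k[X]} (hA : A ≠ 0) (hm : regFun f A 0 ∈ pointIdeal f a b ^ j) :
    j ≤ A.natDegree := by
  simpa using natDegree_le_of_dvd (dvd_of_regFun_mem_pow hf h hb j A hm) hA

/-- Eliminating `y` between two functions that vanish to order `j`. -/
lemma dvd_cross (hf : IsOddHyperelliptic γ f) (h : b ^ 2 = f.eval a) (hb : b ≠ 0) {j : ℕ}
    {A B A' B' : k[X]} (h1 : regFun f A B ∈ pointIdeal f a b ^ j)
    (h2 : regFun f A' B' ∈ pointIdeal f a b ^ j) : (X - C a) ^ j ∣ A * B' - B * A' := by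
  apply dvd_of_regFun_mem_pow hf h hb
  have : regFun f (A * B' - B * A') 0 = regFun f B' 0 * regFun f A B -
      regFun f B 0 * regFun f A' B' := by
    rw [regFun_mul, regFun_mul, regFun_sub]
    congr 1 <;> ring
  rw [this]
  exact Ideal.sub_mem _ (Ideal.mul_mem_left _ _ h1) (Ideal.mul_mem_left _ _ h2)

/-- Hensel lifting: as `2b` is invertible, each step corrects the next coefficient. `S` is a
truncated expansion of `y` in powers of `x - a`. -/
lemma exists_sqrt_mod (h : b ^ 2 = f.eval a) (hb : b ≠ 0) (j : ℕ) :
    ∃ S : k[X], S.eval a = b ∧ (X - C a) ^ (j + 1) ∣ S ^ 2 - f := by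
  induction j with
  | zero =>
    refine ⟨C b, by simp, ?_⟩
    rw [zero_add, pow_one, dvd_iff_isRoot]
    simp [h]
  | succ j ih =>
    obtain ⟨S, hS, q, hq⟩ := ih
    set c := -q.eval a / (2 * b) with hc
    refine ⟨S + C c * (X - C a) ^ (j + 1), by simp [hS], ?_⟩
    have h1 : (S + C c * (X - C a) ^ (j + 1)) ^ 2 - f =
        (X - C a) ^ (j + 1) * (q + 2 * C c * S + C c ^ 2 * (X - C a) ^ (j + 1)) := by
      linear_combination hq
    rw [h1, pow_succ]
    refine mul_dvd_mul_left _ (dvd_iff_isRoot.2 ?_)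
    simp only [IsRoot, eval_add, eval_mul, eval_pow, eval_sub, eval_X, eval_C, eval_ofNat, hS, hc]
    field_simp
    simp

/-- Riemann-Roch by linear algebra: modulo `(x - a)^j` replace `y` by its expansion `S`, so
vanishing becomes the `j` linear conditions `A + S B ≡ 0`, imposed on at least `j + 1` coefficients.
-/
lemma hasFun_add_genus (hf : IsOddHyperelliptic γ f) (h : b ^ 2 = f.eval a) (hb : b ≠ 0)
    (j : ℕ) : HasFun f a b j (j + γ) := by
  obtain ⟨S, hS, hdvd⟩ := exists_sqrt_mod h hb j
  set t : k[X] := (X - C a) ^ j with ht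
  have htm : t.Monic := (monic_X_sub_C a).pow j
  set n₁ := (j + γ) / 2 + 1 with hn₁
  -- For `j < γ` the truncated subtraction gives `n₂ = 0`, so `B = 0`, as the pole bound requires.
  set n₂ := (j - γ + 1) / 2 with hn₂
  let φ : (degreeLT k n₁ × degreeLT k n₂) →ₗ[k] AdjoinRoot t :=
    (AdjoinRoot.mkₐ t : k[X] →ₐ[k] AdjoinRoot t).toLinearMap ∘ₗ
      ((degreeLT k n₁).subtype.coprod ((LinearMap.mulLeft k S) ∘ₗ (degreeLT k n₂).subtype))
  have hfin : Module.Finite k (AdjoinRoot t) := htm.finite_adjoinRoot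
  have hrank : Module.finrank k (AdjoinRoot t) = j := by
    rw [(AdjoinRoot.powerBasis' htm).finrank, AdjoinRoot.powerBasis'_dim, ht, natDegree_pow,
      natDegree_X_sub_C, mul_one]
  have hd : ∀ n, Module.finrank k (degreeLT k n) = n := fun n => by
    rw [LinearEquiv.finrank_eq (degreeLTEquiv k n), Module.finrank_fin_fun]
  have hker : LinearMap.ker φ ≠ ⊥ := by
    have : ∀ n, Module.Finite k (degreeLT k n) := fun n =>
      Module.Finite.equiv (degreeLTEquiv k n).symm
    apply LinearMap.ker_ne_bot_of_finrank_lt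
    rw [hrank, Module.finrank_prod, hd, hd]
    omega
  obtain ⟨⟨⟨A, hA⟩, ⟨B, hB⟩⟩, hx, hne⟩ := (Submodule.ne_bot_iff _).1 hker
  have hx' : AdjoinRoot.mk t (A + S * B) = 0 := hx
  rw [AdjoinRoot.mk_eq_zero] at hx'
  refine ⟨A, B, ?_, ?_, ?_⟩
  · by_contra! hcon
    apply hne
    ext <;> simp [hcon.1, hcon.2]
  · have h1 : regFun f A B = regFun f (A + S * B) 0 - regFun f B 0 * regFun f S (-1) := by
      rw [regFun_mul, regFun_sub]
      congr 1 <;> ring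
    rw [h1]
    refine Ideal.sub_mem _ (regFun_mem_pow_of_dvd hx') (Ideal.mul_mem_left _ _ ?_)
    apply mem_pow_of_dvd_regNorm hf h
    · rw [regNorm]
      refine (pow_dvd_pow _ (Nat.le_succ j)).trans ?_
      convert hdvd using 1
      ring
    · simp [hS, ← two_mul, hb]
  · rw [natDegree_regNorm_le_iff hf]
    rw [mem_degreeLT] at hA hB
    constructor
    · by_cases hA0 : A = 0
      · simp [hA0]
      · have := (natDegree_lt_iff_degree_lt hA0).2 hA
        omega
    · intro hB0
      have := (natDegree_lt_iff_degree_lt hB0).2 hB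
      omega

lemma hasFun_two_mul (j : ℕ) (f : k[X]) (a b : k) : HasFun f a b j (2 * j) := by
  refine ⟨(X - C a) ^ j, 0, .inl (pow_ne_zero _ (X_sub_C_ne_zero a)),
    regFun_mem_pow_of_dvd dvd_rfl, ?_⟩
  simp [regNorm, ← pow_mul, mul_comm]

/-- The pole of `y` has order `2γ + 1`, so only polynomials in `x` are available here. -/
lemma two_mul_le_of_hasFun (hf : IsOddHyperelliptic γ f) (h : b ^ 2 = f.eval a) (hb : b ≠ 0)
    {j m : ℕ} (hm : m ≤ 2 * γ) (hfun : HasFun f a b j m) : 2 * j ≤ m := by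
  obtain ⟨A, B, hAB, h1, h2⟩ := hfun
  rw [natDegree_regNorm_le_iff hf] at h2
  have hB : B = 0 := by
    by_contra hB
    have := h2.2 hB
    omega
  subst hB
  have := le_natDegree_of_regFun_mem_pow hf h hb (by simpa using hAB) h1
  omega

/-- A function with a pole of order at most `2γ + 2` that vanishes to an order larger than `γ + 1`
involves `y` with a constant coefficient, which can be taken to be `1`. -/
lemma HasFun.exists_normalized (hf : IsOddHyperelliptic γ f) (h : b ^ 2 = f.eval a) (hb : b ≠ 0)
    {j m : ℕ} (hm : m ≤ 2 * γ + 2) (hj : m < 2 * j) (hfun : HasFun f a b j m) :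
    2 * γ + 1 ≤ m ∧
      ∃ A : k[X], 2 * A.natDegree ≤ m ∧ regFun f A 1 ∈ pointIdeal f a b ^ j := by
  obtain ⟨A, B, hAB, h1, h2⟩ := hfun
  rw [natDegree_regNorm_le_iff hf] at h2
  by_cases hB : B = 0
  · subst hB
    have := le_natDegree_of_regFun_mem_pow hf h hb (by simpa using hAB) h1
    omega
  · have hB1 := h2.2 hB
    refine ⟨by omega, ?_⟩
    obtain ⟨β, rfl⟩ : ∃ β, B = C β := ⟨_, eq_C_of_natDegree_eq_zero (by omega)⟩
    have hβ : β ≠ 0 := by simpa using hB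
    refine ⟨C β⁻¹ * A, ?_, ?_⟩
    · rw [natDegree_C_mul (inv_ne_zero hβ)]
      exact h2.1
    · have : regFun f (C β⁻¹ * A) 1 = regFun f (C β⁻¹) 0 * regFun f A (C β) := by
        rw [regFun_mul, ← C_mul, inv_mul_cancel₀ hβ]
        congr 1 <;> simp
      rw [this]
      exact Ideal.mul_mem_left _ _ h1

/-- Eliminating `y` against a competitor `A₀ + y` with `deg A₀ < D` leaves a polynomial of degree
exactly `D` with a zero of order `D + 1`. -/
lemma not_hasFun_of_natDegree (hf : IsOddHyperelliptic γ f) (h : b ^ 2 = f.eval a) (hb : b ≠ 0)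
    {D m : ℕ} (hm : m ≤ 2 * γ + 2) (hmD : m < 2 * D) {A : k[X]} (hA : A.natDegree = D) {β : k}
    (hmem : regFun f A (C β) ∈ pointIdeal f a b ^ (D + 1)) : ¬ HasFun f a b (D + 1) m := by
  intro hfun
  obtain ⟨-, A₀, hA₀, hm₀⟩ := hfun.exists_normalized hf h hb hm (by omega)
  have hdvd := dvd_cross hf h hb hmem hm₀
  have h1 : (A * 1 - C β * A₀).natDegree = D := by
    rw [mul_one, natDegree_sub_eq_left_of_natDegree_lt, hA]
    have := natDegree_C_mul_le β A₀
    omega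
  have h2 : A * 1 - C β * A₀ ≠ 0 := by
    intro h0
    rw [h0] at h1
    simp at h1
    omega
  have := natDegree_le_of_dvd hdvd h2
  rw [natDegree_pow, natDegree_X_sub_C] at this
  omega

/-- Here the degree of `A` may be `γ + 2`, so degree alone gives no contradiction. Eliminating `y`
against `A₀ + y` with `deg A₀ ≤ γ` leaves a multiple of `x^(γ+2)`, whose coefficient at `γ + 1`
would still be that of `A`. -/
lemma not_hasFun_of_coeff (hf : IsOddHyperelliptic γ f) (h : b ^ 2 = f.eval 0) (hb : b ≠ 0)
    {A : k[X]} (hA' : A.coeff (γ + 1) ≠ 0) {β : k}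
    (hmem : regFun f A (C β) ∈ pointIdeal f 0 b ^ (γ + 2)) :
    ¬ HasFun f 0 b (γ + 2) (2 * γ + 1) := by
  intro hfun
  obtain ⟨-, A₀, hA₀, hm₀⟩ := hfun.exists_normalized hf h hb (by omega) (by omega)
  obtain ⟨q, hq⟩ := dvd_cross hf h hb hmem hm₀
  have h0 : A₀.natDegree ≤ γ := by omega
  have h1 := congrArg (fun p => p.coeff (γ + 1)) hq
  simp only [mul_one, coeff_sub, coeff_C_mul, C_0, sub_zero] at h1
  rw [coeff_eq_zero_of_natDegree_lt (p := A₀) (by omega), coeff_X_pow_mul', if_neg (by omega)] at h1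
  exact hA' (by simpa using h1)

/-- Eliminating `y` leaves degree at most `γ + 1` against a zero of order `γ + 2`, so the second
function is `B (A₀ + y)` with `deg B ≤ 1`. The factor `B` absorbs at most one of the `γ + 4` zeros.
-/
lemma hasFun_step (hf : IsOddHyperelliptic γ f) (h : b ^ 2 = f.eval a) (hb : b ≠ 0)
    (h2 : HasFun f a b (γ + 2) (2 * γ + 1)) (h4 : HasFun f a b (γ + 4) (2 * γ + 3)) :
    HasFun f a b (γ + 3) (2 * γ + 1) := by
  obtain ⟨-, A₀, hA₀, hm₀⟩ := h2.exists_normalized hf h hb (by omega) (by omega)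
  obtain ⟨A, B, hAB, hm, hdeg⟩ := h4
  rw [natDegree_regNorm_le_iff hf] at hdeg
  have hdvd := dvd_cross hf h hb (Ideal.pow_le_pow_right (by omega : γ + 2 ≤ γ + 4) hm) hm₀
  have hB1 : B.natDegree ≤ 1 := by
    by_cases hB : B = 0
    · simp [hB]
    · have := hdeg.2 hB
      omega
  have hzero : A * 1 - B * A₀ = 0 := by
    by_contra hne
    have h3 := natDegree_le_of_dvd hdvd hne
    rw [natDegree_pow, natDegree_X_sub_C, mul_one, mul_one] at h3
    have h5 := natDegree_sub_le A (B * A₀)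
    have h6 := natDegree_mul_le (p := B) (q := A₀)
    rcases max_choice A.natDegree (B * A₀).natDegree with h8 | h8 <;> omega
  have hA : A = B * A₀ := by rwa [mul_one, sub_eq_zero] at hzero
  have hB : B ≠ 0 := by
    rintro rfl
    simp [hA] at hAB
  have hpair : A₀ ≠ 0 ∨ (1 : k[X]) ≠ 0 := .inr one_ne_zero
  refine ⟨A₀, 1, hpair, ?_, ?_⟩
  · have hmul := ordAt_mul hf (.inl hB) hpair (B := 0) (.affine a b h)
    simp only [zero_mul, mul_zero, add_zero, mul_one, ← hA] at hmul
    rw [mem_pow_iff_le_ordAt hf h hAB, hmul] at hm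
    have hB2 : ¬ regFun f B 0 ∈ pointIdeal f a b ^ 2 := fun hmem => by
      have := le_natDegree_of_regFun_mem_pow hf h hb hB hmem
      omega
    rw [mem_pow_iff_le_ordAt hf h (.inl hB)] at hB2
    rw [mem_pow_iff_le_ordAt hf h hpair]
    push_cast at hm hB2 ⊢
    omega
  · rw [natDegree_regNorm_le_iff hf]
    refine ⟨hA₀, fun _ => by simp⟩

lemma smul_mem_ThetaZero_iff (hf : IsOddHyperelliptic γ f) (h : b ^ 2 = f.eval a) (j d : ℕ) :
    j • pointClass (.affine a b h) ∈ ThetaZero f d ↔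
      HasFun f a b j (j + d) ∧ ∀ d' < d, ¬ HasFun f a b j (j + d') := by
  simp only [mem_ThetaZero_iff, smul_mem_Theta_iff hf]

/-- One function for the index `n` supplies the bound `M - j` for every `j ≤ n`, since vanishing to
higher order implies vanishing to lower order. Periodicity and negation carry the result to all
indices. -/
lemma hasMultProfile_stair (hf : IsOddHyperelliptic γ f) (h : b ^ 2 = f.eval a) (hb : b ≠ 0)
    {n M : ℕ} (hn : 0 < n) (hnM : n ≤ M) (hN : (2 * n) • pointClass (.affine a b h) = 0)
    (hup : HasFun f a b n M)
    (hlow : ∀ j ≤ n, ∀ d < min j (min γ (M - j)), ¬ HasFun f a b j (j + d)) :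
    HasMultProfile (pointClass (.affine a b h)) (stairProfile γ M (2 * n)) := by
  have key : ∀ r ≤ n, r • pointClass (.affine a b h) ∈ ThetaZero f (min r (min γ (M - r))) := by
    intro r hr
    rw [smul_mem_ThetaZero_iff hf]
    refine ⟨?_, hlow r hr⟩
    rcases min_choice r (min γ (M - r)) with h1 | h1 <;> rw [h1]
    · rw [← two_mul]
      exact hasFun_two_mul r f a b
    · rcases min_choice γ (M - r) with h2 | h2 <;> rw [h2]
      · exact hasFun_add_genus hf h hb r
      · exact hup.mono hr (by omega)
  intro j
  have hlt : j % (2 * n) < 2 * n := Nat.mod_lt _ (by omega)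
  have hmod : j • pointClass (.affine a b h) = (j % (2 * n)) • pointClass (.affine a b h) := by
    conv_lhs => rw [← Nat.mod_add_div j (2 * n)]
    rw [add_nsmul, mul_comm (2 * n), mul_nsmul', hN, smul_zero, add_zero]
  rw [hmod]
  simp only [stairProfile]
  rcases le_total (j % (2 * n)) (2 * n - j % (2 * n)) with h1 | h1
  · rw [min_eq_left h1]
    exact key _ (by omega)
  · rw [min_eq_right h1, ← neg_mem_ThetaZero_iff hf]
    have h2 : -((j % (2 * n)) • pointClass (.affine a b h)) =
        (2 * n - j % (2 * n)) • pointClass (.affine a b h) := by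
      rw [neg_eq_iff_add_eq_zero, ← add_nsmul, Nat.add_sub_cancel' hlt.le, hN]
    rw [h2]
    exact key _ (by omega)

/-- A proper divisor of `2n` is at most `n`, and in that range the lower bound is positive, so no
such multiple can vanish. -/
lemma addOrderOf_eq (hf : IsOddHyperelliptic γ f) (h : b ^ 2 = f.eval a) (hγ : 1 ≤ γ)
    {n M : ℕ} (hn : 0 < n) (hnM : n < M) (hN : (2 * n) • pointClass (.affine a b h) = 0)
    (hlow : ∀ j ≤ n, ∀ d < min j (min γ (M - j)), ¬ HasFun f a b j (j + d)) :
    addOrderOf (pointClass (.affine a b h)) = 2 * n := by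
  obtain ⟨c, hc⟩ := addOrderOf_dvd_of_nsmul_eq_zero hN
  set o := addOrderOf (pointClass (.affine a b h)) with ho
  by_contra hne
  have ho0 : 0 < o := Nat.pos_of_ne_zero (by rintro h0; rw [h0] at hc; omega)
  have hc2 : 2 ≤ c := by
    rcases c with _ | _ | c
    · omega
    · omega
    · omega
  have hon : o ≤ n := by nlinarith
  refine hlow o hon 0 (by omega) ?_
  rw [← smul_mem_Theta_iff hf h, ho, addOrderOf_nsmul_eq_zero]
  exact (mem_Theta_iff 0 _).2 ⟨0, by simp, by simp, by simp⟩

lemma low_of_succ (hf : IsOddHyperelliptic γ f) (h : b ^ 2 = f.eval a) (hb : b ≠ 0) (j : ℕ) :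
    ∀ d < min j (min γ (2 * γ + 1 - j)), ¬ HasFun f a b j (j + d) := by
  intro d hd hfun
  have := two_mul_le_of_hasFun hf h hb (by omega) hfun
  omega

/-- Up to `j = γ + 1` the pole order stays at most `2γ`; beyond that every violation would yield the
single excluded function. -/
lemma low_of_add_two (hf : IsOddHyperelliptic γ f) (h : b ^ 2 = f.eval a) (hb : b ≠ 0)
    (hno : ¬ HasFun f a b (γ + 2) (2 * γ + 1)) (j : ℕ) :
    ∀ d < min j (min γ (2 * γ + 2 - j)), ¬ HasFun f a b j (j + d) := by
  intro d hd hfun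
  rcases Nat.lt_or_ge j (γ + 2) with hj | hj
  · have := two_mul_le_of_hasFun hf h hb (by omega) hfun
    omega
  · exact hno (hfun.mono hj (by omega))

lemma low_of_add_three (hf : IsOddHyperelliptic γ f) (h : b ^ 2 = f.eval a) (hb : b ≠ 0)
    (hno : ¬ HasFun f a b (γ + 2) (2 * γ + 1)) (hno' : ¬ HasFun f a b (γ + 3) (2 * γ + 2)) :
    ∀ j ≤ γ + 3, ∀ d < min j (min γ (2 * γ + 3 - j)), ¬ HasFun f a b j (j + d) := by
  intro j hj d hd hfun
  rcases Nat.lt_or_ge j (γ + 2) with hj' | hj'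
  · have := two_mul_le_of_hasFun hf h hb (by omega) hfun
    omega
  · rcases eq_or_lt_of_le hj with rfl | hj
    · exact hno' (hfun.mono le_rfl (by omega))
    · exact hno (hfun.mono hj' (by omega))

lemma ne_zero_of_two_lt_addOrderOf (hf : IsOddHyperelliptic γ f) (h : b ^ 2 = f.eval a)
    (ho : 2 < addOrderOf (pointClass (.affine a b h))) : b ≠ 0 := by
  rintro rfl
  have := Nat.le_of_dvd two_pos (addOrderOf_dvd_of_nsmul_eq_zero (two_smul_pointClass hf h))
  omega

lemma hasMultProfile_of_addOrderOf (hf : IsOddHyperelliptic γ f) (h : b ^ 2 = f.eval a)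
    (hb : b ≠ 0) {n M : ℕ} (hn : 0 < n) (hnM : n ≤ M)
    (ho : addOrderOf (pointClass (.affine a b h)) = 2 * n) (hup : HasFun f a b n M)
    (hlow : ∀ j ≤ n, ∀ d < min j (min γ (M - j)), ¬ HasFun f a b j (j + d)) :
    HasMultProfile (pointClass (.affine a b h)) (stairProfile γ M (2 * n)) :=
  hasMultProfile_stair hf h hb hn hnM (ho ▸ addOrderOf_nsmul_eq_zero _) hup hlow

/-- Any point class of order `2γ + 2` has the minimal profile. -/
lemma profile_order_add_two (hγ : 1 ≤ γ) (hf : IsOddHyperelliptic γ f) (h : b ^ 2 = f.eval a)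
    (ho : addOrderOf (pointClass (.affine a b h)) = 2 * γ + 2) :
    HasMultProfile (pointClass (.affine a b h)) (stairProfile γ (2 * γ + 1) (2 * γ + 2)) := by
  have hb := ne_zero_of_two_lt_addOrderOf hf h (by omega)
  refine hasMultProfile_of_addOrderOf hf h hb (n := γ + 1) (by omega) (by omega) ho ?_
    fun j _ => low_of_succ hf h hb j
  -- Here `n + γ = 2γ + 1 = M`, so the genus bound alone supplies the function.
  exact (hasFun_add_genus hf h hb _).mono le_rfl (by omega)

/-- The universal lower bound at `2γ + 1 - s` is `s`. Equality provides a function of pole order at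
most `2γ + 1`, which forces the whole staircase. -/
lemma profile_minimal {s : ℕ} (hs : 1 ≤ s) (hsγ : s + 1 ≤ γ) {ε : ℕ → ℕ}
    (hε : ε ∈ torsionProfiles k γ (4 * γ + 2 - 2 * s)) :
    s ≤ ε (2 * γ + 1 - s) ∧
      (ε (2 * γ + 1 - s) = s → ε = stairProfile γ (2 * γ + 1) (4 * γ + 2 - 2 * s)) := by
  obtain ⟨f, hf, a, b, h, ho, hprof⟩ := hε
  have hb := ne_zero_of_two_lt_addOrderOf hf h (by omega)
  have h1 := (smul_mem_ThetaZero_iff hf h _ _).1 (hprof (2 * γ + 1 - s))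
  constructor
  · by_contra! hlt
    exact low_of_succ hf h hb (2 * γ + 1 - s) _ (by omega) h1.1
  · intro heq
    have hN : 4 * γ + 2 - 2 * s = 2 * (2 * γ + 1 - s) := by omega
    rw [hN] at ho ⊢
    refine hprof.unique (hasMultProfile_of_addOrderOf hf h hb (by omega) (by omega) ho ?_
      fun j _ => low_of_succ hf h hb j)
    exact h1.1.mono le_rfl (by omega)

/-- The only freedom is whether a function of pole order at most `2γ + 1` vanishes to order `γ + 2`.
-/
lemma torsionProfiles_add_four_subset (hγ : 2 ≤ γ) :
    torsionProfiles k γ (2 * γ + 4) ⊆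
      {stairProfile γ (2 * γ + 2) (2 * γ + 4), stairProfile γ (2 * γ + 1) (2 * γ + 4)} := by
  rintro ε ⟨f, hf, a, b, h, ho, hprof⟩
  have hb := ne_zero_of_two_lt_addOrderOf hf h (by omega)
  have ho' : addOrderOf (pointClass (.affine a b h)) = 2 * (γ + 2) := by omega
  have hN : 2 * γ + 4 = 2 * (γ + 2) := by omega
  rw [hN]
  by_cases hfun : HasFun f a b (γ + 2) (2 * γ + 1)
  · right
    exact hprof.unique (hasMultProfile_of_addOrderOf hf h hb (by omega) (by omega) ho' hfun
      fun j _ => low_of_succ hf h hb j)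
  · left
    refine hprof.unique (hasMultProfile_of_addOrderOf hf h hb (by omega) (by omega) ho' ?_
      fun j _ => low_of_add_two hf h hb hfun j)
    exact (hasFun_add_genus hf h hb _).mono le_rfl (by omega)

lemma torsionProfiles_add_six_subset (hγ : 2 ≤ γ) :
    torsionProfiles k γ (2 * γ + 6) ⊆
      {stairProfile γ (2 * γ + 3) (2 * γ + 6), stairProfile γ (2 * γ + 2) (2 * γ + 6),
        stairProfile γ (2 * γ + 1) (2 * γ + 6)} := by
  rintro ε ⟨f, hf, a, b, h, ho, hprof⟩
  have hb := ne_zero_of_two_lt_addOrderOf hf h (by omega)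
  have ho' : addOrderOf (pointClass (.affine a b h)) = 2 * (γ + 3) := by omega
  have hN : 2 * γ + 6 = 2 * (γ + 3) := by omega
  rw [hN]
  by_cases hfun : HasFun f a b (γ + 2) (2 * γ + 1)
  · right; right
    refine hprof.unique (hasMultProfile_of_addOrderOf hf h hb (by omega) (by omega) ho' ?_
      fun j _ => low_of_succ hf h hb j)
    refine hasFun_step hf h hb hfun ?_
    -- Order `2γ + 6` makes the multiples by `γ + 2` and `γ + 4` opposite, so a small entry at `γ +
    -- 2` also gives the second input of `hasFun_step`.
    have h2 : (γ + 2) • pointClass (.affine a b h) ∈ Theta f (γ - 1) := by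
      rw [smul_mem_Theta_iff hf]
      exact hfun.mono le_rfl (by omega)
    have h4 : (γ + 4) • pointClass (.affine a b h) = -((γ + 2) • pointClass (.affine a b h)) := by
      rw [eq_neg_iff_add_eq_zero, ← add_nsmul, show γ + 4 + (γ + 2) = 2 * (γ + 3) by ring, ← ho',
        addOrderOf_nsmul_eq_zero]
    have h5 := neg_mem_Theta hf h2
    rw [← h4, smul_mem_Theta_iff hf] at h5
    exact h5.mono le_rfl (by omega)
  · by_cases hfun' : HasFun f a b (γ + 3) (2 * γ + 2)
    · right; left
      exact hprof.unique (hasMultProfile_of_addOrderOf hf h hb (by omega) (by omega) ho' hfun'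
        fun j _ => low_of_add_two hf h hb hfun j)
    · left
      refine hprof.unique (hasMultProfile_of_addOrderOf hf h hb (by omega) (by omega) ho' ?_
        (low_of_add_three hf h hb hfun hfun'))
      exact (hasFun_add_genus hf h hb _).mono le_rfl (by omega)

end Profiles

/-! ### The explicit families under nondegeneracy conditions. -/

section Families

variable {k : Type*} [Field k]

lemma monic_rootPoly {n : ℕ} (a : Fin n → k) : (rootPoly a).Monic :=
  monic_prod_of_monic _ _ fun i _ => monic_X_sub_C (a i)

lemma natDegree_rootPoly {n : ℕ} (a : Fin n → k) : (rootPoly a).natDegree = n := by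
  rw [rootPoly, natDegree_prod_of_monic _ _ fun i _ => monic_X_sub_C (a i)]
  simp

lemma nextCoeff_rootPoly {n : ℕ} (a : Fin n → k) : (rootPoly a).nextCoeff = -∑ i, a i := by
  rw [rootPoly, prod_X_sub_C_nextCoeff]

lemma eval_rootPoly_eq_zero {n : ℕ} (a : Fin n → k) (i : Fin n) : (rootPoly a).eval (a i) = 0 := by
  rw [rootPoly, eval_prod]
  exact Finset.prod_eq_zero (Finset.mem_univ i) (by simp)

lemma eval_zero_rootPoly_ne_zero {n : ℕ} {a : Fin n → k} (ha : ∀ i, a i ≠ 0) :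
    (rootPoly a).eval 0 ≠ 0 := by
  rw [rootPoly, eval_prod, Finset.prod_ne_zero_iff]
  intro i _
  simpa using ha i

lemma injective_of_separable_rootPoly {n : ℕ} {a : Fin n → k} (h : (rootPoly a).Separable) :
    Function.Injective a :=
  separable_prod_X_sub_C_iff.1 h

lemma separable_C_mul {c : k} (hc : c ≠ 0) {p : k[X]} (hp : p.Separable) :
    (C c * p).Separable :=
  hp.unit_mul (isUnit_C.2 hc.isUnit)

lemma natDegree_X_pow_sub_monic {M : k[X]} (hM : M.Monic) {n : ℕ} (hn : M.natDegree = n + 1)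
    (h : M.nextCoeff ≠ 0) :
    (X ^ (n + 1) - M).natDegree = n ∧ (X ^ (n + 1) - M).leadingCoeff = -M.nextCoeff := by
  have hnext : M.nextCoeff = M.coeff n := by
    rw [nextCoeff_of_natDegree_pos (by omega), hn, Nat.add_sub_cancel]
  have hcoeff : (X ^ (n + 1) - M).coeff n = -M.nextCoeff := by
    rw [coeff_sub, coeff_X_pow, if_neg (by omega), zero_sub, hnext]
  have hle : (X ^ (n + 1) - M).natDegree ≤ n := by
    rw [natDegree_le_iff_coeff_eq_zero]
    intro N hN
    rw [coeff_sub, coeff_X_pow]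
    split_ifs with h1
    · rw [h1, ← hn, hM.coeff_natDegree, sub_self]
    · rw [coeff_eq_zero_of_natDegree_lt (by omega), sub_zero]
  have heq : (X ^ (n + 1) - M).natDegree = n :=
    le_antisymm hle (le_natDegree_of_ne_zero (by rw [hcoeff]; exact neg_ne_zero.2 h))
  exact ⟨heq, by rw [leadingCoeff, heq, hcoeff]⟩

lemma secondAux_degree {s r : ℕ} (a : Fin s → k) (b : Fin r → k) {n : ℕ} (hn : s + 2 * r = n + 1)
    (h : ∑ i, a i + 2 * ∑ j, b j ≠ 0) :
    (secondAux a b).natDegree = n ∧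
      (secondAux a b).leadingCoeff = ∑ i, a i + 2 * ∑ j, b j := by
  have hM : (rootPoly a * rootPoly b ^ 2).Monic := (monic_rootPoly a).mul ((monic_rootPoly b).pow 2)
  have hd : (rootPoly a * rootPoly b ^ 2).natDegree = n + 1 := by
    rw [(monic_rootPoly a).natDegree_mul ((monic_rootPoly b).pow 2), natDegree_pow,
      natDegree_rootPoly, natDegree_rootPoly, hn]
  have hnc : (rootPoly a * rootPoly b ^ 2).nextCoeff = -(∑ i, a i + 2 * ∑ j, b j) := by
    rw [(monic_rootPoly a).nextCoeff_mul ((monic_rootPoly b).pow 2),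
      (monic_rootPoly b).nextCoeff_pow, nextCoeff_rootPoly, nextCoeff_rootPoly]
    simp [two_mul]
    ring
  have := natDegree_X_pow_sub_monic hM hd (by rw [hnc]; exact neg_ne_zero.2 h)
  rwa [hnc, neg_neg, ← hn] at this

lemma isOddHyperelliptic_of_factor {γ s n : ℕ} {a : Fin s → k} {g f : k[X]} {c : k}
    (hg : g.natDegree = n) (hsn : s + n = 2 * γ + 1) (hc : c * g.leadingCoeff = 1)
    (hsep : (rootPoly a * g).Separable) (hf : f = C c * rootPoly a * g) :
    IsOddHyperelliptic γ f := by
  have hc0 : c ≠ 0 := left_ne_zero_of_mul_eq_one hc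
  have hg0 : g ≠ 0 := by
    rintro rfl
    simp at hc
  rw [hf, mul_assoc]
  refine ⟨?_, ?_, separable_C_mul hc0 hsep⟩
  · rw [Monic, leadingCoeff_mul, leadingCoeff_mul, leadingCoeff_C, (monic_rootPoly a).leadingCoeff,
      one_mul, hc]
  · rw [natDegree_C_mul hc0, (monic_rootPoly a).natDegree_mul' hg0, natDegree_rootPoly, hg, hsn]

variable [CharZero k] [IsAlgClosed k] {γ : ℕ} {f : k[X]}

/-- A point whose `n`-th multiple is a sum of `s` Weierstrass points, because of the function
`v - y`. -/
lemma half_order (hf : IsOddHyperelliptic γ f) {b : k} (h : b ^ 2 = f.eval 0) (hb : b ≠ 0)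
    {ι : Type*} [Fintype ι] {w : ι → k} (hw : Function.Injective w)
    (hwf : ∀ i, (0 : k) ^ 2 = f.eval (w i)) {v : k[X]} (hv : v.eval 0 = b) {c : k} (hc : c ≠ 0)
    {n : ℕ} (hN : v ^ 2 - f = C c * X ^ n * ∏ i, (X - C (w i))) :
    n • pointClass (.affine 0 b h) = ∑ i, pointClass (.affine (w i) 0 (hwf i)) ∧
    2 • ∑ i, pointClass (.affine (w i) 0 (hwf i)) = 0 ∧
    (2 * n) • pointClass (.affine 0 b h) = 0 ∧
    HasFun f 0 b n (n + Fintype.card ι) ∧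
    regFun f v (C (-1)) ∈ pointIdeal f 0 b ^ n := by
  have h1 := smul_pointClass_eq_sum hf h hb hw hwf hv hc (n := n) (by simpa using hN)
  have h2 : 2 • ∑ i, pointClass (.affine (w i) 0 (hwf i)) = 0 := by
    rw [Finset.smul_sum]
    exact Finset.sum_eq_zero fun i _ => two_smul_pointClass hf (hwf i)
  refine ⟨h1, h2, by rw [mul_nsmul', h1, h2], ?_, ?_⟩
  · rw [← smul_mem_Theta_iff hf h, h1]
    refine ⟨fun i => .affine (w ((Fintype.equivFin ι).symm i)) 0 (hwf _), ?_⟩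
    exact (Fintype.equivFin ι).symm.sum_comp fun i => pointClass (.affine (w i) 0 (hwf i))
  · refine mem_pow_of_dvd_regNorm hf h ?_ ?_
    · refine ⟨C c * ∏ i, (X - C (w i)), ?_⟩
      rw [regNorm, ← C_pow, neg_one_sq, C_1, mul_one, hN]
      simp only [C_0, sub_zero]
      ring
    · simp [hv, ← two_mul, hb]

lemma order_profile_of_succ (hγ : 1 ≤ γ) (hf : IsOddHyperelliptic γ f) {a b : k}
    (h : b ^ 2 = f.eval a) (hb : b ≠ 0) {n N : ℕ} (hNn : N = 2 * n) (hn : 0 < n)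
    (hnγ : n ≤ 2 * γ) (hN : (2 * n) • pointClass (.affine a b h) = 0)
    (hup : HasFun f a b n (2 * γ + 1)) :
    addOrderOf (pointClass (.affine a b h)) = N ∧
      HasMultProfile (pointClass (.affine a b h)) (stairProfile γ (2 * γ + 1) N) := by
  subst hNn
  have hlow := fun j (_ : j ≤ n) => low_of_succ hf h hb j
  exact ⟨addOrderOf_eq hf h hγ hn (by omega) hN hlow,
    hasMultProfile_stair hf h hb hn (by omega) hN hup hlow⟩

lemma order_profile_of_add_two (hγ : 1 ≤ γ) (hf : IsOddHyperelliptic γ f) {a b : k}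
    (h : b ^ 2 = f.eval a) (hb : b ≠ 0) {n N : ℕ} (hNn : N = 2 * n) (hn : γ + 2 ≤ n)
    (hnγ : n ≤ 2 * γ + 1) (hN : (2 * n) • pointClass (.affine a b h) = 0)
    (hup : HasFun f a b n (2 * γ + 2)) {v : k[X]} (hv : v.natDegree = γ + 1) {β : k}
    (hmem : regFun f v (C β) ∈ pointIdeal f a b ^ n) :
    addOrderOf (pointClass (.affine a b h)) = N ∧
      HasMultProfile (pointClass (.affine a b h)) (stairProfile γ (2 * γ + 2) N) := by
  subst hNn
  have hno := not_hasFun_of_natDegree hf h hb (m := 2 * γ + 1) (by omega) (by omega) hv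
    (Ideal.pow_le_pow_right hn hmem)
  have hlow := fun j (_ : j ≤ n) => low_of_add_two hf h hb hno j
  exact ⟨addOrderOf_eq hf h hγ (by omega) (by omega) hN hlow,
    hasMultProfile_stair hf h hb (by omega) (by omega) hN hup hlow⟩

lemma order_profile_of_add_three (hγ : 1 ≤ γ) (hf : IsOddHyperelliptic γ f) {b : k}
    (h : b ^ 2 = f.eval 0) (hb : b ≠ 0) {N : ℕ} (hNn : N = 2 * (γ + 3)) (hγ2 : 2 ≤ γ)
    (hN : (2 * (γ + 3)) • pointClass (.affine 0 b h) = 0)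
    {v : k[X]} (hv : v.natDegree = γ + 2) (hv' : v.coeff (γ + 1) ≠ 0) {β : k}
    (hmem : regFun f v (C β) ∈ pointIdeal f 0 b ^ (γ + 3)) :
    addOrderOf (pointClass (.affine 0 b h)) = N ∧
      HasMultProfile (pointClass (.affine 0 b h)) (stairProfile γ (2 * γ + 3) N) := by
  subst hNn
  have hno := not_hasFun_of_natDegree hf h hb (m := 2 * γ + 2) (by omega) (by omega) hv hmem
  have hno' := not_hasFun_of_coeff hf h hb hv' (Ideal.pow_le_pow_right (by omega) hmem)
  have hlow := low_of_add_three hf h hb hno' hno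
  refine ⟨addOrderOf_eq hf h hγ (by omega) (by omega) hN hlow,
    hasMultProfile_stair hf h hb (by omega) (by omega) hN ?_ hlow⟩
  exact (hasFun_add_genus hf h hb _).mono le_rfl (by omega)

/-- The function `v - y` has `deg v = γ + 1`, hence pole order `2γ + 2`: it gives the upper bound,
and its degree rules out the competitor of pole order `2γ + 1`. -/
lemma second_family {s r : ℕ} (hγ : 1 ≤ γ) (hsr : s + r = γ + 1) (a : Fin s → k) (b : Fin r → k)
    (hS : ∑ i, a i + 2 * ∑ j, b j ≠ 0) (hsep : (rootPoly a * secondAux a b).Separable)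
    (ha : ∀ i, a i ≠ 0) (hb : ∀ j, b j ≠ 0) :
    (secondAux a b).Separable ∧ (secondAux a b).natDegree = 2 * γ + 1 - s ∧
      ∀ (c : k) (f : k[X]), c = (∑ i, a i + 2 * ∑ j, b j)⁻¹ →
        f = C c * rootPoly a * secondAux a b →
        IsOddHyperelliptic γ f ∧
        ∀ (κ : k) (v : k[X]), κ ^ 2 = -c → v = C κ * rootPoly a * rootPoly b →
          ∃ (hp : v.eval 0 ^ 2 = f.eval 0) (hw : ∀ i, (0 : k) ^ 2 = f.eval (a i)),
            (2 * γ + 2 - s) • pointClass (.affine 0 (v.eval 0) hp) =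
              ∑ i, pointClass (.affine (a i) 0 (hw i)) ∧
            2 • ∑ i, pointClass (.affine (a i) 0 (hw i)) = 0 ∧
            (1 ≤ s → s ≤ γ →
              addOrderOf (pointClass (.affine 0 (v.eval 0) hp)) = 4 * γ + 4 - 2 * s ∧
              HasMultProfile (pointClass (.affine 0 (v.eval 0) hp))
                (stairProfile γ (2 * γ + 2) (4 * γ + 4 - 2 * s))) := by
  have hd := secondAux_degree a b (n := 2 * γ + 1 - s) (by omega) hS
  refine ⟨hsep.of_mul_right, hd.1, fun c f hc hf => ?_⟩
  have hodd : IsOddHyperelliptic γ f := isOddHyperelliptic_of_factor hd.1 (by omega)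
    (by rw [hd.2, hc, inv_mul_cancel₀ hS]) hsep hf
  refine ⟨hodd, fun κ v hκ hv => ?_⟩
  have hc0 : -c ≠ 0 := by rw [hc]; exact neg_ne_zero.2 (inv_ne_zero hS)
  have hκ0 : κ ≠ 0 := by
    rintro rfl
    exact hc0 (by rw [← hκ]; simp)
  have hN : v ^ 2 - f = C (-c) * X ^ (2 * γ + 2 - s) * ∏ i, (X - C (a i)) := by
    have hκ' : C κ ^ 2 = -C c := by rw [← C_pow, hκ, C_neg]
    change _ = C (-c) * X ^ (2 * γ + 2 - s) * rootPoly a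
    rw [hv, hf, secondAux, show s + 2 * r = 2 * γ + 2 - s by omega, C_neg]
    linear_combination (rootPoly a * rootPoly b) ^ 2 * hκ'
  have hw : ∀ i, (0 : k) ^ 2 = f.eval (a i) := fun i => by
    rw [hf]
    simp [eval_rootPoly_eq_zero]
  have hv0 : v.eval 0 ≠ 0 := by
    rw [hv]
    simp [hκ0, eval_zero_rootPoly_ne_zero ha, eval_zero_rootPoly_ne_zero hb]
  have hp : v.eval 0 ^ 2 = f.eval 0 := by
    have := congrArg (eval 0) hN
    simp only [eval_sub, eval_pow, eval_mul, eval_X, zero_pow (by omega : 2 * γ + 2 - s ≠ 0),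
      mul_zero, zero_mul, sub_eq_zero] at this
    exact this
  obtain ⟨h1, h2, h3, h4, h5⟩ := half_order hodd hp hv0
    (injective_of_separable_rootPoly hsep.of_mul_left) hw rfl hc0 hN
  refine ⟨hp, hw, h1, h2, fun hs1 hsγ => ?_⟩
  refine order_profile_of_add_two hγ hodd hp hv0 (by omega) (by omega) (by omega) h3
    (h4.mono le_rfl (by simp; omega)) ?_ h5
  rw [hv, mul_assoc, natDegree_C_mul hκ0, (monic_rootPoly a).natDegree_mul (monic_rootPoly b),
    natDegree_rootPoly, natDegree_rootPoly, hsr]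

lemma thirdAux_degree {s n : ℕ} (hn : s + 2 < n) (a : Fin s → k) (b : k) {c : k} (hc : c ≠ 0) :
    (thirdAux n a b c).natDegree = n ∧ (thirdAux n a b c).leadingCoeff = c := by
  have h1 : (C c * X ^ n : k[X]).natDegree = n := natDegree_C_mul_X_pow n c hc
  have h2 : (rootPoly a * (X - C b) ^ 2).natDegree = s + 2 := by
    rw [(monic_rootPoly a).natDegree_mul ((monic_X_sub_C b).pow 2), natDegree_pow,
      natDegree_rootPoly, natDegree_X_sub_C]
  have h3 : (thirdAux n a b c).natDegree = n := by
    rw [thirdAux, natDegree_add_eq_left_of_natDegree_lt (by omega), h1]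
  refine ⟨h3, ?_⟩
  rw [leadingCoeff, h3, thirdAux, coeff_add, coeff_C_mul, coeff_X_pow_self, mul_one,
    coeff_eq_zero_of_natDegree_lt (by omega), add_zero]

/-- Now `deg v = s + 1 ≤ γ`, so `v - y` has the least pole order of a function involving `y`, namely
`2γ + 1`, and no competitor needs to be excluded. -/
lemma third_family {s : ℕ} (hs1 : 1 ≤ s) (hsγ : s + 1 ≤ γ) (a : Fin s → k) (b c : k)
    (hc : c ≠ 0) (hsep : (rootPoly a * thirdAux (2 * γ + 1 - s) a b c).Separable)
    (ha : ∀ i, a i ≠ 0) (hb : b ≠ 0) :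
    (thirdAux (2 * γ + 1 - s) a b c).Separable ∧
      (thirdAux (2 * γ + 1 - s) a b c).natDegree = 2 * γ + 1 - s ∧
      ∀ f : k[X], f = C c⁻¹ * rootPoly a * thirdAux (2 * γ + 1 - s) a b c →
        IsOddHyperelliptic γ f ∧
        ∀ (κ : k) (v : k[X]), κ ^ 2 = c⁻¹ → v = C κ * rootPoly a * (X - C b) →
          ∃ (hp : v.eval 0 ^ 2 = f.eval 0) (hw : ∀ i, (0 : k) ^ 2 = f.eval (a i)),
            (2 * γ + 1 - s) • pointClass (.affine 0 (v.eval 0) hp) =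
              ∑ i, pointClass (.affine (a i) 0 (hw i)) ∧
            addOrderOf (pointClass (.affine 0 (v.eval 0) hp)) = 4 * γ + 2 - 2 * s ∧
            HasMultProfile (pointClass (.affine 0 (v.eval 0) hp))
              (stairProfile γ (2 * γ + 1) (4 * γ + 2 - 2 * s)) := by
  have hd := thirdAux_degree (n := 2 * γ + 1 - s) (by omega) a b hc
  refine ⟨hsep.of_mul_right, hd.1, fun f hf => ?_⟩
  have hodd : IsOddHyperelliptic γ f := isOddHyperelliptic_of_factor hd.1 (by omega)
    (by rw [hd.2, inv_mul_cancel₀ hc]) hsep hf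
  refine ⟨hodd, fun κ v hκ hv => ?_⟩
  have hκ0 : κ ≠ 0 := by
    rintro rfl
    exact inv_ne_zero hc (by rw [← hκ]; simp)
  have hN : v ^ 2 - f = C (-1) * X ^ (2 * γ + 1 - s) * ∏ i, (X - C (a i)) := by
    have hκ' : C κ ^ 2 = C c⁻¹ := by rw [← C_pow, hκ]
    have hcc : C c⁻¹ * C c = 1 := by rw [← C_mul, inv_mul_cancel₀ hc, C_1]
    change _ = C (-1) * X ^ (2 * γ + 1 - s) * rootPoly a
    rw [hv, hf, thirdAux, C_neg, C_1]
    linear_combination (rootPoly a * (X - C b)) ^ 2 * hκ' -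
      rootPoly a * X ^ (2 * γ + 1 - s) * hcc
  have hw : ∀ i, (0 : k) ^ 2 = f.eval (a i) := fun i => by
    rw [hf]
    simp [eval_rootPoly_eq_zero]
  have hv0 : v.eval 0 ≠ 0 := by
    rw [hv]
    simp [hκ0, eval_zero_rootPoly_ne_zero ha, hb]
  have hp : v.eval 0 ^ 2 = f.eval 0 := by
    have := congrArg (eval 0) hN
    simp only [eval_sub, eval_pow, eval_mul, eval_X, zero_pow (by omega : 2 * γ + 1 - s ≠ 0),
      mul_zero, zero_mul, sub_eq_zero] at this
    exact this
  obtain ⟨h1, h2, h3, h4, h5⟩ := half_order hodd hp hv0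
    (injective_of_separable_rootPoly hsep.of_mul_left) hw rfl (neg_ne_zero.2 one_ne_zero) hN
  exact ⟨hp, hw, h1, order_profile_of_succ (by omega) hodd hp hv0 (by omega) (by omega) (by omega)
    h3 (h4.mono le_rfl (by simp; omega))⟩

/-- `∏ (x - a_i) (x - b)²` as a product over a multiset of roots. -/
lemma rootPoly_mul_sq_eq {n : ℕ} (a : Fin n → k) (b : k) :
    rootPoly a * (X - C b) ^ 2 =
      ((Finset.univ.val.map a + {b, b}).map fun t => X - C t).prod := by
  rw [Multiset.map_add, Multiset.prod_add, Multiset.map_map]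
  simp [rootPoly, Finset.prod_eq_multiset_prod, pow_two]

/-- Vieta: up to sign, `e₁` and `e₂` are the two coefficients after the leading one. -/
lemma mem_fourthLocus_iff {n : ℕ} (a : Fin (n + 1) → k) (b : k) :
    (a, b) ∈ fourthLocus k (n + 1) ↔ (rootPoly a * (X - C b) ^ 2).coeff (n + 2) = 0 ∧
      (rootPoly a * (X - C b) ^ 2).coeff (n + 1) = 0 := by
  have hcard : (Finset.univ.val.map a + {b, b}).card = n + 3 := by simp
  rw [rootPoly_mul_sq_eq, Multiset.prod_X_sub_C_coeff _ (by omega),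
    Multiset.prod_X_sub_C_coeff _ (by omega), hcard, show n + 3 - (n + 2) = 1 by omega,
    show n + 3 - (n + 1) = 2 by omega]
  simp [fourthLocus]

lemma natDegree_rootPoly_mul_sq {n : ℕ} (a : Fin n → k) (b : k) :
    (rootPoly a * (X - C b) ^ 2).Monic ∧ (rootPoly a * (X - C b) ^ 2).natDegree = n + 2 := by
  refine ⟨(monic_rootPoly a).mul ((monic_X_sub_C b).pow 2), ?_⟩
  rw [(monic_rootPoly a).natDegree_mul ((monic_X_sub_C b).pow 2), natDegree_pow,
    natDegree_rootPoly, natDegree_X_sub_C]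

lemma fourthAux_natDegree_le {n : ℕ} {a : Fin (n + 1) → k} {b : k}
    (h : (a, b) ∈ fourthLocus k (n + 1)) : (fourthAux a b).natDegree ≤ n := by
  rw [mem_fourthLocus_iff] at h
  obtain ⟨hm, hd⟩ := natDegree_rootPoly_mul_sq a b
  rw [natDegree_le_iff_coeff_eq_zero]
  intro N hN
  rw [fourthAux, coeff_sub, coeff_X_pow]
  rcases lt_trichotomy N (n + 3) with h1 | h1 | h1
  · rw [if_neg (by omega), zero_sub, neg_eq_zero]
    rcases (by omega : N = n + 2 ∨ N = n + 1) with rfl | rfl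
    exacts [h.1, h.2]
  · rw [if_pos (by omega), h1, show n + 3 = n + 1 + 2 by omega, ← hd, hm.coeff_natDegree, sub_self]
  · rw [if_neg (by omega), coeff_eq_zero_of_natDegree_lt (by omega), sub_zero]

lemma sum_eq_of_mem_fourthLocus {n : ℕ} {a : Fin (n + 1) → k} {b : k}
    (h : (a, b) ∈ fourthLocus k (n + 1)) : ∑ i, a i + 2 * b = 0 := by
  obtain ⟨hm, hd⟩ := natDegree_rootPoly_mul_sq a b
  have h1 : (rootPoly a * (X - C b) ^ 2).nextCoeff = 0 := by
    rw [nextCoeff_of_natDegree_pos (by omega), hd]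
    exact ((mem_fourthLocus_iff a b).1 h).1
  rw [(monic_rootPoly a).nextCoeff_mul ((monic_X_sub_C b).pow 2), (monic_X_sub_C b).nextCoeff_pow,
    nextCoeff_rootPoly, nextCoeff_X_sub_C, two_nsmul] at h1
  linear_combination -h1

/-- Here `v - y` has pole order `2γ + 4`, too large for an upper bound, which comes from the genus
instead. Its role is to bound the order of the class and to exclude the two competitors at `γ + 2`
and `γ + 3`. -/
lemma fourth_family (hγ : 2 ≤ γ) (a : Fin (γ + 1) → k) (b : k)
    (hab : (a, b) ∈ fourthLocus k (γ + 1)) (hcoeff : (fourthAux a b).coeff γ ≠ 0)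
    (hsep : (rootPoly a * fourthAux a b).Separable) (ha : ∀ i, a i ≠ 0) (hb : b ≠ 0) :
    a.Injective ∧ (∀ i, a i ≠ 0) ∧ b ≠ 0 ∧
      (fourthAux a b).Separable ∧ (fourthAux a b).natDegree = γ ∧
      ∀ (c : k) (f : k[X]), c = (fourthAux a b).leadingCoeff →
        f = C c⁻¹ * rootPoly a * fourthAux a b →
        IsOddHyperelliptic γ f ∧
        ∀ (κ : k) (v : k[X]), κ ^ 2 = -c⁻¹ → v = C κ * rootPoly a * (X - C b) →
          ∃ (hp : v.eval 0 ^ 2 = f.eval 0) (hw : ∀ i, (0 : k) ^ 2 = f.eval (a i)),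
            (γ + 3) • pointClass (.affine 0 (v.eval 0) hp) =
              ∑ i, pointClass (.affine (a i) 0 (hw i)) ∧
            addOrderOf (pointClass (.affine 0 (v.eval 0) hp)) = 2 * γ + 6 ∧
            HasMultProfile (pointClass (.affine 0 (v.eval 0) hp))
              (stairProfile γ (2 * γ + 3) (2 * γ + 6)) := by
  have hinj := injective_of_separable_rootPoly hsep.of_mul_left
  have hd : (fourthAux a b).natDegree = γ :=
    le_antisymm (fourthAux_natDegree_le hab) (le_natDegree_of_ne_zero hcoeff)
  refine ⟨hinj, ha, hb, hsep.of_mul_right, hd, fun c f hc hf => ?_⟩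
  have hc0 : c ≠ 0 := by rw [hc, leadingCoeff, hd]; exact hcoeff
  have hodd : IsOddHyperelliptic γ f := isOddHyperelliptic_of_factor hd (by omega)
    (by rw [← hc, inv_mul_cancel₀ hc0]) hsep hf
  refine ⟨hodd, fun κ v hκ hv => ?_⟩
  have hκ0 : κ ≠ 0 := by
    rintro rfl
    exact neg_ne_zero.2 (inv_ne_zero hc0) (by rw [← hκ]; simp)
  have hN : v ^ 2 - f = C (-c⁻¹) * X ^ (γ + 3) * ∏ i, (X - C (a i)) := by
    have hκ' : C κ ^ 2 = -C c⁻¹ := by rw [← C_pow, hκ, C_neg]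
    change _ = C (-c⁻¹) * X ^ (γ + 3) * rootPoly a
    rw [hv, hf, fourthAux, C_neg]
    linear_combination (rootPoly a * (X - C b)) ^ 2 * hκ'
  have hw : ∀ i, (0 : k) ^ 2 = f.eval (a i) := fun i => by
    rw [hf]
    simp [eval_rootPoly_eq_zero]
  have hv0 : v.eval 0 ≠ 0 := by
    rw [hv]
    simp [hκ0, eval_zero_rootPoly_ne_zero ha, hb]
  have hp : v.eval 0 ^ 2 = f.eval 0 := by
    have := congrArg (eval 0) hN
    simp only [eval_sub, eval_pow, eval_mul, eval_X, zero_pow (by omega : γ + 3 ≠ 0),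
      mul_zero, zero_mul, sub_eq_zero] at this
    exact this
  obtain ⟨h1, h2, h3, h4, h5⟩ := half_order hodd hp hv0 hinj hw rfl
    (neg_ne_zero.2 (inv_ne_zero hc0)) hN
  have hm : (rootPoly a * (X - C b)).Monic := (monic_rootPoly a).mul (monic_X_sub_C b)
  have hmd : (rootPoly a * (X - C b)).natDegree = γ + 2 := by
    rw [(monic_rootPoly a).natDegree_mul (monic_X_sub_C b), natDegree_rootPoly, natDegree_X_sub_C]
  refine ⟨hp, hw, h1, order_profile_of_add_three (by omega) hodd hp hv0 (by omega) hγ h3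
    (v := v) ?_ ?_ h5⟩
  · rw [hv, mul_assoc, natDegree_C_mul hκ0, hmd]
  -- The coefficient is `-(∑ a_i + b)`, and `e₁ = 0` says `∑ a_i = -2b`; this is where `b ≠ 0`
  -- enters the profile.
  · have hnc : (rootPoly a * (X - C b)).nextCoeff = b := by
      rw [(monic_rootPoly a).nextCoeff_mul (monic_X_sub_C b), nextCoeff_rootPoly,
        nextCoeff_X_sub_C]
      linear_combination -sum_eq_of_mem_fourthLocus hab
    rw [nextCoeff_of_natDegree_pos (by omega), hmd] at hnc
    rw [hv, mul_assoc, coeff_C_mul]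
    exact mul_ne_zero hκ0 (hnc.trans_ne hb)

end Families

/-! ### General position: discriminants and explicit nondegenerate members. -/

section Generic

variable {k : Type*} [Field k] [CharZero k]

/-- The discriminant of a family of polynomials, as a polynomial in the parameters. -/
lemma exists_discriminant {σ : Type*} (U : (MvPolynomial σ k)[X]) (m : ℕ) :
    ∃ F : MvPolynomial σ k, ∀ x : σ → k, (U.map (MvPolynomial.eval x)).natDegree = m + 1 →
      (MvPolynomial.eval x F ≠ 0 ↔ (U.map (MvPolynomial.eval x)).Separable) := by
  -- Fixing the formal degrees lets the resultant commute with specialization; in characteristic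
  -- zero they are the true degrees whenever the specialization has degree `m + 1`.
  refine ⟨resultant U (derivative U) (m + 1) m, fun x hx => ?_⟩
  rw [← resultant_map_map, ← derivative_map]
  set p := U.map (MvPolynomial.eval x)
  have hd : (derivative p).natDegree = m := by rw [natDegree_derivative, hx, Nat.add_sub_cancel]
  have hp : p ≠ 0 := by
    intro h
    rw [h] at hx
    simp at hx
  have := resultant_eq_zero_iff (f := p) (g := derivative p)
  rw [hx, hd] at this
  rw [Ne, this, Separable]
  tauto

variable [IsAlgClosed k]

lemma isCoprime_of_no_common_root {p q : k[X]} (h : ∀ x, p.eval x = 0 → q.eval x ≠ 0) :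
    IsCoprime p q := by
  rw [isCoprime_iff_aeval_ne_zero_of_isAlgClosed (k := k) k]
  intro x
  simp only [coe_aeval_eq_eval]
  by_contra! hcon
  exact h x hcon.1 hcon.2

/-- All but finitely many members of a pencil have no double root away from the base locus. -/
lemma pencil_finite (G₀ G₁ : k[X]) (hW : derivative G₀ * G₁ - G₀ * derivative G₁ ≠ 0) :
    {t : k | ∃ x, G₁.eval x ≠ 0 ∧ (G₀ + C t * G₁).eval x = 0 ∧
      (derivative (G₀ + C t * G₁)).eval x = 0}.Finite := by
  -- A double root `x` off the base locus is a zero of the Wronskian, and it determines `t = -G₀(x)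
  -- / G₁(x)`.
  refine (((derivative G₀ * G₁ - G₀ * derivative G₁).rootSet_finite k).image
    fun x => -G₀.eval x / G₁.eval x).subset ?_
  rintro t ⟨x, hx, h1, h2⟩
  simp only [eval_add, eval_mul, eval_C, derivative_add, derivative_C_mul] at h1 h2
  refine ⟨x, ?_, ?_⟩
  · rw [mem_rootSet]
    refine ⟨hW, ?_⟩
    simp only [coe_aeval_eq_eval, eval_sub, eval_mul]
    linear_combination G₁.eval x * h2 - (derivative G₁).eval x * h1
  · field_simp
    linear_combination -h1

/-- All but finitely many translates of a polynomial of degree `n` with two different roots have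
the property that their difference with `X ^ n` has no double root. -/
lemma translate_finite {G : k[X]} (hG : G.Monic) {n : ℕ} (hn : G.natDegree = n) {z₁ z₂ : k}
    (hz : z₁ ≠ z₂) (h1 : G.eval z₁ = 0) (h2 : G.eval z₂ = 0) :
    {t : k | ∃ x, (X ^ n - G.comp (X + C t)).eval x = 0 ∧
      (derivative (X ^ n - G.comp (X + C t))).eval x = 0}.Finite := by
  have hn0 : n ≠ 0 := by
    rintro rfl
    rw [hG.natDegree_eq_zero.1 hn] at h1
    simp at h1
  -- At a double root `x`, with `z = x + t`, one has `x^n = G(z)` and `n x^(n-1) = G'(z)`.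
  -- Eliminating `x` gives `D(z) = 0`.
  set D : k[X] := C ((n : k) ^ n) * G ^ (n - 1) - derivative G ^ n with hD
  have hD0 : D ≠ 0 := by
    classical
    intro h0
    rw [hD, sub_eq_zero] at h0
    have hc : ((n : k) ^ n) ≠ 0 := pow_ne_zero _ (Nat.cast_ne_zero.2 hn0)
    -- If `D = 0`, a root of multiplicity `e` satisfies `(n - 1) e = n (e - 1)`, so `e = n` and
    -- there is no room for a second root.
    have hmult : G.rootMultiplicity z₁ = n := by
      have hpos := (rootMultiplicity_pos hG.ne_zero).2 h1
      have h3 := congrArg (fun p => p.roots.count z₁) h0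
      simp only [roots_C_mul _ hc, roots_pow, Multiset.count_nsmul, count_roots,
        derivative_rootMultiplicity_of_root h1] at h3
      obtain ⟨m, hm⟩ := Nat.exists_eq_succ_of_ne_zero hpos.ne'
      obtain ⟨n', rfl⟩ := Nat.exists_eq_succ_of_ne_zero hn0
      rw [hm] at h3 ⊢
      simp only [Nat.succ_eq_add_one, Nat.add_sub_cancel] at h3 ⊢
      nlinarith
    have hdvd := pow_rootMultiplicity_dvd G z₁
    rw [hmult] at hdvd
    have heq := eq_of_monic_of_dvd_of_natDegree_le ((monic_X_sub_C z₁).pow n) hG hdvd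
      (by rw [natDegree_pow, natDegree_X_sub_C, hn, mul_one])
    rw [heq] at h2
    simp [hn0, sub_eq_zero, hz.symm] at h2
  -- For each of the finitely many `z`, `x` is an `n`-th root of `G(z)` and `t = z - x`.
  have hfin : (⋃ z ∈ D.rootSet k,
      (fun y => z - y) '' (X ^ n - C (G.eval z) : k[X]).rootSet k).Finite :=
    (D.rootSet_finite k).biUnion fun z _ => (rootSet_finite _ _).image _
  refine hfin.subset ?_
  rintro t ⟨x, hx, hx'⟩
  simp only [eval_sub, eval_pow, eval_X, eval_comp, eval_add, eval_C, derivative_sub,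
    derivative_X_pow, derivative_comp, derivative_add, derivative_X, derivative_C, eval_mul,
    add_zero, one_mul] at hx hx'
  refine Set.mem_biUnion (x := x + t) ?_ ⟨x, ?_, by ring⟩
  · rw [mem_rootSet]
    refine ⟨hD0, ?_⟩
    simp only [hD, coe_aeval_eq_eval, eval_sub, eval_mul, eval_pow, eval_C]
    rw [← sub_eq_zero.1 hx, ← sub_eq_zero.1 hx', mul_pow]
    ring
  · rw [mem_rootSet]
    exact ⟨X_pow_sub_C_ne_zero (Nat.pos_of_ne_zero hn0) _, by simpa using hx⟩

lemma exists_rootPoly_eq (n : ℕ) : ∀ p : k[X], p.Monic → p.natDegree = n →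
    ∃ a : Fin n → k, p = rootPoly a := by
  induction n with
  | zero =>
    intro p hp hd
    exact ⟨Fin.elim0, by rw [hp.natDegree_eq_zero.1 hd, rootPoly, Fin.prod_univ_zero]⟩
  | succ n ih =>
    intro p hp hd
    obtain ⟨r, hr⟩ := IsAlgClosed.exists_root p (by
      intro h
      have := natDegree_eq_of_degree_eq_some (n := 0) h
      omega)
    obtain ⟨q, rfl⟩ := dvd_iff_isRoot.2 hr
    have hq := (monic_X_sub_C r).of_mul_monic_left hp
    rw [(monic_X_sub_C r).natDegree_mul hq, natDegree_X_sub_C] at hd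
    obtain ⟨a, rfl⟩ := ih q hq (by omega)
    exact ⟨Fin.cons r a, by simp [rootPoly, Fin.prod_univ_succ]⟩

/-- A separability criterion for `P g` when `g ≡ λ x^n` modulo `P`. -/
lemma separable_rootPoly_mul {s n : ℕ} {a : Fin s → k} (ha : Function.Injective a)
    (ha0 : ∀ i, a i ≠ 0) {g q : k[X]} {c : k} (hc : c ≠ 0)
    (hg : g = C c * X ^ n + rootPoly a * q)
    (hdouble : ∀ x, g.eval x = 0 → (derivative g).eval x ≠ 0) :
    (rootPoly a * g).Separable := by
  refine (separable_prod_X_sub_C_iff.2 ha).mul (isCoprime_of_no_common_root hdouble)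
    (isCoprime_of_no_common_root fun x hx => ?_)
  have hx' : (rootPoly a).eval x = 0 := hx
  rw [hg]
  simp only [eval_add, eval_mul, eval_C, eval_pow, eval_X, hx', zero_mul, add_zero]
  refine mul_ne_zero hc (pow_ne_zero _ ?_)
  rintro rfl
  exact eval_zero_rootPoly_ne_zero ha0 hx'

lemma rootPoly_sub_const {n : ℕ} (a : Fin n → k) (t : k) :
    rootPoly (fun i => a i - t) = (rootPoly a).comp (X + C t) := by
  simp only [rootPoly, prod_comp]
  refine Finset.prod_congr rfl fun i _ => ?_
  simp
  ring

/-- Start from the distinct integers `0, …, γ` as roots and translate them all by a `t` that avoids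
double roots, zero parameters and a vanishing leading coefficient. -/
lemma second_witness {γ s r : ℕ} (hγ : 1 ≤ γ) (hsr : s + r = γ + 1) :
    ∃ (a : Fin s → k) (b : Fin r → k), ∑ i, a i + 2 * ∑ j, b j ≠ 0 ∧
      (rootPoly a * secondAux a b).Separable ∧ (∀ i, a i ≠ 0) ∧ (∀ j, b j ≠ 0) := by
  let a₀ : Fin s → k := fun i => (i : ℕ)
  let b₀ : Fin r → k := fun j => ((s + j : ℕ) : k)
  set G : k[X] := rootPoly a₀ * rootPoly b₀ ^ 2 with hG
  have hGm : G.Monic := (monic_rootPoly a₀).mul ((monic_rootPoly b₀).pow 2)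
  have hGd : G.natDegree = s + 2 * r := by
    rw [(monic_rootPoly a₀).natDegree_mul ((monic_rootPoly b₀).pow 2), natDegree_pow,
      natDegree_rootPoly, natDegree_rootPoly]
  have hroot : ∀ m : ℕ, m < s + r → G.eval (m : k) = 0 := by
    intro m hm
    rw [hG, eval_mul, eval_pow]
    rcases Nat.lt_or_ge m s with h | h
    · have := eval_rootPoly_eq_zero a₀ ⟨m, h⟩
      simp only [a₀] at this
      rw [this, zero_mul]
    · have := eval_rootPoly_eq_zero b₀ ⟨m - s, by omega⟩
      simp only [b₀, Nat.add_sub_cancel' h] at this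
      rw [this]
      simp
  have hfin := translate_finite hGm hGd (z₁ := ((0 : ℕ) : k)) (z₂ := ((1 : ℕ) : k)) (by simp)
    (hroot 0 (by omega)) (hroot 1 (by omega))
  have hfin' := ((hfin.union (Set.finite_range a₀)).union (Set.finite_range b₀)).union
    (Set.finite_singleton ((∑ i, a₀ i + 2 * ∑ j, b₀ j) / ((s + 2 * r : ℕ) : k)))
  obtain ⟨t, ht⟩ := hfin'.exists_notMem
  simp only [Set.mem_union, Set.mem_range, Set.mem_ofPred_eq, Set.mem_singleton_iff, not_or,
    not_exists, not_and] at ht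
  obtain ⟨⟨⟨h1, h2⟩, h3⟩, h4⟩ := ht
  have ha0 : ∀ i, a₀ i - t ≠ 0 := fun i => sub_ne_zero.2 (h2 i)
  have hn0 : ((s + 2 * r : ℕ) : k) ≠ 0 := Nat.cast_ne_zero.2 (by omega)
  refine ⟨fun i => a₀ i - t, fun j => b₀ j - t, ?_, ?_, ha0, fun j => sub_ne_zero.2 (h3 j)⟩
  · intro h0
    apply h4
    rw [eq_div_iff hn0]
    simp only [Finset.sum_sub_distrib, Finset.sum_const, Finset.card_univ, Fintype.card_fin,
      nsmul_eq_mul] at h0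
    push_cast
    linear_combination -h0
  · have heq : secondAux (fun i => a₀ i - t) (fun j => b₀ j - t) =
        X ^ (s + 2 * r) - G.comp (X + C t) := by
      rw [secondAux, rootPoly_sub_const, rootPoly_sub_const, hG, mul_comp, pow_comp]
    refine separable_rootPoly_mul ?_ ha0 (n := s + 2 * r) (c := 1)
      (q := -rootPoly (fun j => b₀ j - t) ^ 2) one_ne_zero ?_ fun x hx => ?_
    · intro i j hij
      have : ((i : ℕ) : k) = (j : ℕ) := by simpa [a₀] using hij
      exact Fin.ext (Nat.cast_injective this)
    · rw [secondAux, C_1]; ring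
    · rw [heq] at hx ⊢
      exact h1 x hx

/-- Only `c` varies, in the pencil spanned by `G` and `x^n`. The choice `b = 1` may coincide with
one of the `a_i`; this is harmless because the base point `x = 0` is not a root of `G`. -/
lemma third_witness {s n : ℕ} (hsn : s + 2 < n) :
    ∃ (a : Fin s → k) (b c : k), c ≠ 0 ∧ (rootPoly a * thirdAux n a b c).Separable ∧
      (∀ i, a i ≠ 0) ∧ b ≠ 0 := by
  let a : Fin s → k := fun i => ((i + 1 : ℕ) : k)
  have ha0 : ∀ i, a i ≠ 0 := fun i => Nat.cast_ne_zero.2 (Nat.succ_ne_zero _)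
  set G : k[X] := rootPoly a * (X - C 1) ^ 2 with hG
  obtain ⟨hGm, hGd⟩ := natDegree_rootPoly_mul_sq a (1 : k)
  have hW : derivative G * X ^ n - G * derivative (X ^ n : k[X]) ≠ 0 := by
    intro h0
    obtain ⟨n, rfl⟩ := Nat.exists_eq_succ_of_ne_zero (by omega : n ≠ 0)
    rw [derivative_X_pow_succ] at h0
    have h1 : (X : k[X]) ^ n * (X * derivative G - C ((n : k) + 1) * G) = 0 := by
      rw [← h0]
      simp only [Nat.succ_eq_add_one]
      ring
    have h2 := (mul_eq_zero.1 h1).resolve_left (pow_ne_zero _ X_ne_zero)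
    -- The top coefficient of `x G' - n G` is `deg G - n`, nonzero since `s + 2 < n`.
    have h3 := congrArg (fun p => p.coeff (s + 2)) h2
    simp only [coeff_sub, coeff_C_mul, coeff_X_mul, coeff_derivative, coeff_zero] at h3
    have h4 : G.coeff (s + 2) = 1 := by rw [← hGd]; exact hGm.coeff_natDegree
    rw [h4] at h3
    have h5 : ((s + 2 : ℕ) : k) = ((n + 1 : ℕ) : k) := by
      push_cast at h3 ⊢
      linear_combination h3
    have := Nat.cast_injective h5
    omega
  obtain ⟨c, hc⟩ := ((pencil_finite G (X ^ n) hW).union (Set.finite_singleton 0)).exists_notMem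
  simp only [Set.mem_union, Set.mem_ofPred_eq, Set.mem_singleton_iff, not_or, not_exists,
    not_and] at hc
  obtain ⟨h1, hc0⟩ := hc
  refine ⟨a, 1, c, hc0, ?_, ha0, one_ne_zero⟩
  have heq : thirdAux n a 1 c = G + C c * X ^ n := by rw [thirdAux, hG, add_comm]
  refine separable_rootPoly_mul ?_ ha0 hc0 rfl fun x hx => ?_
  · intro i j hij
    have := Nat.cast_injective (R := k) hij
    exact Fin.ext (by omega)
  · rw [heq] at hx ⊢
    refine h1 x ?_ hx
    intro hx0
    have hx0' : x = 0 := by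
      rw [eval_pow, eval_X] at hx0
      exact eq_zero_of_pow_eq_zero hx0
    subst hx0'
    rw [eval_add, eval_mul (p := C c), hx0, mul_zero, add_zero, hG, eval_mul] at hx
    simp [eval_zero_rootPoly_ne_zero ha0] at hx

/-- With `b = 1` the task is to find `g` of degree `γ` such that `(x - 1)²` divides `x^(γ+3) - g`;
the quotient then provides the `a_i`. The constants `α`, `β` solve `g₀(1) = 1`, `g₀'(1) = γ + 3`,
and adding `t (x - 1)²` to `g₀` replaces the quotient `P₀` by `P₀ - t`. For all but finitely many
`t` both are free of double roots. -/
lemma fourth_witness {γ : ℕ} (hγ : 2 ≤ γ) :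
    ∃ (a : Fin (γ + 1) → k) (b : k), (a, b) ∈ fourthLocus k (γ + 1) ∧
      (fourthAux a b).coeff γ ≠ 0 ∧ (rootPoly a * fourthAux a b).Separable ∧
      (∀ i, a i ≠ 0) ∧ b ≠ 0 := by
  have hγ0 : (γ : k) ≠ 0 := Nat.cast_ne_zero.2 (by omega)
  set α : k := (γ + 3) / γ with hα
  set β : k := -3 / γ with hβ
  have hα0 : α ≠ 0 := div_ne_zero (by exact_mod_cast (by omega : γ + 3 ≠ 0)) hγ0
  have hβ0 : β ≠ 0 := div_ne_zero (by norm_num) hγ0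
  have hαβ : α + β = 1 := by rw [hα, hβ]; field_simp; ring
  have hαγ : α * γ = γ + 3 := by rw [hα]; field_simp
  set g₀ : k[X] := C α * X ^ γ + C β with hg₀
  obtain ⟨P₀, hP₀⟩ : (X - C 1) ^ 2 ∣ X ^ (γ + 3) - g₀ := by
    obtain ⟨q, hq⟩ : X - C 1 ∣ X ^ (γ + 3) - g₀ := by
      rw [dvd_iff_isRoot]
      simp [hg₀, hαβ]
    have hq1 : X - C 1 ∣ q := by
      rw [dvd_iff_isRoot, IsRoot]
      have h1 := congrArg (fun p => (derivative p).eval 1) hq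
      simp [hg₀, derivative_X_pow] at h1
      rw [← h1]
      linear_combination -hαγ
    obtain ⟨q', rfl⟩ := hq1
    exact ⟨q', by rw [hq]; ring⟩
  have hH : (X ^ (γ + 3) - g₀).Monic ∧ (X ^ (γ + 3) - g₀).natDegree = γ + 3 := by
    have hlt : g₀.natDegree < (X ^ (γ + 3) : k[X]).natDegree := by
      rw [natDegree_X_pow, hg₀]
      refine (natDegree_add_le _ _).trans_lt ?_
      have := natDegree_C_mul_X_pow_le α γ
      rw [natDegree_C, Nat.max_zero]
      omega
    refine ⟨(monic_X_pow _).sub_of_left (degree_lt_degree hlt), ?_⟩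
    rw [natDegree_sub_eq_left_of_natDegree_lt hlt, natDegree_X_pow]
  have hsq : ((X - C 1 : k[X]) ^ 2).Monic := (monic_X_sub_C 1).pow 2
  have hP₀m : P₀.Monic := hsq.of_mul_monic_left (hP₀ ▸ hH.1)
  have hP₀d : P₀.natDegree = γ + 1 := by
    have := hH.2
    rw [hP₀, hsq.natDegree_mul hP₀m, natDegree_pow, natDegree_X_sub_C] at this
    omega
  have hW₁ : derivative P₀ * (-1) - P₀ * derivative (-1 : k[X]) ≠ 0 := by
    intro h0
    have h1 : derivative P₀ = 0 := by simpa using h0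
    have := derivative_eq_zero.1 h1
    omega
  -- The value of this Wronskian at `0` is `2β`, because `γ ≥ 2` kills the derivative of `g₀` there.
  have hW₂ : derivative g₀ * (X - C 1) ^ 2 - g₀ * derivative ((X - C 1) ^ 2 : k[X]) ≠ 0 := by
    intro h0
    have h1 := congrArg (eval 0) h0
    simp [hg₀, derivative_pow] at h1
    rw [zero_pow (by omega : γ - 1 ≠ 0), zero_pow (by omega : γ ≠ 0)] at h1
    simp [hβ0] at h1
  -- The last value protects the coefficient of `x^γ`, which `t` affects only when `γ = 2`;
  -- otherwise division by zero merely excludes `t = 0`.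
  obtain ⟨t, ht⟩ := ((((pencil_finite P₀ (-1) hW₁).union (pencil_finite g₀ _ hW₂)).union
    (Set.finite_singleton (-β))).union
    (Set.finite_singleton (-α / ((X - C 1 : k[X]) ^ 2).coeff γ))).exists_notMem
  simp only [Set.mem_union, Set.mem_ofPred_eq, Set.mem_singleton_iff, not_or, not_exists,
    not_and] at ht
  obtain ⟨⟨⟨h1, h2⟩, h3⟩, h4⟩ := ht
  have hPm : (P₀ - C t).Monic := hP₀m.sub_of_left
    (degree_C_le.trans_lt (natDegree_pos_iff_degree_pos.1 (by omega)))
  have hPd : (P₀ - C t).natDegree = γ + 1 := by rw [natDegree_sub_C, hP₀d]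
  obtain ⟨a, ha⟩ := exists_rootPoly_eq (γ + 1) _ hPm hPd
  have hg : fourthAux a 1 = g₀ + C t * (X - C 1) ^ 2 := by
    rw [fourthAux, ← ha, show γ + 1 + 2 = γ + 3 by omega]
    linear_combination hP₀
  have hcoeff : ∀ j, γ < j → (g₀ + C t * (X - C 1) ^ 2).coeff j = 0 := by
    intro j hj
    have hsqd : ((X - C 1 : k[X]) ^ 2).natDegree = 2 := by
      rw [natDegree_pow, natDegree_X_sub_C]
    rw [hg₀, coeff_add, coeff_add, coeff_C_mul_X_pow, if_neg (by omega), coeff_C,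
      if_neg (by omega), coeff_C_mul, coeff_eq_zero_of_natDegree_lt (by omega)]
    simp
  have hge0 : (fourthAux a 1).eval 0 ≠ 0 := by
    rw [hg]
    simp only [hg₀, eval_add, eval_mul, eval_C, eval_pow, eval_X, eval_sub,
      zero_pow (by omega : γ ≠ 0)]
    intro h0
    exact h3 (by linear_combination h0)
  have ha0 : ∀ i, a i ≠ 0 := by
    intro i hi
    apply hge0
    have := eval_rootPoly_eq_zero a i
    rw [hi] at this
    rw [fourthAux]
    simp [this]
  have hinj : Function.Injective a := by
    apply injective_of_separable_rootPoly
    rw [← ha]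
    refine isCoprime_of_no_common_root fun x hx => ?_
    have heq : P₀ - C t = P₀ + C t * (-1) := by ring
    rw [heq] at hx ⊢
    exact h1 x (by simp) hx
  refine ⟨a, 1, ?_, ?_, ?_, ha0, one_ne_zero⟩
  · rw [mem_fourthLocus_iff]
    have hPQ : rootPoly a * (X - C 1) ^ 2 = X ^ (γ + 3) - (g₀ + C t * (X - C 1) ^ 2) := by
      rw [← hg, fourthAux]
      ring
    rw [hPQ, coeff_sub, coeff_sub, hcoeff _ (by omega), hcoeff _ (by omega), coeff_X_pow,
      coeff_X_pow, if_neg (by omega), if_neg (by omega)]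
    simp
  · rw [hg, coeff_add, coeff_C_mul, hg₀, coeff_add, coeff_C_mul, coeff_X_pow_self, coeff_C,
      if_neg (by omega)]
    intro h0
    apply h4
    have hc0 : ((X - C 1 : k[X]) ^ 2).coeff γ ≠ 0 := by
      intro hc
      rw [hc] at h0
      simp [hα0] at h0
    rw [eq_div_iff hc0]
    linear_combination h0
  · refine separable_rootPoly_mul hinj ha0 (n := γ + 1 + 2) (c := 1) (q := -(X - C 1) ^ 2)
      one_ne_zero (by rw [fourthAux, C_1]; ring) fun x hx => ?_
    rw [hg] at hx ⊢
    refine h2 x ?_ hx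
    intro hx1
    have hx1' : x = 1 := by simpa [sub_eq_zero] using hx1
    subst hx1'
    simp [hg₀, hαβ] at hx

/-- `F` multiplies the leading coefficient, the discriminant of `f` up to scaling, and all
parameters. The leading coefficient must be a factor because the discriminant is meaningful only in
the expected degree. -/
lemma second_generic {γ s r : ℕ} (hγ : 1 ≤ γ) (hsr : s + r = γ + 1) :
    ∃ F : MvPolynomial (Fin s ⊕ Fin r) k, F ≠ 0 ∧
      ∀ (a : Fin s → k) (b : Fin r → k), F.eval (Sum.elim a b) ≠ 0 →
        ∑ i, a i + 2 * ∑ j, b j ≠ 0 ∧ (rootPoly a * secondAux a b).Separable ∧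
          (∀ i, a i ≠ 0) ∧ (∀ j, b j ≠ 0) := by
  let x : Fin s ⊕ Fin r → MvPolynomial (Fin s ⊕ Fin r) k := MvPolynomial.X
  let P : (MvPolynomial (Fin s ⊕ Fin r) k)[X] := ∏ i, (X - C (x (.inl i)))
  let Q : (MvPolynomial (Fin s ⊕ Fin r) k)[X] := ∏ j, (X - C (x (.inr j)))
  obtain ⟨D, hD⟩ := exists_discriminant (P * (X ^ (s + 2 * r) - P * Q ^ 2)) (2 * γ)
  have hmap : ∀ (a : Fin s → k) (b : Fin r → k),
      (P * (X ^ (s + 2 * r) - P * Q ^ 2)).map (MvPolynomial.eval (Sum.elim a b)) =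
        rootPoly a * secondAux a b := by
    intro a b
    simp [P, Q, x, Polynomial.map_prod, rootPoly, secondAux]
  have hsep : ∀ (a : Fin s → k) (b : Fin r → k), ∑ i, a i + 2 * ∑ j, b j ≠ 0 →
      (D.eval (Sum.elim a b) ≠ 0 ↔ (rootPoly a * secondAux a b).Separable) := by
    intro a b hS
    rw [← hmap]
    refine hD _ ?_
    have hd := secondAux_degree a b (n := 2 * γ + 1 - s) (by omega) hS
    have h0 : secondAux a b ≠ 0 := by
      rw [← leadingCoeff_ne_zero, hd.2]
      exact hS
    rw [hmap, (monic_rootPoly a).natDegree_mul' h0, natDegree_rootPoly, hd.1]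
    omega
  let F : MvPolynomial (Fin s ⊕ Fin r) k := (∑ i, x (.inl i) + 2 * ∑ j, x (.inr j)) * D *
    ((∏ i, x (.inl i)) * ∏ j, x (.inr j))
  have hF : ∀ (a : Fin s → k) (b : Fin r → k), F.eval (Sum.elim a b) =
      (∑ i, a i + 2 * ∑ j, b j) * D.eval (Sum.elim a b) * ((∏ i, a i) * ∏ j, b j) := by
    intro a b
    simp [F, x]
  refine ⟨F, ?_, fun a b h => ?_⟩
  · obtain ⟨a, b, h1, h2, h3, h4⟩ := second_witness (k := k) hγ hsr
    intro h0
    have h5 := hF a b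
    rw [h0, map_zero, eq_comm] at h5
    exact mul_ne_zero (mul_ne_zero h1 ((hsep a b h1).2 h2))
      (mul_ne_zero (Finset.prod_ne_zero_iff.2 fun i _ => h3 i)
        (Finset.prod_ne_zero_iff.2 fun i _ => h4 i)) h5
  · rw [hF] at h
    simp only [ne_eq, mul_eq_zero, not_or, Finset.prod_eq_zero_iff, Finset.mem_univ, true_and,
      not_exists] at h
    exact ⟨h.1.1, (hsep a b h.1.1).1 h.1.2, h.2.1, h.2.2⟩

lemma third_generic {γ s : ℕ} (hsγ : s + 1 ≤ γ) :
    ∃ F : MvPolynomial (Fin s ⊕ Fin 2) k, F ≠ 0 ∧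
      ∀ (a : Fin s → k) (b c : k), F.eval (Sum.elim a ![b, c]) ≠ 0 →
        c ≠ 0 ∧ (rootPoly a * thirdAux (2 * γ + 1 - s) a b c).Separable ∧
          (∀ i, a i ≠ 0) ∧ b ≠ 0 := by
  let x : Fin s ⊕ Fin 2 → MvPolynomial (Fin s ⊕ Fin 2) k := MvPolynomial.X
  let P : (MvPolynomial (Fin s ⊕ Fin 2) k)[X] := ∏ i, (X - C (x (.inl i)))
  set n := 2 * γ + 1 - s with hn
  set U := P * (C (x (.inr 1)) * X ^ n + P * (X - C (x (.inr 0))) ^ 2) with hU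
  obtain ⟨D, hD⟩ := exists_discriminant U (2 * γ)
  have hmap : ∀ (a : Fin s → k) (b c : k),
      U.map (MvPolynomial.eval (Sum.elim a ![b, c])) = rootPoly a * thirdAux n a b c := by
    intro a b c
    simp [hU, P, x, Polynomial.map_prod, rootPoly, thirdAux]
  have hsep : ∀ (a : Fin s → k) (b c : k), c ≠ 0 →
      (D.eval (Sum.elim a ![b, c]) ≠ 0 ↔ (rootPoly a * thirdAux n a b c).Separable) := by
    intro a b c hc
    rw [← hmap]
    refine hD _ ?_
    have hd := thirdAux_degree (n := n) (by omega) a b hc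
    have h0 : thirdAux n a b c ≠ 0 := by
      rw [← leadingCoeff_ne_zero, hd.2]
      exact hc
    rw [hmap, (monic_rootPoly a).natDegree_mul' h0, natDegree_rootPoly, hd.1]
    omega
  let F : MvPolynomial (Fin s ⊕ Fin 2) k := x (.inr 1) * D *
    ((∏ i, x (.inl i)) * x (.inr 0))
  have hF : ∀ (a : Fin s → k) (b c : k), F.eval (Sum.elim a ![b, c]) =
      c * D.eval (Sum.elim a ![b, c]) * ((∏ i, a i) * b) := by
    intro a b c
    simp [F, x]
  refine ⟨F, ?_, fun a b c h => ?_⟩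
  · obtain ⟨a, b, c, h1, h2, h3, h4⟩ := third_witness (k := k) (n := n) (s := s) (by omega)
    intro h0
    have h5 := hF a b c
    rw [h0, map_zero, eq_comm] at h5
    exact mul_ne_zero (mul_ne_zero h1 ((hsep a b c h1).2 h2))
      (mul_ne_zero (Finset.prod_ne_zero_iff.2 fun i _ => h3 i) h4) h5
  · rw [hF] at h
    simp only [ne_eq, mul_eq_zero, not_or, Finset.prod_eq_zero_iff, Finset.mem_univ, true_and,
      not_exists] at h
    exact ⟨h.1.1, (hsep a b c h.1.1).1 h.1.2, h.2.1, h.2.2⟩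

lemma fourth_generic {γ : ℕ} (hγ : 2 ≤ γ) :
    ∃ F : MvPolynomial (Fin (γ + 1) ⊕ Unit) k,
      (∃ z ∈ fourthLocus k (γ + 1), F.eval (Sum.elim z.1 fun _ => z.2) ≠ 0) ∧
      ∀ (a : Fin (γ + 1) → k) (b : k), (a, b) ∈ fourthLocus k (γ + 1) →
        F.eval (Sum.elim a fun _ => b) ≠ 0 →
        (fourthAux a b).coeff γ ≠ 0 ∧ (rootPoly a * fourthAux a b).Separable ∧
          (∀ i, a i ≠ 0) ∧ b ≠ 0 := by
  let x : Fin (γ + 1) ⊕ Unit → MvPolynomial (Fin (γ + 1) ⊕ Unit) k := MvPolynomial.X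
  let P : (MvPolynomial (Fin (γ + 1) ⊕ Unit) k)[X] := ∏ i, (X - C (x (.inl i)))
  set G := X ^ (γ + 1 + 2) - P * (X - C (x (.inr ()))) ^ 2 with hG
  obtain ⟨D, hD⟩ := exists_discriminant (P * G) (2 * γ)
  have hmapG : ∀ (a : Fin (γ + 1) → k) (b : k),
      G.map (MvPolynomial.eval (Sum.elim a fun _ => b)) = fourthAux a b := by
    intro a b
    simp [hG, P, x, Polynomial.map_prod, rootPoly, fourthAux]
  have hmap : ∀ (a : Fin (γ + 1) → k) (b : k),
      (P * G).map (MvPolynomial.eval (Sum.elim a fun _ => b)) = rootPoly a * fourthAux a b := by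
    intro a b
    rw [Polynomial.map_mul, hmapG]
    simp [P, x, Polynomial.map_prod, rootPoly]
  have hsep : ∀ (a : Fin (γ + 1) → k) (b : k), (a, b) ∈ fourthLocus k (γ + 1) →
      (fourthAux a b).coeff γ ≠ 0 →
      (D.eval (Sum.elim a fun _ => b) ≠ 0 ↔ (rootPoly a * fourthAux a b).Separable) := by
    intro a b hab hc
    rw [← hmap]
    refine hD _ ?_
    have hd : (fourthAux a b).natDegree = γ :=
      le_antisymm (fourthAux_natDegree_le hab) (le_natDegree_of_ne_zero hc)
    have h0 : fourthAux a b ≠ 0 := by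
      intro h0
      simp [h0] at hc
    rw [hmap, (monic_rootPoly a).natDegree_mul' h0, natDegree_rootPoly, hd]
    omega
  let F : MvPolynomial (Fin (γ + 1) ⊕ Unit) k := G.coeff γ * D *
    ((∏ i, x (.inl i)) * x (.inr ()))
  have hF : ∀ (a : Fin (γ + 1) → k) (b : k), F.eval (Sum.elim a fun _ => b) =
      (fourthAux a b).coeff γ * D.eval (Sum.elim a fun _ => b) * ((∏ i, a i) * b) := by
    intro a b
    rw [← hmapG, coeff_map]
    simp [F, x]
  refine ⟨F, ?_, fun a b hab h => ?_⟩
  · obtain ⟨a, b, hab, h1, h2, h3, h4⟩ := fourth_witness (k := k) hγ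
    refine ⟨(a, b), hab, ?_⟩
    rw [hF]
    exact mul_ne_zero (mul_ne_zero h1 ((hsep a b hab h1).2 h2))
      (mul_ne_zero (Finset.prod_ne_zero_iff.2 fun i _ => h3 i) h4)
  · rw [hF] at h
    simp only [ne_eq, mul_eq_zero, not_or, Finset.prod_eq_zero_iff, Finset.mem_univ, true_and,
      not_exists] at h
    exact ⟨h.1.1, (hsep a b hab h.1.1).1 h.1.2, h.2.1, h.2.2⟩

end Generic

/-! ### The explicit first family and its separability. -/

section FirstFamily

variable {k : Type*} [Field k] [CharZero k] [IsAlgClosed k]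

lemma firstPoly_eq {γ s : ℕ} :
    firstPoly k γ s = (X ^ (γ - s + 1) - 1) *
      (X ^ (γ + s) - C (1 / 2) * (X ^ (γ - s + 1) - 1)) := by
  have h1 : (C (-1 / 2) : k[X]) = -C (1 / 2) := by rw [← C_neg, neg_div]
  have h2 : (C (1 / 2) : k[X]) * 2 = 1 := by
    rw [← C_ofNat, ← C_mul]
    norm_num
  rw [firstPoly, h1, show 2 * (γ + s) = (γ + s) * 2 by ring, pow_mul]
  linear_combination (X ^ (γ + s) * (X ^ (γ - s + 1) - 1)) * h2

lemma trinomial_natDegree {m n : ℕ} (hmn : m < n) :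
    (X ^ n - C (1 / 2) * (X ^ m - 1) : k[X]).Monic ∧
      (X ^ n - C (1 / 2) * (X ^ m - 1) : k[X]).natDegree = n := by
  have hlt : (C (1 / 2) * (X ^ m - 1) : k[X]).natDegree < (X ^ n : k[X]).natDegree := by
    rw [natDegree_X_pow]
    refine (natDegree_C_mul_le _ _).trans_lt ?_
    rw [← C_1, natDegree_X_pow_sub_C]
    exact hmn
  refine ⟨(monic_X_pow _).sub_of_left (degree_lt_degree hlt), ?_⟩
  rw [natDegree_sub_eq_left_of_natDegree_lt hlt, natDegree_X_pow]

/-- A double root satisfies `(n - m) x^m = n` and `2 (n - m) x^n = m`. Eliminating `x` gives `(2 (n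
- m))^m n^n = (n - m)^n m^m`, an identity of natural numbers in characteristic zero, but its left
side is strictly larger. -/
lemma trinomial_no_double_root {m n : ℕ} (hm : 0 < m) (hmn : m < n) (x : k)
    (hx : (X ^ n - C (1 / 2) * (X ^ m - 1) : k[X]).eval x = 0) :
    (derivative (X ^ n - C (1 / 2) * (X ^ m - 1) : k[X])).eval x ≠ 0 := by
  intro hx'
  simp [derivative_X_pow] at hx hx'
  obtain ⟨d, rfl⟩ := Nat.exists_eq_add_of_lt hmn
  have e1 : x ^ (m + d + 1) * 2 = x ^ m - 1 := by
    linear_combination 2 * hx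
  have e2 : 2 * ((m + d + 1 : ℕ) : k) * x ^ (m + d + 1) = m * x ^ m := by
    obtain ⟨m, rfl⟩ := Nat.exists_eq_succ_of_ne_zero hm.ne'
    simp only [Nat.succ_eq_add_one, Nat.add_sub_cancel] at hx' ⊢
    rw [pow_succ x m, pow_succ x (m + 1 + d)]
    push_cast at hx' ⊢
    linear_combination 2 * x * hx'
  have e3 : ((d + 1 : ℕ) : k) * x ^ m = ((m + d + 1 : ℕ) : k) := by
    push_cast at e2 ⊢
    linear_combination e2 - ((m : k) + d + 1) * e1
  have e4 : ((2 * (d + 1) : ℕ) : k) * x ^ (m + d + 1) = (m : k) := by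
    push_cast at e3 ⊢
    linear_combination ((d : k) + 1) * e1 + e3
  have e5 : ((2 * (d + 1) : ℕ) : k) ^ m * ((m + d + 1 : ℕ) : k) ^ (m + d + 1) =
      ((d + 1 : ℕ) : k) ^ (m + d + 1) * (m : k) ^ m := by
    have h1 := congrArg (· ^ (m + d + 1)) e3
    have h2 := congrArg (· ^ m) e4
    simp only [mul_pow _ (x ^ m), mul_pow _ (x ^ (m + d + 1)), ← pow_mul] at h1 h2
    rw [← h1, ← h2, mul_comm m]
    ring
  have e6 : (2 * (d + 1)) ^ m * (m + d + 1) ^ (m + d + 1) = (d + 1) ^ (m + d + 1) * m ^ m := by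
    exact_mod_cast e5
  have h1 : m ^ m * (d + 1) ^ (d + 1) ≤ (m + d + 1) ^ (m + d + 1) := by
    rw [add_assoc, pow_add (m + (d + 1))]
    exact Nat.mul_le_mul (Nat.pow_le_pow_left (by omega) _) (Nat.pow_le_pow_left (by omega) _)
  have h2 : (d + 1) ^ m < (2 * (d + 1)) ^ m := Nat.pow_lt_pow_left (by omega) hm.ne'
  have h4 : (d + 1) ^ m * (m ^ m * (d + 1) ^ (d + 1)) <
      (2 * (d + 1)) ^ m * (m + d + 1) ^ (m + d + 1) :=
    Nat.mul_lt_mul_of_lt_of_le h2 h1 (by positivity)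
  rw [e6, add_assoc, pow_add] at h4
  exact absurd h4 (by rw [not_lt]; exact le_of_eq (by ring))

lemma isOddHyperelliptic_firstPoly {γ s : ℕ} (hs : 1 ≤ s) (hsγ : s ≤ γ) :
    IsOddHyperelliptic γ (firstPoly k γ s) := by
  obtain ⟨hm, hd⟩ := trinomial_natDegree (k := k) (m := γ - s + 1) (n := γ + s) (by omega)
  have hP : (X ^ (γ - s + 1) - 1 : k[X]).Monic := by
    rw [← C_1]
    exact monic_X_pow_sub_C _ (by omega)
  rw [firstPoly_eq]
  refine ⟨hP.mul hm, ?_, ?_⟩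
  · rw [hP.natDegree_mul hm, hd, ← C_1, natDegree_X_pow_sub_C]
    omega
  · refine Separable.mul ?_ (isCoprime_of_no_common_root fun x hx =>
      trinomial_no_double_root (by omega) (by omega) x hx)
      (isCoprime_of_no_common_root fun x hx => ?_)
    · rw [X_pow_sub_one_separable_iff]
      exact Nat.cast_ne_zero.2 (Nat.succ_ne_zero _)
    · simp only [eval_sub, eval_pow, eval_X, eval_one, eval_mul] at hx ⊢
      rw [hx, mul_zero, sub_zero]
      refine pow_ne_zero _ ?_
      rintro rfl
      simp at hx

lemma exists_prod_nthRoots {m : ℕ} (hm : 0 < m) :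
    ∏ ξ : nthRootsFinset m (1 : k), (X - C ξ.1) = (X ^ m - 1 : k[X]) ∧
      Fintype.card (nthRootsFinset m (1 : k)) = m := by
  have : NeZero (m : k) := ⟨Nat.cast_ne_zero.2 hm.ne'⟩
  have : NeZero m := ⟨hm.ne'⟩
  obtain ⟨ζ, hζ⟩ := HasEnoughRootsOfUnity.exists_primitiveRoot k m
  refine ⟨?_, by rw [Fintype.card_coe, hζ.card_nthRootsFinset]⟩
  rw [X_pow_sub_one_eq_prod hm hζ]
  exact Finset.prod_coe_sort (nthRootsFinset m (1 : k)) fun ξ => X - C ξ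

/-- The function is `β (1 - x^(γ-s+1)) - y`, with norm `-x^(γ+s) (x^(γ-s+1) - 1)`; its pole order
`2γ + 1` is the least for a function involving `y`. -/
lemma first_family {γ s : ℕ} (hs : 1 ≤ s) (hsγ : s ≤ γ) (β : k) (hβ : β ^ 2 = -1 / 2) :
    ∃ (hp : β ^ 2 = (firstPoly k γ s).eval 0)
      (hw : ∀ ξ ∈ nthRootsFinset (γ - s + 1) (1 : k), (0 : k) ^ 2 = (firstPoly k γ s).eval ξ),
      (γ + s) • pointClass (.affine 0 β hp) =
        ∑ ξ ∈ (nthRootsFinset (γ - s + 1) (1 : k)).attach,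
          pointClass (.affine ξ.1 0 (hw ξ.1 ξ.2)) ∧
      addOrderOf (pointClass (.affine 0 β hp)) = 2 * γ + 2 * s ∧
      HasMultProfile (pointClass (.affine 0 β hp))
        (stairProfile γ (2 * γ + 1) (2 * γ + 2 * s)) := by
  have hodd := isOddHyperelliptic_firstPoly (k := k) hs hsγ
  have hβ0 : β ≠ 0 := by
    rintro rfl
    norm_num at hβ
  have hp : β ^ 2 = (firstPoly k γ s).eval 0 := by
    rw [hβ, firstPoly_eq]
    simp [zero_pow (by omega : γ + s ≠ 0), neg_div]
  have hw : ∀ ξ ∈ nthRootsFinset (γ - s + 1) (1 : k),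
      (0 : k) ^ 2 = (firstPoly k γ s).eval ξ := by
    intro ξ hξ
    rw [mem_nthRootsFinset (by omega)] at hξ
    rw [firstPoly_eq]
    simp [hξ]
  obtain ⟨hprod, hcard⟩ := exists_prod_nthRoots (k := k) (m := γ - s + 1) (by omega)
  have hN : (C β * (1 - X ^ (γ - s + 1))) ^ 2 - firstPoly k γ s = C (-1) * X ^ (γ + s) *
      ∏ ξ : nthRootsFinset (γ - s + 1) (1 : k), (X - C ξ.1) := by
    have hβ' : (C β : k[X]) ^ 2 = -C (1 / 2) := by rw [← C_pow, hβ, ← C_neg, neg_div]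
    rw [hprod, firstPoly_eq, C_neg, C_1]
    linear_combination (1 - X ^ (γ - s + 1)) ^ 2 * hβ'
  obtain ⟨h1, -, h3, h4, -⟩ := half_order hodd hp hβ0
    (w := fun ξ : nthRootsFinset (γ - s + 1) (1 : k) => ξ.1) Subtype.val_injective
    (fun ξ => hw ξ.1 ξ.2) (v := C β * (1 - X ^ (γ - s + 1))) (by simp)
    (neg_ne_zero.2 one_ne_zero) hN
  rw [hcard] at h4
  exact ⟨hp, hw, h1, order_profile_of_succ (by omega) hodd hp hβ0 (by omega) (by omega) (by omega)
    h3 (h4.mono le_rfl (by omega))⟩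

end FirstFamily

/-! ### Which profiles occur, and their number. -/

section Occurrence

variable (k : Type*) [Field k] [CharZero k] [IsAlgClosed k]

lemma first_mem_torsionProfiles {γ s : ℕ} (hs : 1 ≤ s) (hsγ : s ≤ γ) :
    stairProfile γ (2 * γ + 1) (2 * γ + 2 * s) ∈ torsionProfiles k γ (2 * γ + 2 * s) := by
  obtain ⟨β, hβ⟩ := IsAlgClosed.exists_pow_nat_eq (-1 / 2 : k) two_pos
  obtain ⟨hp, hw, -, h2, h3⟩ := first_family hs hsγ β hβ
  exact ⟨_, isOddHyperelliptic_firstPoly hs hsγ, 0, β, hp, h2, h3⟩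

lemma second_mem_torsionProfiles {γ s : ℕ} (hs : 1 ≤ s) (hsγ : s ≤ γ) :
    stairProfile γ (2 * γ + 2) (4 * γ + 4 - 2 * s) ∈
      torsionProfiles k γ (4 * γ + 4 - 2 * s) := by
  obtain ⟨a, b, hS, hsep, ha, hb⟩ := second_witness (k := k) (γ := γ) (s := s) (r := γ + 1 - s)
    (by omega) (by omega)
  obtain ⟨-, -, h⟩ := second_family (γ := γ) (by omega) (by omega) a b hS hsep ha hb
  obtain ⟨hodd, h'⟩ := h _ _ rfl rfl
  obtain ⟨κ, hκ⟩ := IsAlgClosed.exists_pow_nat_eq (-(∑ i, a i + 2 * ∑ j, b j)⁻¹) two_pos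
  obtain ⟨hp, -, -, -, h3⟩ := h' κ _ hκ rfl
  exact ⟨_, hodd, 0, _, hp, h3 hs hsγ⟩

lemma fourth_mem_torsionProfiles {γ : ℕ} (hγ : 2 ≤ γ) :
    stairProfile γ (2 * γ + 3) (2 * γ + 6) ∈ torsionProfiles k γ (2 * γ + 6) := by
  obtain ⟨a, b, hab, hc, hsep, ha, hb⟩ := fourth_witness (k := k) hγ
  obtain ⟨-, -, -, -, -, h⟩ := fourth_family hγ a b hab hc hsep ha hb
  obtain ⟨hodd, h'⟩ := h _ _ rfl rfl
  obtain ⟨κ, hκ⟩ := IsAlgClosed.exists_pow_nat_eq (-(fourthAux a b).leadingCoeff⁻¹) two_pos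
  obtain ⟨hp, -, -, h3⟩ := h' κ _ hκ rfl
  exact ⟨_, hodd, 0, _, hp, h3⟩

lemma stairProfile_half (γ M : ℕ) {n : ℕ} (hn : 0 < n) :
    stairProfile γ M (2 * n) n = min n (min γ (M - n)) := by
  have h1 : n % (2 * n) = n := Nat.mod_eq_of_lt (by omega)
  simp only [stairProfile, h1]
  rw [show 2 * n - n = n by omega, min_self]

/-- The staircases are told apart at the middle of the period, where the descent is deepest. -/
lemma stairProfile_ne {γ M M' n N : ℕ} (hN : N = 2 * n) (hn : 0 < n)
    (h : min n (min γ (M - n)) ≠ min n (min γ (M' - n))) :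
    stairProfile γ M N ≠ stairProfile γ M' N := by
  subst hN
  intro heq
  apply h
  rw [← stairProfile_half γ M hn, ← stairProfile_half γ M' hn, heq]

lemma torsionProfiles_add_four {γ : ℕ} (hγ : 2 ≤ γ) :
    torsionProfiles k γ (2 * γ + 4) =
      {stairProfile γ (2 * γ + 2) (2 * γ + 4), stairProfile γ (2 * γ + 1) (2 * γ + 4)} ∧
    (torsionProfiles k γ (2 * γ + 4)).ncard = 2 := by
  have heq : torsionProfiles k γ (2 * γ + 4) =
      {stairProfile γ (2 * γ + 2) (2 * γ + 4), stairProfile γ (2 * γ + 1) (2 * γ + 4)} := by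
    refine (torsionProfiles_add_four_subset hγ).antisymm ?_
    rintro ε (rfl | rfl)
    · have := second_mem_torsionProfiles k (γ := γ) (s := γ) (by omega) le_rfl
      rwa [show 4 * γ + 4 - 2 * γ = 2 * γ + 4 by omega] at this
    · exact first_mem_torsionProfiles k (s := 2) (by omega) hγ
  refine ⟨heq, ?_⟩
  rw [heq]
  exact Set.ncard_pair (stairProfile_ne (n := γ + 2) (by omega) (by omega) (by omega))

lemma second_mem_torsionProfiles_add_six {γ : ℕ} (hγ : 2 ≤ γ) :
    stairProfile γ (2 * γ + 2) (2 * γ + 6) ∈ torsionProfiles k γ (2 * γ + 6) := by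
  have := second_mem_torsionProfiles k (γ := γ) (s := γ - 1) (by omega) (by omega)
  rwa [show 4 * γ + 4 - 2 * (γ - 1) = 2 * γ + 6 by omega] at this

lemma torsionProfiles_add_six {γ : ℕ} (hγ : 3 ≤ γ) :
    stairProfile γ (2 * γ + 1) (2 * γ + 6) ∈ torsionProfiles k γ (2 * γ + 6) ∧
      (torsionProfiles k γ (2 * γ + 6)).ncard = 3 := by
  have h1 : stairProfile γ (2 * γ + 1) (2 * γ + 6) ∈ torsionProfiles k γ (2 * γ + 6) :=
    first_mem_torsionProfiles k (s := 3) (by omega) hγ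
  refine ⟨h1, ?_⟩
  have heq := (torsionProfiles_add_six_subset (k := k) (γ := γ) (by omega)).antisymm (by
    rintro ε (rfl | rfl | rfl)
    exacts [fourth_mem_torsionProfiles k (by omega),
      second_mem_torsionProfiles_add_six k (by omega), h1])
  rw [heq, Set.ncard_eq_three]
  exact ⟨_, _, _, stairProfile_ne (n := γ + 3) (by omega) (by omega) (by omega),
    stairProfile_ne (n := γ + 3) (by omega) (by omega) (by omega),
    stairProfile_ne (n := γ + 3) (by omega) (by omega) (by omega), rfl⟩

end Occurrence

end

theorem mainTheorem8 (k : Type*) [Field k] [IsAlgClosed k] [CharZero k] (γ : ℕ) (hγ : 1 ≤ γ) :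
    -- First family: torsion order `2γ + 2s` for `1 ≤ s ≤ γ`.
    (∀ s : ℕ, 1 ≤ s → s ≤ γ →
      IsOddHyperelliptic γ (firstPoly k γ s) ∧
      ∀ β : k, β ^ 2 = -1 / 2 →
        ∃ (hp : β ^ 2 = (firstPoly k γ s).eval 0)
          (hw : ∀ ξ ∈ nthRootsFinset (γ - s + 1) (1 : k), (0 : k) ^ 2 = (firstPoly k γ s).eval ξ),
          (γ + s) • pointClass (.affine 0 β hp) =
            ∑ ξ ∈ (nthRootsFinset (γ - s + 1) (1 : k)).attach,
              pointClass (.affine ξ.1 0 (hw ξ.1 ξ.2)) ∧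
          addOrderOf (pointClass (.affine 0 β hp)) = 2 * γ + 2 * s ∧
          HasMultProfile (pointClass (.affine 0 β hp))
            (stairProfile γ (2 * γ + 1) (2 * γ + 2 * s))) ∧
    -- Any point class of order `2γ + 2` has the profile of the first family with `s = 1`.
    (∀ f : k[X], IsOddHyperelliptic γ f → ∀ (a b : k) (h : b ^ 2 = f.eval a),
      addOrderOf (pointClass (.affine a b h)) = 2 * γ + 2 →
        HasMultProfile (pointClass (.affine a b h)) (stairProfile γ (2 * γ + 1) (2 * γ + 2))) ∧
    -- Second family: torsion order `4γ + 4 - 2s` for `1 ≤ s ≤ γ`; general `(a, b)`.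
    (∀ s r : ℕ, s + r = γ + 1 →
      ∃ F : MvPolynomial (Fin s ⊕ Fin r) k, F ≠ 0 ∧
      ∀ (a : Fin s → k) (b : Fin r → k), F.eval (Sum.elim a b) ≠ 0 →
        ∑ i, a i + 2 * ∑ j, b j ≠ 0 ∧
        (secondAux a b).Separable ∧ (secondAux a b).natDegree = 2 * γ + 1 - s ∧
        ∀ (c : k) (f : k[X]), c = (∑ i, a i + 2 * ∑ j, b j)⁻¹ →
          f = C c * rootPoly a * secondAux a b →
          IsOddHyperelliptic γ f ∧
          ∀ (κ : k) (v : k[X]), κ ^ 2 = -c → v = C κ * rootPoly a * rootPoly b →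
            ∃ (hp : v.eval 0 ^ 2 = f.eval 0) (hw : ∀ i, (0 : k) ^ 2 = f.eval (a i)),
              (2 * γ + 2 - s) • pointClass (.affine 0 (v.eval 0) hp) =
                ∑ i, pointClass (.affine (a i) 0 (hw i)) ∧
              2 • ∑ i, pointClass (.affine (a i) 0 (hw i)) = 0 ∧
              (1 ≤ s → s ≤ γ →
                addOrderOf (pointClass (.affine 0 (v.eval 0) hp)) = 4 * γ + 4 - 2 * s ∧
                HasMultProfile (pointClass (.affine 0 (v.eval 0) hp))
                  (stairProfile γ (2 * γ + 2) (4 * γ + 4 - 2 * s)))) ∧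
    -- Third family: torsion order `4γ + 2 - 2s` for `1 ≤ s ≤ γ - 1`; general `(a, b, c)`.
    (∀ s : ℕ, 1 ≤ s → s + 1 ≤ γ →
      ∃ F : MvPolynomial (Fin s ⊕ Fin 2) k, F ≠ 0 ∧
      ∀ (a : Fin s → k) (b c : k), F.eval (Sum.elim a ![b, c]) ≠ 0 →
        c ≠ 0 ∧ (thirdAux (2 * γ + 1 - s) a b c).Separable ∧
        (thirdAux (2 * γ + 1 - s) a b c).natDegree = 2 * γ + 1 - s ∧
        ∀ f : k[X], f = C c⁻¹ * rootPoly a * thirdAux (2 * γ + 1 - s) a b c →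
          IsOddHyperelliptic γ f ∧
          ∀ (κ : k) (v : k[X]), κ ^ 2 = c⁻¹ → v = C κ * rootPoly a * (X - C b) →
            ∃ (hp : v.eval 0 ^ 2 = f.eval 0) (hw : ∀ i, (0 : k) ^ 2 = f.eval (a i)),
              (2 * γ + 1 - s) • pointClass (.affine 0 (v.eval 0) hp) =
                ∑ i, pointClass (.affine (a i) 0 (hw i)) ∧
              addOrderOf (pointClass (.affine 0 (v.eval 0) hp)) = 4 * γ + 2 - 2 * s ∧
              HasMultProfile (pointClass (.affine 0 (v.eval 0) hp))
                (stairProfile γ (2 * γ + 1) (4 * γ + 2 - 2 * s))) ∧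
    -- Among all point classes of order `4γ + 2 - 2s`, this is the profile that minimizes
    -- the entry at `2γ + 1 - s`.
    (∀ s : ℕ, 1 ≤ s → s + 1 ≤ γ → ∀ ε ∈ torsionProfiles k γ (4 * γ + 2 - 2 * s),
      s ≤ ε (2 * γ + 1 - s) ∧
      (ε (2 * γ + 1 - s) = s → ε = stairProfile γ (2 * γ + 1) (4 * γ + 2 - 2 * s))) ∧
    -- Fourth family: torsion order `2γ + 6`; general points of the locus `e₁ = e₂ = 0`.
    (2 ≤ γ →
      ∃ F : MvPolynomial (Fin (γ + 1) ⊕ Unit) k,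
      (∃ z ∈ fourthLocus k (γ + 1), F.eval (Sum.elim z.1 fun _ => z.2) ≠ 0) ∧
      ∀ (a : Fin (γ + 1) → k) (b : k), (a, b) ∈ fourthLocus k (γ + 1) →
        F.eval (Sum.elim a fun _ => b) ≠ 0 →
        a.Injective ∧ (∀ i, a i ≠ 0) ∧ b ≠ 0 ∧
        (fourthAux a b).Separable ∧ (fourthAux a b).natDegree = γ ∧
        ∀ (c : k) (f : k[X]), c = (fourthAux a b).leadingCoeff →
          f = C c⁻¹ * rootPoly a * fourthAux a b →
          IsOddHyperelliptic γ f ∧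
          ∀ (κ : k) (v : k[X]), κ ^ 2 = -c⁻¹ → v = C κ * rootPoly a * (X - C b) →
            ∃ (hp : v.eval 0 ^ 2 = f.eval 0) (hw : ∀ i, (0 : k) ^ 2 = f.eval (a i)),
              (γ + 3) • pointClass (.affine 0 (v.eval 0) hp) =
                ∑ i, pointClass (.affine (a i) 0 (hw i)) ∧
              addOrderOf (pointClass (.affine 0 (v.eval 0) hp)) = 2 * γ + 6 ∧
              HasMultProfile (pointClass (.affine 0 (v.eval 0) hp))
                (stairProfile γ (2 * γ + 3) (2 * γ + 6))) ∧
    -- Order `2γ + 4`: there are exactly two profiles.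
    (2 ≤ γ →
      torsionProfiles k γ (2 * γ + 4) =
        {stairProfile γ (2 * γ + 2) (2 * γ + 4), stairProfile γ (2 * γ + 1) (2 * γ + 4)} ∧
      (torsionProfiles k γ (2 * γ + 4)).ncard = 2) ∧
    -- Order `2γ + 6`: there are three candidates, `(ε_{γ+2}, ε_{γ+3})` being `(γ, γ)`,
    -- `(γ, γ - 1)` or `(γ - 1, γ - 2)`; the first two occur, and so does the third if `γ ≥ 3`.
    (2 ≤ γ →
      torsionProfiles k γ (2 * γ + 6) ⊆
        {stairProfile γ (2 * γ + 3) (2 * γ + 6), stairProfile γ (2 * γ + 2) (2 * γ + 6),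
          stairProfile γ (2 * γ + 1) (2 * γ + 6)} ∧
      stairProfile γ (2 * γ + 3) (2 * γ + 6) ∈ torsionProfiles k γ (2 * γ + 6) ∧
      stairProfile γ (2 * γ + 2) (2 * γ + 6) ∈ torsionProfiles k γ (2 * γ + 6) ∧
      (3 ≤ γ → stairProfile γ (2 * γ + 1) (2 * γ + 6) ∈ torsionProfiles k γ (2 * γ + 6) ∧
        (torsionProfiles k γ (2 * γ + 6)).ncard = 3)) := by
  refine ⟨fun s hs hsγ => ⟨isOddHyperelliptic_firstPoly hs hsγ, fun β hβ =>
      first_family hs hsγ β hβ⟩,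
    fun f hf a b h ho => profile_order_add_two hγ hf h ho, fun s r hsr => ?_,
    fun s hs hsγ => ?_, fun s hs hsγ ε hε => profile_minimal hs hsγ hε, fun hγ2 => ?_,
    fun hγ2 => torsionProfiles_add_four k hγ2, fun hγ2 => ⟨torsionProfiles_add_six_subset hγ2,
      fourth_mem_torsionProfiles k hγ2, second_mem_torsionProfiles_add_six k hγ2,
      fun hγ3 => torsionProfiles_add_six k hγ3⟩⟩
  · obtain ⟨F, hF, h⟩ := second_generic (k := k) hγ hsr
    refine ⟨F, hF, fun a b hab => ?_⟩
    obtain ⟨hS, hsep, ha, hb⟩ := h a b hab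
    exact ⟨hS, second_family hγ hsr a b hS hsep ha hb⟩
  · obtain ⟨F, hF, h⟩ := third_generic (k := k) hsγ
    refine ⟨F, hF, fun a b c habc => ?_⟩
    obtain ⟨hc, hsep, ha, hb⟩ := h a b c habc
    exact ⟨hc, third_family hs hsγ a b c hc hsep ha hb⟩
  · obtain ⟨F, hF, h⟩ := fourth_generic (k := k) hγ2
    refine ⟨F, hF, fun a b hab hFab => ?_⟩
    obtain ⟨hc, hsep, ha, hb⟩ := h a b hab hFab
    exact fourth_family hγ2 a b hab hc hsep ha hb
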